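/- **Setting.** Let $\hat E_f$ be the set of fuzzy numbers $z:\mathbb R\to[0,1]$ (normal, fuzzy convex, upper semicontinuous, compactly supported) whose level map $r\mapsto[z]^r=[\underline z_r,\overline z_r]$ is continuous on $[0,1]$ for the Hausdorff distance $d_H$. Here $[z]^r=\{z\ge r\}$ for $r>0$, and $[z]^0$ is the closure of $\{z>0\}$. Equip $\hat E_f$ with level-wise addition and multiplication by reals and with the metric $\mathbb D(p,q)=\sup_{0\le r\le 1}d_H([p]^r,[q]^r)$. The Hukuhara difference $p\ominus q$ is the $w$ with $p=q+w$, if it exists. The gH-difference $p\ominus_{gH}q$ is the $w$ with $p=q+w$ or $q=p+(-1)w$. The gH-derivative is the $\mathbb D$-limit of $h^{-1}\bigl(f(x+h)\ominus_{gH}f(x)\bigr)$. It is of type (i) if its level sets are $[\underline f_r',\overline f_r']$ for all $r$, and of type (ii) if they are $[\overline f_r',\underline f_r']$ for all $r$. Let $a,b,\rho_1,\rho_2,R_1,R_2>0$, $\varphi=(\varphi_1,\varphi_2)$, $\psi=(\psi_1,\psi_2)\in(0,1]^2$, $\Omega=(0,a]\times(0,b]$ and $\overline\Omega=[0,a]\times[0,b]$.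 For $\alpha=(\alpha_1,\alpha_2)\in(0,1]^2$ let $$\mathfrak I^{\alpha,\rho}u(x,y)=\frac{\rho_1^{1-\alpha_1}\rho_2^{1-\alpha_2}}{\Gamma(\alpha_1)\Gamma(\alpha_2)}\int_0^x\!\!\int_0^y\frac{s^{\rho_1-1}t^{\rho_2-1}}{(x^{\rho_1}-s^{\rho_1})^{1-\alpha_1}(y^{\rho_2}-t^{\rho_2})^{1-\alpha_2}}\,u(s,t)\,dt\,ds ,$$ taken on the end points of the level sets of $u$. In a variable in which the order is $0$, the integral is replaced by evaluation at $x$ (respectively $y$). The type-(1) Caputo–Katugampola derivative of order $\alpha$ of $\upsilon:\overline\Omega\to\hat E_f$ is $${}^C\mathfrak D^{\alpha,\rho}\upsilon=x^{1-\rho_1}y^{1-\rho_2}\,\partial^2_{xy}U\ \text{ on }\Omega,\quad U=\mathfrak I^{1-\alpha,\rho}u,\quad u(x,y)=\bigl(\upsilon(x,y)\ominus\upsilon(x,0)\bigr)\ominus\bigl(\upsilon(0,y)\ominus\upsilon(0,0)\bigr),$$ where the Hukuhara differences exist on $\overline\Omega$, $\partial^2_{xy}U$ is the gH-derivative in $y$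 of $\partial_xU$, and throughout $\Omega$ both $U$ (in $x$) and $\partial_x U$ (in $y$) are of type (i), or both are of type (ii). **Theorem.** Let $\mathcal F,\mathcal G:\Omega\times\hat E_f\times\hat E_f\to\hat E_f$ be continuous, with $\mathbb D(\mathcal F(x,y,0,0),0)$ and $\mathbb D(\mathcal G(x,y,0,0),0)$ bounded on $\Omega$. Suppose that for all $(x,y)\in\Omega$ and $\upsilon,\omega,\hat\upsilon,\hat\omega\in\hat E_f$ $$\mathbb D(\mathcal F(x,y,\upsilon,\omega),\mathcal F(x,y,\hat\upsilon,\hat\omega))\le R_1\bigl(\mathbb D(\upsilon,\hat\upsilon)+\mathbb D(\omega,\hat\omega)\bigr),$$ $$\mathbb D(\mathcal G(x,y,\upsilon,\omega),\mathcal G(x,y,\hat\upsilon,\hat\omega))\le R_2\bigl(\mathbb D(\upsilon,\hat\upsilon)+\mathbb D(\omega,\hat\omega)\bigr).$$ Let $\xi_1,\eta_1:[0,a]\to\hat E_f$ and $\xi_2,\eta_2:[0,b]\to\hat E_f$ be continuous with $\xi_1(0)=\xi_2(0)$ and $\eta_1(0)=\eta_2(0)$, and such that $\xi_2(y)\ominus\xi_1(0)$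 and $\eta_2(y)\ominus\eta_1(0)$ exist for all $y\in[0,b]$. Suppose $$\Xi_1=\frac{R_1}{\Gamma(\varphi_1+1)\Gamma(\varphi_2+1)}\Bigl(\frac{a^{\rho_1}}{\rho_1}\Bigr)^{\varphi_1}\Bigl(\frac{b^{\rho_2}}{\rho_2}\Bigr)^{\varphi_2}<1,\qquad \Xi_2=\frac{R_2}{\Gamma(\psi_1+1)\Gamma(\psi_2+1)}\Bigl(\frac{a^{\rho_1}}{\rho_1}\Bigr)^{\psi_1}\Bigl(\frac{b^{\rho_2}}{\rho_2}\Bigr)^{\psi_2}<1 .$$ Then the coupled system $${}^C\mathfrak D^{\varphi,\rho}\upsilon=\mathcal F(x,y,\upsilon,\omega),\quad {}^C\mathfrak D^{\psi,\rho}\omega=\mathcal G(x,y,\upsilon,\omega)\quad\text{on }\Omega,$$ $$\upsilon(x,0)=\xi_1(x),\ \ \upsilon(0,y)=\xi_2(y),\ \ \omega(x,0)=\eta_1(x),\ \ \omega(0,y)=\eta_2(y)$$ with type-(1) derivatives has exactly one solution $(\upsilon,\omega)$ in $C(\overline\Omega,\hat E_f)\times C(\overline\Omega,\hat E_f)$.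 This pair is also the unique solution in $C(\overline\Omega,\hat E_f)\times C(\overline\Omega,\hat E_f)$ of the integral system $$\upsilon=\xi_1(x)+\bigl(\xi_2(y)\ominus\xi_1(0)\bigr)+\mathfrak I^{\varphi,\rho}[\mathcal F(\cdot,\cdot,\upsilon,\omega)],\qquad \omega=\eta_1(x)+\bigl(\eta_2(y)\ominus\eta_1(0)\bigr)+\mathfrak I^{\psi,\rho}[\mathcal G(\cdot,\cdot,\upsilon,\omega)]\quad\text{on }\overline\Omega.$$ -/

import Mathlib

open Set Filter Topology MeasureTheory
open scoped Pointwise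

/-- A fuzzy number: a normal, fuzzy convex, upper semicontinuous, compactly supported map
from the real line to the unit interval. -/
structure FuzzyNumber where
  toFun : ℝ → ℝ
  mem_Icc' : ∀ x, toFun x ∈ Icc (0 : ℝ) 1
  normal' : ∃ x, toFun x = 1
  fuzzyConvex' : ∀ x y t : ℝ, 0 ≤ t → t ≤ 1 →
    min (toFun x) (toFun y) ≤ toFun (t * x + (1 - t) * y)
  usc' : UpperSemicontinuous toFun
  compactSupport' : HasCompactSupport toFun

namespace FuzzyNumber

/-- The `r`-level set: `{x | r ≤ z x}` for `0 < r`, and the closure of `{x | z x ≠ 0}` for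
`r = 0`. -/
noncomputable def level (z : FuzzyNumber) (r : ℝ) : Set ℝ :=
  if r ≤ 0 then tsupport z.toFun else {x | r ≤ z.toFun x}

/-- Left end point of the `r`-level set. -/
noncomputable def lower (z : FuzzyNumber) (r : ℝ) : ℝ := sInf (z.level r)

/-- Right end point of the `r`-level set. -/
noncomputable def upper (z : FuzzyNumber) (r : ℝ) : ℝ := sSup (z.level r)

theorem level_zero (z : FuzzyNumber) : z.level 0 = tsupport z.toFun := by simp [level]

theorem level_of_pos (z : FuzzyNumber) {r : ℝ} (hr : 0 < r) :
    z.level r = {x | r ≤ z.toFun x} := by simp [level, not_le.2 hr]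

theorem level_subset (z : FuzzyNumber) {r q : ℝ} (h : r ≤ q) : z.level q ⊆ z.level r := by
  intro x hx
  rcases le_or_gt q 0 with hq | hq
  · simpa [level, hq, h.trans hq] using hx
  · rw [level_of_pos z hq] at hx
    rcases le_or_gt r 0 with hr | hr
    · simp only [level, hr, if_true]
      exact subset_tsupport _ (ne_of_gt (lt_of_lt_of_le hq hx))
    · rw [level_of_pos z hr]
      exact h.trans hx

theorem level_nonempty (z : FuzzyNumber) {r : ℝ} (hr : r ≤ 1) : (z.level r).Nonempty := by
  obtain ⟨x, hx⟩ := z.normal'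
  refine ⟨x, z.level_subset hr ?_⟩
  rw [level_of_pos z one_pos]
  exact hx.ge

theorem isCompact_level (z : FuzzyNumber) (r : ℝ) : IsCompact (z.level r) := by
  have h0 : IsCompact (z.level 0) := by rw [level_zero]; exact z.compactSupport'
  rcases le_or_gt r 0 with hr | hr
  · have : z.level r = z.level 0 := by simp [level, hr]
    rw [this]; exact h0
  · refine h0.of_isClosed_subset ?_ (z.level_subset hr.le)
    rw [level_of_pos z hr]
    exact z.usc'.isClosed_preimage r

theorem convex_superlevel (z : FuzzyNumber) (r : ℝ) : Convex ℝ {x | r ≤ z.toFun x} := by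
  intro x hx y hy s t hs ht hst
  have h := z.fuzzyConvex' x y s hs (by linarith)
  have : t = 1 - s := by linarith
  subst this
  simp only [mem_ofPred_eq, smul_eq_mul] at *
  exact (le_min hx hy).trans h

theorem convex_level (z : FuzzyNumber) (r : ℝ) : Convex ℝ (z.level r) := by
  rcases le_or_gt r 0 with hr | hr
  · simp only [level, hr, if_true]
    refine Convex.closure ?_
    intro x hx y hy s t hs ht hst
    have h := z.fuzzyConvex' x y s hs (by linarith)
    have : t = 1 - s := by linarith
    subst this
    have hx' : 0 < z.toFun x := lt_of_le_of_ne (z.mem_Icc' x).1 (Ne.symm hx)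
    have hy' : 0 < z.toFun y := lt_of_le_of_ne (z.mem_Icc' y).1 (Ne.symm hy)
    exact ne_of_gt (lt_of_lt_of_le (lt_min hx' hy') h)
  · rw [level_of_pos z hr]
    exact z.convex_superlevel r

/-- The level sets are compact intervals. -/
theorem level_eq_Icc (z : FuzzyNumber) {r : ℝ} (hr : r ≤ 1) :
    z.level r = Icc (z.lower r) (z.upper r) :=
  eq_Icc_of_connected_compact
    ⟨z.level_nonempty hr, (z.convex_level r).isPreconnected⟩ (z.isCompact_level r)

theorem lower_le_upper (z : FuzzyNumber) {r : ℝ} (hr : r ≤ 1) : z.lower r ≤ z.upper r := by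
  have := z.level_nonempty hr
  rwa [z.level_eq_Icc hr, nonempty_Icc] at this

theorem lower_mono (z : FuzzyNumber) {r q : ℝ} (h : r ≤ q) (hq : q ≤ 1) :
    z.lower r ≤ z.lower q :=
  csInf_le_csInf (z.isCompact_level r).bddBelow (z.level_nonempty hq) (z.level_subset h)

theorem upper_anti (z : FuzzyNumber) {r q : ℝ} (h : r ≤ q) (hq : q ≤ 1) :
    z.upper q ≤ z.upper r :=
  csSup_le_csSup (z.isCompact_level r).bddAbove (z.level_nonempty hq) (z.level_subset h)

theorem ext_of_level {z w : FuzzyNumber} (h : ∀ r ∈ Icc (0 : ℝ) 1, z.level r = w.level r) :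
    z = w := by
  have key : ∀ z w : FuzzyNumber, (∀ r ∈ Icc (0 : ℝ) 1, z.level r = w.level r) →
      ∀ x, z.toFun x ≤ w.toFun x := by
    intro z w h x
    rcases (z.mem_Icc' x).1.eq_or_lt with h0 | h0
    · rw [← h0]; exact (w.mem_Icc' x).1
    · have h1 : x ∈ z.level (z.toFun x) := by rw [level_of_pos z h0]; exact le_refl (z.toFun x)
      rw [h _ (z.mem_Icc' x), level_of_pos w h0] at h1
      exact h1
  have hf : z.toFun = w.toFun :=
    funext fun x => le_antisymm (key z w h x) (key w z (fun r hr => (h r hr).symm) x)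
  cases z; cases w; cases hf; rfl

end FuzzyNumber

/-- A fuzzy number whose level map `r ↦ [z]^r` is continuous on `[0, 1]` for the Hausdorff
distance. -/
structure CFuzzy extends FuzzyNumber where
  level_continuous' : ∀ r ∈ Icc (0 : ℝ) 1,
    Tendsto (fun q => Metric.hausdorffDist (toFuzzyNumber.level q) (toFuzzyNumber.level r))
      (𝓝[Icc 0 1] r) (𝓝 0)

namespace CFuzzy

theorem ext_of_level {z w : CFuzzy} (h : ∀ r ∈ Icc (0 : ℝ) 1, z.level r = w.level r) :
    z = w := by
  have := FuzzyNumber.ext_of_level h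
  cases z; cases w; cases this; rfl

theorem hausdorffEDist_level_ne_top (z w : FuzzyNumber) {r q : ℝ} (hr : r ≤ 1) (hq : q ≤ 1) :
    Metric.hausdorffEDist (z.level r) (w.level q) ≠ ⊤ :=
  Metric.hausdorffEDist_ne_top_of_nonempty_of_bounded (z.level_nonempty hr)
    (w.level_nonempty hq) (z.isCompact_level r).isBounded (w.isCompact_level q).isBounded

theorem hausdorffDist_Icc {a b c d : ℝ} (hab : a ≤ b) (hcd : c ≤ d) :
    Metric.hausdorffDist (Icc a b) (Icc c d) = max |a - c| |b - d| := by
  have hne : Metric.hausdorffEDist (Icc a b) (Icc c d) ≠ ⊤ :=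
    Metric.hausdorffEDist_ne_top_of_nonempty_of_bounded (nonempty_Icc.2 hab)
      (nonempty_Icc.2 hcd) (Metric.isBounded_Icc _ _) (Metric.isBounded_Icc _ _)
  have side : ∀ a b c d : ℝ, c ≤ d → ∀ x ∈ Icc a b,
      ∃ y ∈ Icc c d, dist x y ≤ max |a - c| |b - d| := by
    intro a b c d hcd x hx
    refine ⟨max c (min d x), ⟨le_max_left _ _, max_le hcd (min_le_left _ _)⟩, ?_⟩
    rw [Real.dist_eq]
    rcases le_total c x with h1 | h1 <;> rcases le_total d x with h2 | h2
    · rw [min_eq_left h2, max_eq_right hcd, abs_of_nonneg (by linarith)]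
      exact le_max_of_le_right ((sub_le_sub_right hx.2 d).trans (le_abs_self _))
    · rw [min_eq_right h2, max_eq_right h1]
      simp
    · rw [min_eq_left h2, max_eq_right hcd, abs_of_nonneg (by linarith)]
      exact le_max_of_le_right ((sub_le_sub_right hx.2 d).trans (le_abs_self _))
    · rw [min_eq_right h2, max_eq_left h1, abs_sub_comm, abs_of_nonneg (by linarith)]
      refine le_max_of_le_left ?_
      rw [abs_sub_comm]
      exact (sub_le_sub_left hx.1 c).trans (le_abs_self _)
  apply le_antisymm
  · refine Metric.hausdorffDist_le_of_mem_dist (le_max_of_le_left (abs_nonneg _))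
      (side a b c d hcd) ?_
    intro x hx
    obtain ⟨y, hy, h⟩ := side c d a b hab x hx
    refine ⟨y, hy, ?_⟩
    rwa [abs_sub_comm a c, abs_sub_comm b d]
  · have ne1 : (Icc a b).Nonempty := nonempty_Icc.2 hab
    have ne2 : (Icc c d).Nonempty := nonempty_Icc.2 hcd
    refine le_of_forall_gt fun e he => ?_
    have hL : ∀ x ∈ Icc a b, ∃ y ∈ Icc c d, dist x y < e := fun x hx =>
      Metric.exists_dist_lt_of_hausdorffDist_lt hx he hne
    have hR : ∀ y ∈ Icc c d, ∃ x ∈ Icc a b, dist x y < e := fun y hy =>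
      Metric.exists_dist_lt_of_hausdorffDist_lt' hy he hne
    obtain ⟨y1, hy1, k1⟩ := hL a (left_mem_Icc.2 hab)
    obtain ⟨y2, hy2, k2⟩ := hL b (right_mem_Icc.2 hab)
    obtain ⟨x1, hx1, k3⟩ := hR c (left_mem_Icc.2 hcd)
    obtain ⟨x2, hx2, k4⟩ := hR d (right_mem_Icc.2 hcd)
    rw [Real.dist_eq, abs_lt] at k1 k2 k3 k4
    rw [max_lt_iff, abs_lt, abs_lt]
    refine ⟨⟨?_, ?_⟩, ?_, ?_⟩ <;>
      linarith [hy1.1, hy1.2, hy2.1, hy2.2, hx1.1, hx1.2, hx2.1, hx2.2]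

theorem hausdorffDist_level (z w : FuzzyNumber) {r q : ℝ} (hr : r ≤ 1) (hq : q ≤ 1) :
    Metric.hausdorffDist (z.level r) (w.level q)
      = max |z.lower r - w.lower q| |z.upper r - w.upper q| := by
  rw [z.level_eq_Icc hr, w.level_eq_Icc hq,
    hausdorffDist_Icc (z.lower_le_upper hr) (w.lower_le_upper hq)]

theorem bddAbove_levelDist (z w : CFuzzy) :
    BddAbove (range fun r : Icc (0 : ℝ) 1 =>
      Metric.hausdorffDist (z.level r) (w.level r)) := by
  refine ⟨max (max |z.lower 0 - w.lower 1| |z.lower 1 - w.lower 0|)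
    (max |z.upper 0 - w.upper 1| |z.upper 1 - w.upper 0|), ?_⟩
  rintro _ ⟨⟨r, h0, h1⟩, rfl⟩
  simp only
  rw [hausdorffDist_level _ _ h1 h1]
  have a1 := z.lower_mono h0 h1
  have a2 := z.lower_mono h1 le_rfl
  have a3 := w.lower_mono h0 h1
  have a4 := w.lower_mono h1 le_rfl
  have b1 := z.upper_anti h0 h1
  have b2 := z.upper_anti h1 le_rfl
  have b3 := w.upper_anti h0 h1
  have b4 := w.upper_anti h1 le_rfl
  refine max_le_max ?_ ?_
  · rw [abs_le]
    constructor
    · have := (neg_abs_le (z.lower 0 - w.lower 1))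
      have := le_max_left |z.lower 0 - w.lower 1| |z.lower 1 - w.lower 0|
      linarith
    · have := (le_abs_self (z.lower 1 - w.lower 0))
      have := le_max_right |z.lower 0 - w.lower 1| |z.lower 1 - w.lower 0|
      linarith
  · rw [abs_le]
    constructor
    · have := (neg_abs_le (z.upper 1 - w.upper 0))
      have := le_max_right |z.upper 0 - w.upper 1| |z.upper 1 - w.upper 0|
      linarith
    · have := (le_abs_self (z.upper 0 - w.upper 1))
      have := le_max_left |z.upper 0 - w.upper 1| |z.upper 1 - w.upper 0|
      linarith

/-- The metric `D(z, w) = sup_{0 ≤ r ≤ 1} d_H([z]^r, [w]^r)`. -/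
noncomputable instance instMetricSpace : MetricSpace CFuzzy where
  dist z w := ⨆ r : Icc (0 : ℝ) 1, Metric.hausdorffDist (z.level r) (w.level r)
  dist_self z := by simp [Metric.hausdorffDist_self_zero]
  dist_comm z w := by simp only [Metric.hausdorffDist_comm]
  dist_triangle x y z := by
    refine ciSup_le fun r => ?_
    refine (Metric.hausdorffDist_triangle
      (hausdorffEDist_level_ne_top x.toFuzzyNumber y.toFuzzyNumber r.2.2 r.2.2)).trans ?_
    exact add_le_add (le_ciSup (bddAbove_levelDist x y) r) (le_ciSup (bddAbove_levelDist y z) r)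
  eq_of_dist_eq_zero := by
    intro z w h
    refine ext_of_level fun r hr => ?_
    have h1 : Metric.hausdorffDist (z.level r) (w.level r) ≤ 0 := by
      refine le_trans ?_ (le_of_eq h)
      exact le_ciSup (bddAbove_levelDist z w) ⟨r, hr⟩
    exact ((z.isCompact_level r).isClosed.hausdorffDist_zero_iff_eq
      (w.isCompact_level r).isClosed (hausdorffEDist_level_ne_top _ _ hr.2 hr.2)).1
      (le_antisymm h1 Metric.hausdorffDist_nonneg)

theorem dist_def (z w : CFuzzy) :
    dist z w = ⨆ r : Icc (0 : ℝ) 1, Metric.hausdorffDist (z.level r) (w.level r) := rfl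

theorem dist_eq (z w : CFuzzy) :
    dist z w = ⨆ r : Icc (0 : ℝ) 1,
      max |z.lower r - w.lower r| |z.upper r - w.upper r| := by
  rw [dist_def]
  exact iSup_congr fun r => hausdorffDist_level _ _ r.2.2 r.2.2

theorem continuousOn_lower (z : CFuzzy) : ContinuousOn z.lower (Icc 0 1) := by
  intro r hr
  rw [ContinuousWithinAt, tendsto_iff_dist_tendsto_zero]
  refine squeeze_zero' (Eventually.of_forall fun _ => dist_nonneg) ?_ (z.level_continuous' r hr)
  filter_upwards [self_mem_nhdsWithin] with q hq
  rw [hausdorffDist_level _ _ hq.2 hr.2, Real.dist_eq]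
  exact le_max_left _ _

theorem continuousOn_upper (z : CFuzzy) : ContinuousOn z.upper (Icc 0 1) := by
  intro r hr
  rw [ContinuousWithinAt, tendsto_iff_dist_tendsto_zero]
  refine squeeze_zero' (Eventually.of_forall fun _ => dist_nonneg) ?_ (z.level_continuous' r hr)
  filter_upwards [self_mem_nhdsWithin] with q hq
  rw [hausdorffDist_level _ _ hq.2 hr.2, Real.dist_eq]
  exact le_max_right _ _

/-- The fuzzy number with level sets `[l r, u r]`. -/
theorem exists_of_endpoints (l u : ℝ → ℝ) (hl : ContinuousOn l (Icc 0 1))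
    (hu : ContinuousOn u (Icc 0 1)) (hlm : MonotoneOn l (Icc 0 1))
    (hum : AntitoneOn u (Icc 0 1)) (h1 : l 1 ≤ u 1) :
    ∃ z : CFuzzy, ∀ r ∈ Icc (0 : ℝ) 1, z.level r = Icc (l r) (u r) := by
  have i0 : (0 : ℝ) ∈ Icc (0 : ℝ) 1 := ⟨le_rfl, zero_le_one⟩
  have i1 : (1 : ℝ) ∈ Icc (0 : ℝ) 1 := ⟨zero_le_one, le_rfl⟩
  have hlu : ∀ r ∈ Icc (0 : ℝ) 1, l r ≤ u r := fun r hr =>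
    (hlm hr i1 hr.2).trans (h1.trans (hum hr i1 hr.2))
  let S : ℝ → Set ℝ := fun x => {r | r ∈ Icc (0 : ℝ) 1 ∧ x ∈ Icc (l r) (u r)}
  let f : ℝ → ℝ := fun x => sSup (S x)
  have hS : ∀ x, BddAbove (S x) := fun x => ⟨1, fun r hr => hr.1.2⟩
  have hf0 : ∀ x, 0 ≤ f x := fun x => Real.sSup_nonneg fun r hr => hr.1.1
  have hf1 : ∀ x, f x ≤ 1 := fun x => Real.sSup_le (fun r hr => hr.1.2) zero_le_one
  have hSclosed : ∀ x, IsClosed (S x) := by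
    intro x
    have e : S x = (Icc 0 1 ∩ l ⁻¹' Iic x) ∩ (Icc 0 1 ∩ u ⁻¹' Ici x) := by
      ext r
      simp only [S, mem_ofPred_eq, mem_inter_iff, mem_preimage, mem_Iic, mem_Ici, mem_Icc]
      tauto
    rw [e]
    exact (hl.preimage_isClosed_of_isClosed isClosed_Icc isClosed_Iic).inter
      (hu.preimage_isClosed_of_isClosed isClosed_Icc isClosed_Ici)
  have key : ∀ r, 0 < r → r ≤ 1 → ∀ x, r ≤ f x ↔ x ∈ Icc (l r) (u r) := by
    intro r hr hr1 x
    constructor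
    · intro h
      have hne : (S x).Nonempty := by
        by_contra hne
        rw [not_nonempty_iff_eq_empty] at hne
        have : f x = 0 := by simp [f, hne]
        linarith
      have hm : f x ∈ S x := (hSclosed x).csSup_mem hne (hS x)
      have hrm : r ∈ Icc (0 : ℝ) 1 := ⟨hr.le, hr1⟩
      exact ⟨(hlm hrm hm.1 h).trans hm.2.1, hm.2.2.trans (hum hrm hm.1 h)⟩
    · intro h
      exact le_csSup (hS x) ⟨⟨hr.le, hr1⟩, h⟩
  have hsub : Function.support f ⊆ Icc (l 0) (u 0) := by
    intro x hx
    have hpos : 0 < f x := lt_of_le_of_ne (hf0 x) (Ne.symm hx)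
    have h := (key (f x) hpos (hf1 x) x).1 le_rfl
    have hm : f x ∈ Icc (0 : ℝ) 1 := ⟨hf0 x, hf1 x⟩
    exact ⟨(hlm i0 hm hpos.le).trans h.1, h.2.trans (hum i0 hm hpos.le)⟩
  have hts : tsupport f = Icc (l 0) (u 0) := by
    apply Subset.antisymm (closure_minimal hsub isClosed_Icc)
    intro x hx
    -- approximate `x` by its projections to the intervals with `r > 0`
    have hp : Tendsto (fun r => max (l r) (min (u r) x)) (𝓝[Ioc 0 1] (0 : ℝ))
        (𝓝 (max (l 0) (min (u 0) x))) := by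
      have c1 : Tendsto l (𝓝[Ioc 0 1] (0 : ℝ)) (𝓝 (l 0)) :=
        (hl 0 i0).mono_left (nhdsWithin_mono _ Ioc_subset_Icc_self)
      have c2 : Tendsto u (𝓝[Ioc 0 1] (0 : ℝ)) (𝓝 (u 0)) :=
        (hu 0 i0).mono_left (nhdsWithin_mono _ Ioc_subset_Icc_self)
      exact c1.max (c2.min tendsto_const_nhds)
    rw [min_eq_right hx.2, max_eq_right hx.1] at hp
    have : (𝓝[Ioc 0 1] (0 : ℝ)).NeBot := by
      rw [← mem_closure_iff_nhdsWithin_neBot, closure_Ioc (by norm_num)]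
      exact i0
    refine mem_closure_of_tendsto hp ?_
    filter_upwards [self_mem_nhdsWithin] with r hr
    have hrm : r ∈ Icc (0 : ℝ) 1 := ⟨hr.1.le, hr.2⟩
    have := (key r hr.1 hr.2 (max (l r) (min (u r) x))).2
      ⟨le_max_left _ _, max_le (hlu r hrm) (min_le_left _ _)⟩
    exact ne_of_gt (lt_of_lt_of_le hr.1 this)
  have hconv : ∀ x y t : ℝ, 0 ≤ t → t ≤ 1 → min (f x) (f y) ≤ f (t * x + (1 - t) * y) := by
    intro x y t ht ht1
    rcases (le_min (hf0 x) (hf0 y)).eq_or_lt with h | h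
    · rw [← h]; exact hf0 _
    · have hm1 : min (f x) (f y) ≤ 1 := (min_le_left _ _).trans (hf1 x)
      rw [key _ h hm1]
      have hx := (key _ h hm1 x).1 (min_le_left _ _)
      have hy := (key _ h hm1 y).1 (min_le_right _ _)
      have := (convex_Icc (l (min (f x) (f y))) (u (min (f x) (f y)))) hx hy ht
        (sub_nonneg.2 ht1) (by ring)
      simpa using this
  have husc : UpperSemicontinuous f := by
    rw [upperSemicontinuous_iff_isClosed_preimage]
    intro r
    rcases le_or_gt r 0 with h | h
    · have : f ⁻¹' Ici r = univ := by
        ext x; simp only [mem_preimage, mem_Ici, mem_univ, iff_true]; exact h.trans (hf0 x)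
      rw [this]; exact isClosed_univ
    · rcases le_or_gt r 1 with h' | h'
      · have : f ⁻¹' Ici r = Icc (l r) (u r) := by
          ext x; exact key r h h' x
        rw [this]; exact isClosed_Icc
      · have : f ⁻¹' Ici r = ∅ := by
          ext x
          simp only [mem_preimage, mem_Ici, mem_empty_iff_false, iff_false, not_le]
          exact (hf1 x).trans_lt h'
        rw [this]; exact isClosed_empty
  let z : FuzzyNumber :=
    { toFun := f
      mem_Icc' := fun x => ⟨hf0 x, hf1 x⟩
      normal' := ⟨l 1, le_antisymm (hf1 _) ((key 1 one_pos le_rfl _).2 ⟨le_rfl, h1⟩)⟩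
      fuzzyConvex' := hconv
      usc' := husc
      compactSupport' := by
        rw [HasCompactSupport, hts]; exact isCompact_Icc }
  have hz : ∀ r ∈ Icc (0 : ℝ) 1, z.level r = Icc (l r) (u r) := by
    intro r hr
    rcases hr.1.eq_or_lt with h | h
    · rw [← h, z.level_zero]; exact hts
    · rw [z.level_of_pos h]; ext x; exact key r h hr.2 x
  refine ⟨{ toFuzzyNumber := z, level_continuous' := ?_ }, hz⟩
  intro r hr
  have c1 : Tendsto (fun q => |l q - l r|) (𝓝[Icc 0 1] r) (𝓝 0) := by
    have := ((hl r hr).sub_const (l r)).abs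
    simpa using this
  have c2 : Tendsto (fun q => |u q - u r|) (𝓝[Icc 0 1] r) (𝓝 0) := by
    have := ((hu r hr).sub_const (u r)).abs
    simpa using this
  have c3 := c1.max c2
  rw [max_self] at c3
  refine c3.congr' ?_
  filter_upwards [self_mem_nhdsWithin] with q hq
  rw [hz q hq, hz r hr, hausdorffDist_Icc (hlu q hq) (hlu r hr)]

/-- The crisp number zero, with all level sets equal to `{0}`. -/
theorem exists_zero : ∃ z : CFuzzy, ∀ r ∈ Icc (0 : ℝ) 1, z.level r = {0} := by
  obtain ⟨z, hz⟩ := exists_of_endpoints (fun _ => 0) (fun _ => 0) continuousOn_const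
    continuousOn_const (fun _ _ _ _ _ => le_rfl) (fun _ _ _ _ _ => le_rfl) le_rfl
  exact ⟨z, fun r hr => by rw [hz r hr, Icc_self]⟩

theorem exists_add (p q : CFuzzy) :
    ∃ z : CFuzzy, ∀ r ∈ Icc (0 : ℝ) 1, z.level r = p.level r + q.level r := by
  obtain ⟨z, hz⟩ := exists_of_endpoints (fun r => p.lower r + q.lower r)
    (fun r => p.upper r + q.upper r) (p.continuousOn_lower.add q.continuousOn_lower)
    (p.continuousOn_upper.add q.continuousOn_upper)
    (fun _ _ _ hb hab => add_le_add (p.lower_mono hab hb.2) (q.lower_mono hab hb.2))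
    (fun _ _ _ hb hab => add_le_add (p.upper_anti hab hb.2) (q.upper_anti hab hb.2))
    (add_le_add (p.lower_le_upper le_rfl) (q.lower_le_upper le_rfl))
  refine ⟨z, fun r hr => ?_⟩
  rw [hz r hr, p.level_eq_Icc hr.2, q.level_eq_Icc hr.2]
  have hp := p.lower_le_upper hr.2
  have hq := q.lower_le_upper hr.2
  refine Subset.antisymm ?_ (Icc_add_Icc_subset _ _ _ _)
  intro x hx
  refine ⟨max (p.lower r) (x - q.upper r), ⟨le_max_left _ _, max_le hp (by linarith [hx.2])⟩,
    x - max (p.lower r) (x - q.upper r), ⟨?_, ?_⟩, by ring⟩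
  · rcases max_cases (p.lower r) (x - q.upper r) with h | h <;> linarith [hx.1]
  · linarith [le_max_right (p.lower r) (x - q.upper r)]

theorem exists_smul (c : ℝ) (p : CFuzzy) :
    ∃ z : CFuzzy, ∀ r ∈ Icc (0 : ℝ) 1, z.level r = c • p.level r := by
  rcases lt_trichotomy c 0 with hc | hc | hc
  · obtain ⟨z, hz⟩ := exists_of_endpoints (fun r => c * p.upper r) (fun r => c * p.lower r)
      (continuousOn_const.mul p.continuousOn_upper) (continuousOn_const.mul p.continuousOn_lower)
      (fun _ _ _ hb hab => mul_le_mul_of_nonpos_left (p.upper_anti hab hb.2) hc.le)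
      (fun _ _ _ hb hab => mul_le_mul_of_nonpos_left (p.lower_mono hab hb.2) hc.le)
      (mul_le_mul_of_nonpos_left (p.lower_le_upper le_rfl) hc.le)
    refine ⟨z, fun r hr => ?_⟩
    rw [hz r hr, p.level_eq_Icc hr.2]
    ext x
    rw [mem_smul_set_iff_inv_smul_mem₀ hc.ne, smul_eq_mul, mem_Icc, mem_Icc,
      ← div_eq_inv_mul, le_div_iff_of_neg hc, div_le_iff_of_neg hc, mul_comm c, mul_comm c,
      and_comm]
  · subst hc
    obtain ⟨z, hz⟩ := exists_zero
    refine ⟨z, fun r hr => ?_⟩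
    rw [hz r hr, zero_smul_set (p.level_nonempty hr.2)]
    rfl
  · obtain ⟨z, hz⟩ := exists_of_endpoints (fun r => c * p.lower r) (fun r => c * p.upper r)
      (continuousOn_const.mul p.continuousOn_lower) (continuousOn_const.mul p.continuousOn_upper)
      (fun _ _ _ hb hab => mul_le_mul_of_nonneg_left (p.lower_mono hab hb.2) hc.le)
      (fun _ _ _ hb hab => mul_le_mul_of_nonneg_left (p.upper_anti hab hb.2) hc.le)
      (mul_le_mul_of_nonneg_left (p.lower_le_upper le_rfl) hc.le)
    refine ⟨z, fun r hr => ?_⟩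
    rw [hz r hr, p.level_eq_Icc hr.2]
    ext x
    rw [mem_smul_set_iff_inv_smul_mem₀ hc.ne', smul_eq_mul, mem_Icc, mem_Icc,
      ← div_eq_inv_mul, le_div_iff₀ hc, div_le_iff₀ hc, mul_comm c, mul_comm c]

noncomputable instance instZero : Zero CFuzzy := ⟨exists_zero.choose⟩

/-- Level-wise (Minkowski) addition. -/
noncomputable instance instAdd : Add CFuzzy := ⟨fun p q => (exists_add p q).choose⟩

/-- Level-wise multiplication by a real number. -/
noncomputable instance instSMul : SMul ℝ CFuzzy := ⟨fun c p => (exists_smul c p).choose⟩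

theorem level_zero {r : ℝ} (hr : r ∈ Icc (0 : ℝ) 1) : (0 : CFuzzy).level r = {0} :=
  exists_zero.choose_spec r hr

theorem level_add (p q : CFuzzy) {r : ℝ} (hr : r ∈ Icc (0 : ℝ) 1) :
    (p + q).level r = p.level r + q.level r :=
  (exists_add p q).choose_spec r hr

theorem level_smul (c : ℝ) (p : CFuzzy) {r : ℝ} (hr : r ∈ Icc (0 : ℝ) 1) :
    (c • p).level r = c • p.level r :=
  (exists_smul c p).choose_spec r hr

/-- `w` is the Hukuhara difference `p ⊖ q`. -/
def IsHDiff (p q w : CFuzzy) : Prop := p = q + w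

/-- `w` is the generalized Hukuhara difference of `p` and `q`. -/
def IsGHDiff (p q w : CFuzzy) : Prop := p = q + w ∨ q = p + (-1 : ℝ) • w

/-- `f` has generalized Hukuhara derivative `d` at `x`, with increments taken inside `s`. -/
def HasGHDeriv (f : ℝ → CFuzzy) (d : CFuzzy) (s : Set ℝ) (x : ℝ) : Prop :=
  ∃ Δ : ℝ → CFuzzy,
    (∀ᶠ h in 𝓝[{h | h ≠ 0 ∧ x + h ∈ s}] 0, IsGHDiff (f (x + h)) (f x) (Δ h)) ∧
    Tendsto (fun h => h⁻¹ • Δ h) (𝓝[{h | h ≠ 0 ∧ x + h ∈ s}] 0) (𝓝 d)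

/-- `(i)`-differentiability: the level sets of the derivative are
`[(lower f)', (upper f)']`. -/
def HasGHDerivI (f : ℝ → CFuzzy) (d : CFuzzy) (s : Set ℝ) (x : ℝ) : Prop :=
  HasGHDeriv f d s x ∧ ∀ r ∈ Icc (0 : ℝ) 1,
    HasDerivWithinAt (fun t => (f t).lower r) (d.lower r) s x ∧
    HasDerivWithinAt (fun t => (f t).upper r) (d.upper r) s x

/-- `(ii)`-differentiability: the level sets of the derivative are
`[(upper f)', (lower f)']`. -/
def HasGHDerivII (f : ℝ → CFuzzy) (d : CFuzzy) (s : Set ℝ) (x : ℝ) : Prop :=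
  HasGHDeriv f d s x ∧ ∀ r ∈ Icc (0 : ℝ) 1,
    HasDerivWithinAt (fun t => (f t).upper r) (d.lower r) s x ∧
    HasDerivWithinAt (fun t => (f t).lower r) (d.upper r) s x

/-- The measure `ρ^(1-α) / Γ(α) * s^(ρ-1) * (x^ρ - s^ρ)^(α-1) ds` on `(0, x)`, integration
against which is the one-variable Katugampola integral of order `α > 0` at `x`. The integral of
order `0` is evaluation at `x`. -/
noncomputable def katMeasure (α ρ x : ℝ) : Measure ℝ :=
  if α = 0 then Measure.dirac x
  else (volume.restrict (Ioo 0 x)).withDensity fun s =>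
    ENNReal.ofReal (ρ ^ (1 - α) / Real.Gamma α * (s ^ (ρ - 1) * (x ^ ρ - s ^ ρ) ^ (α - 1)))

theorem integral_katMeasure {α ρ x : ℝ} (hα : 0 < α) (hρ : 0 < ρ) (hx : 0 ≤ x) (f : ℝ → ℝ) :
    ∫ s, f s ∂(katMeasure α ρ x) =
      ρ ^ (1 - α) / Real.Gamma α *
        ∫ s in (0 : ℝ)..x, s ^ (ρ - 1) / (x ^ ρ - s ^ ρ) ^ (1 - α) * f s := by
  rw [katMeasure, if_neg hα.ne', integral_withDensity_eq_integral_toReal_smul (by fun_prop)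
    (Eventually.of_forall fun _ => ENNReal.ofReal_lt_top), intervalIntegral.integral_of_le hx,
    integral_Ioc_eq_integral_Ioo, ← integral_const_mul]
  refine setIntegral_congr_fun measurableSet_Ioo fun s hs => ?_
  have h1 : 0 ≤ s ^ (ρ - 1) := Real.rpow_nonneg hs.1.le _
  have h2 : 0 ≤ x ^ ρ - s ^ ρ :=
    sub_nonneg.2 (Real.rpow_le_rpow hs.1.le hs.2.le hρ.le)
  have h3 : 0 ≤ (x ^ ρ - s ^ ρ) ^ (α - 1) := Real.rpow_nonneg h2 _
  have h4 : 0 ≤ ρ ^ (1 - α) / Real.Gamma α :=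
    div_nonneg (Real.rpow_nonneg hρ.le _) (Real.Gamma_pos_of_pos hα).le
  have h5 : (x ^ ρ - s ^ ρ) ^ (α - 1) = ((x ^ ρ - s ^ ρ) ^ (1 - α))⁻¹ := by
    rw [← Real.rpow_neg h2]; congr 1; ring
  simp only [smul_eq_mul]
  rw [ENNReal.toReal_ofReal (mul_nonneg h4 (mul_nonneg h1 h3)), h5]
  ring

/-- `w` is the mixed Katugampola fuzzy fractional integral of order `(α₁, α₂)` of `u` at
`(x, y)`: its level sets are given by the integrals of the end points of the level sets of `u`. -/
def IsKatIntegral (α₁ α₂ ρ₁ ρ₂ : ℝ) (u : ℝ → ℝ → CFuzzy) (x y : ℝ) (w : CFuzzy) : Prop :=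
  ∀ r ∈ Icc (0 : ℝ) 1,
    (Integrable (fun p : ℝ × ℝ => (u p.1 p.2).lower r)
        ((katMeasure α₁ ρ₁ x).prod (katMeasure α₂ ρ₂ y)) ∧
      w.lower r = ∫ p : ℝ × ℝ, (u p.1 p.2).lower r
        ∂((katMeasure α₁ ρ₁ x).prod (katMeasure α₂ ρ₂ y))) ∧
    (Integrable (fun p : ℝ × ℝ => (u p.1 p.2).upper r)
        ((katMeasure α₁ ρ₁ x).prod (katMeasure α₂ ρ₂ y)) ∧
      w.upper r = ∫ p : ℝ × ℝ, (u p.1 p.2).upper r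
        ∂((katMeasure α₁ ρ₁ x).prod (katMeasure α₂ ρ₂ y)))

/-- On `(0, a] × (0, b]`, the function `d` is the mixed second gH-derivative `∂²U/∂x∂y` (first
in `x`, then in `y`), and the types of gH-differentiability of `U` and of `∂U/∂x` are the same,
without switching points. -/
def HasMixedDerivSameType (a b : ℝ) (U d : ℝ → ℝ → CFuzzy) : Prop :=
  ∃ Ux : ℝ → ℝ → CFuzzy,
    (∀ x ∈ Ioc 0 a, ∀ y ∈ Ioc 0 b,
      HasGHDerivI (fun t => U t y) (Ux x y) (Ioc 0 a) x ∧
      HasGHDerivI (fun t => Ux x t) (d x y) (Ioc 0 b) y) ∨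
    (∀ x ∈ Ioc 0 a, ∀ y ∈ Ioc 0 b,
      HasGHDerivII (fun t => U t y) (Ux x y) (Ioc 0 a) x ∧
      HasGHDerivII (fun t => Ux x t) (d x y) (Ioc 0 b) y)

/-- On `(0, a] × (0, b]`, the function `u` is `(1)`-Katugampola gH-differentiable of order
`(α₁, α₂)`, with derivative
`g(x, y) = x^(1-ρ₁) y^(1-ρ₂) ∂²/∂x∂y (I^(1-α₁, 1-α₂) u)(x, y)`. -/
def HasKatDeriv1 (a b α₁ α₂ ρ₁ ρ₂ : ℝ) (u g : ℝ → ℝ → CFuzzy) : Prop :=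
  ∃ U d : ℝ → ℝ → CFuzzy,
    (∀ x ∈ Ioc 0 a, ∀ y ∈ Ioc 0 b,
      IsKatIntegral (1 - α₁) (1 - α₂) ρ₁ ρ₂ u x y (U x y)) ∧
    HasMixedDerivSameType a b U d ∧
    ∀ x ∈ Ioc 0 a, ∀ y ∈ Ioc 0 b, g x y = (x ^ (1 - ρ₁) * y ^ (1 - ρ₂)) • d x y

/-- On `(0, a] × (0, b]`, the function `v` is `(1)`-Caputo-Katugampola gH-differentiable of order
`(α₁, α₂)`, with derivative `g`: the Katugampola derivative of
`(v(x, y) ⊖ v(x, 0)) ⊖ (v(0, y) ⊖ v(0, 0))` is `g`. -/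
def HasCKDeriv1 (a b α₁ α₂ ρ₁ ρ₂ : ℝ) (v g : ℝ → ℝ → CFuzzy) : Prop :=
  ∃ u : ℝ → ℝ → CFuzzy,
    (∀ x ∈ Icc 0 a, ∀ y ∈ Icc 0 b, ∃ p q : CFuzzy,
      IsHDiff (v x y) (v x 0) p ∧ IsHDiff (v 0 y) (v 0 0) q ∧ IsHDiff p q (u x y)) ∧
    HasKatDeriv1 a b α₁ α₂ ρ₁ ρ₂ u g

/-- `(v, w)` is a pair of continuous functions on `[0, a] × [0, b]` that solves the
coupled system of differential equations, with derivatives of type `(1)`, on `(0, a] × (0, b]`,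
together with the conditions on the axes. -/
structure IsSolution (a b φ₁ φ₂ ψ₁ ψ₂ ρ₁ ρ₂ : ℝ) (F G : ℝ → ℝ → CFuzzy → CFuzzy → CFuzzy)
    (ξ₁ ξ₂ η₁ η₂ : ℝ → CFuzzy) (v w : ℝ → ℝ → CFuzzy) : Prop where
  continuousOn_fst : ContinuousOn (fun p : ℝ × ℝ => v p.1 p.2) (Icc 0 a ×ˢ Icc 0 b)
  continuousOn_snd : ContinuousOn (fun p : ℝ × ℝ => w p.1 p.2) (Icc 0 a ×ˢ Icc 0 b)
  deriv_fst : HasCKDeriv1 a b φ₁ φ₂ ρ₁ ρ₂ v (fun x y => F x y (v x y) (w x y))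
  deriv_snd : HasCKDeriv1 a b ψ₁ ψ₂ ρ₁ ρ₂ w (fun x y => G x y (v x y) (w x y))
  fst_xAxis : ∀ x ∈ Icc 0 a, v x 0 = ξ₁ x
  fst_yAxis : ∀ y ∈ Icc 0 b, v 0 y = ξ₂ y
  snd_xAxis : ∀ x ∈ Icc 0 a, w x 0 = η₁ x
  snd_yAxis : ∀ y ∈ Icc 0 b, w 0 y = η₂ y

/-- `(v, w)` is a pair of continuous functions on `[0, a] × [0, b]` that solves the coupled
system of integral equations `v = ξ₁ + (ξ₂ ⊖ ξ₁(0)) + I^φ F(·, ·, v, w)`,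
`w = η₁ + (η₂ ⊖ η₁(0)) + I^ψ G(·, ·, v, w)`. -/
structure IsIntegralSolution (a b φ₁ φ₂ ψ₁ ψ₂ ρ₁ ρ₂ : ℝ)
    (F G : ℝ → ℝ → CFuzzy → CFuzzy → CFuzzy)
    (ξ₁ ξ₂ η₁ η₂ : ℝ → CFuzzy) (v w : ℝ → ℝ → CFuzzy) : Prop where
  continuousOn_fst : ContinuousOn (fun p : ℝ × ℝ => v p.1 p.2) (Icc 0 a ×ˢ Icc 0 b)
  continuousOn_snd : ContinuousOn (fun p : ℝ × ℝ => w p.1 p.2) (Icc 0 a ×ˢ Icc 0 b)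
  eq_fst : ∀ x ∈ Icc 0 a, ∀ y ∈ Icc 0 b, ∃ k J : CFuzzy,
    IsHDiff (ξ₂ y) (ξ₁ 0) k ∧
    IsKatIntegral φ₁ φ₂ ρ₁ ρ₂ (fun s t => F s t (v s t) (w s t)) x y J ∧
    v x y = ξ₁ x + k + J
  eq_snd : ∀ x ∈ Icc 0 a, ∀ y ∈ Icc 0 b, ∃ k J : CFuzzy,
    IsHDiff (η₂ y) (η₁ 0) k ∧
    IsKatIntegral ψ₁ ψ₂ ρ₁ ρ₂ (fun s t => G s t (v s t) (w s t)) x y J ∧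
    w x y = η₁ x + k + J

end CFuzzy

/-! A fuzzy number is determined by its two end point functions, and `emb` sends it to this pair in
the Banach space `C([0,1]) × C([0,1])`. The map `emb` is an isometry onto a closed convex cone, cut
out by the functionals `IsEndpointTest` (`mem_range_emb`). It respects sums and nonnegative
multiples, and turns Hukuhara differences into ordinary differences. Hence the fuzzy numbers form a
complete space, Bochner integrals of embedded fuzzy numbers stay in the cone, and so do increments
of a curve whose derivative lies in the cone.

The differential and integral problems are linked by the semigroup law `I^(1-φ) I^φ = I^1`
(`lintegral_katMeasure_katMeasure`, `BoundedContOn.katInt_katInt`), which rests on the Beta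
integral. If `u = I^φ g`, then `I^(1-φ) u = I^1 g`, which the fundamental theorem of calculus
differentiates in `x` and then in `y`. The derivatives lie in the cone, so this is
gH-differentiability of type (i) (`hasKatDeriv1_katInt`). Conversely, let `u` have derivative `g`.
In type (i) each end point function satisfies a scalar mixed-derivative equation. In type (ii) the
end points are exchanged twice, which gives the same scalar equations. Then `I^(1-φ) u` and `I^1 g`
have equal mixed derivatives and both tend to zero at the axes, so they agree, and injectivity of
`I^(1-φ)` gives `u = I^φ g` (`eq_katInt_of_mixed_deriv`). Both problems thereby become the single
fixed point equation `IsEmbSolution`.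

That equation is solved by Picard iteration with distances measured against the weight `exp (l *
x)`. For `l` large, the Katugampola integral of the weight is at most a prescribed small multiple of
the weight (`eventually_katInt_exp_le`), so the Lipschitz bounds make the Picard map halve weighted
distances (`IsEquationData.eventually_contraction`). This yields existence and uniqueness. -/

namespace CFuzzy

/-! ### End points of level sets under the linear operations. -/

theorem endpoints_of_level {z : CFuzzy} {r l u : ℝ} (h : z.level r = Icc l u) (hlu : l ≤ u) :
    z.lower r = l ∧ z.upper r = u := by
  rw [FuzzyNumber.lower, FuzzyNumber.upper, h, csInf_Icc hlu, csSup_Icc hlu]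
  exact ⟨rfl, rfl⟩

theorem level_eq_Icc (z : CFuzzy) {r : ℝ} (hr : r ∈ Icc (0 : ℝ) 1) :
    z.level r = Icc (z.lower r) (z.upper r) := z.toFuzzyNumber.level_eq_Icc hr.2

theorem endpoints_add (p q : CFuzzy) {r : ℝ} (hr : r ∈ Icc (0 : ℝ) 1) :
    (p + q).lower r = p.lower r + q.lower r ∧ (p + q).upper r = p.upper r + q.upper r := by
  have hp := p.lower_le_upper hr.2
  have hq := q.lower_le_upper hr.2
  refine endpoints_of_level ?_ (add_le_add hp hq)
  rw [level_add p q hr, level_eq_Icc p hr, level_eq_Icc q hr]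
  refine Subset.antisymm (Icc_add_Icc_subset _ _ _ _) ?_
  intro x hx
  -- The first summand is the least point of the interval of `p` whose complement in `x` does not
  -- exceed `q.upper r`.
  refine ⟨max (p.lower r) (x - q.upper r), ⟨le_max_left _ _, max_le hp (by linarith [hx.2])⟩,
    x - max (p.lower r) (x - q.upper r), ⟨?_, ?_⟩, by ring⟩
  · rcases max_cases (p.lower r) (x - q.upper r) with h | h <;> linarith [hx.1]
  · linarith [le_max_right (p.lower r) (x - q.upper r)]

theorem endpoints_zero {r : ℝ} (hr : r ∈ Icc (0 : ℝ) 1) :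
    (0 : CFuzzy).lower r = 0 ∧ (0 : CFuzzy).upper r = 0 :=
  endpoints_of_level (by rw [level_zero hr, Icc_self]) le_rfl

theorem endpoints_smul {c : ℝ} (hc : 0 ≤ c) (p : CFuzzy) {r : ℝ} (hr : r ∈ Icc (0 : ℝ) 1) :
    (c • p).lower r = c * p.lower r ∧ (c • p).upper r = c * p.upper r := by
  have hp := p.lower_le_upper hr.2
  refine endpoints_of_level ?_ (mul_le_mul_of_nonneg_left hp hc)
  rw [level_smul c p hr, level_eq_Icc p hr]
  rcases hc.eq_or_lt with rfl | hc
  · rw [zero_smul_set (nonempty_Icc.2 hp), zero_mul, zero_mul, Icc_self]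
    rfl
  · ext x
    rw [mem_smul_set_iff_inv_smul_mem₀ hc.ne', smul_eq_mul, mem_Icc, mem_Icc,
      ← div_eq_inv_mul, le_div_iff₀ hc, div_le_iff₀ hc, mul_comm c, mul_comm c]

theorem smul_smul_eq (c d : ℝ) (p : CFuzzy) : c • d • p = (c * d) • p := by
  refine ext_of_level fun r hr => ?_
  rw [level_smul _ _ hr, level_smul _ _ hr, level_smul _ _ hr, smul_smul]

/-! ### The isometric embedding onto a closed convex cone. -/

/-- Pairs of continuous functions on `[0, 1]`, with the sup norm. -/
abbrev EndpointSpace : Type := C(Icc (0 : ℝ) 1, ℝ) × C(Icc (0 : ℝ) 1, ℝ)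

/-- The pair of end point functions of a fuzzy number. -/
noncomputable def emb (z : CFuzzy) : EndpointSpace :=
  (⟨fun r => z.lower r, z.continuousOn_lower.domRestrict⟩,
    ⟨fun r => z.upper r, z.continuousOn_upper.domRestrict⟩)

@[simp] theorem emb_fst (z : CFuzzy) (r : Icc (0 : ℝ) 1) : (emb z).1 r = z.lower r := rfl
@[simp] theorem emb_snd (z : CFuzzy) (r : Icc (0 : ℝ) 1) : (emb z).2 r = z.upper r := rfl

theorem emb_eq_iff {z : CFuzzy} {e : EndpointSpace} :
    emb z = e ↔ ∀ r : Icc (0 : ℝ) 1, z.lower r = e.1 r ∧ z.upper r = e.2 r := by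
  rw [Prod.ext_iff, ContinuousMap.ext_iff, ContinuousMap.ext_iff, ← forall_and]
  rfl

theorem emb_add (p q : CFuzzy) : emb (p + q) = emb p + emb q :=
  emb_eq_iff.2 fun r => endpoints_add p q r.2

theorem emb_zero : emb 0 = 0 := emb_eq_iff.2 fun r => endpoints_zero r.2

theorem emb_smul {c : ℝ} (hc : 0 ≤ c) (p : CFuzzy) : emb (c • p) = c • emb p :=
  emb_eq_iff.2 fun r => endpoints_smul hc p r.2

theorem isometry_emb : Isometry emb := by
  refine Isometry.of_dist_eq fun z w => ?_
  have hb : BddAbove (range fun r : Icc (0 : ℝ) 1 =>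
      max |z.lower r - w.lower r| |z.upper r - w.upper r|) := by
    have h := bddAbove_levelDist z w
    simpa only [fun r : Icc (0 : ℝ) 1 => hausdorffDist_level z.toFuzzyNumber w.toFuzzyNumber
      r.2.2 r.2.2] using h
  have h0 : 0 ≤ ⨆ r : Icc (0 : ℝ) 1, max |z.lower r - w.lower r| |z.upper r - w.upper r| :=
    Real.iSup_nonneg fun r => le_max_of_le_left (abs_nonneg _)
  rw [dist_eq, Prod.dist_eq]
  apply le_antisymm
  · refine max_le ((ContinuousMap.dist_le h0).2 fun r => ?_)
      ((ContinuousMap.dist_le h0).2 fun r => ?_)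
    · exact (le_max_left _ _).trans (le_ciSup hb r)
    · exact (le_max_right _ _).trans (le_ciSup hb r)
  · refine ciSup_le fun r => max_le_max ?_ ?_
    · exact ContinuousMap.dist_apply_le_dist (f := (emb z).1) (g := (emb w).1) r
    · exact ContinuousMap.dist_apply_le_dist (f := (emb z).2) (g := (emb w).2) r

theorem emb_injective : Function.Injective emb := isometry_emb.injective

theorem dist_emb (z w : CFuzzy) : ‖emb z - emb w‖ = dist z w := by
  rw [← dist_eq_norm, isometry_emb.dist_eq]

theorem norm_emb (z : CFuzzy) : ‖emb z‖ = dist z 0 := by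
  rw [← dist_emb, emb_zero, sub_zero]

theorem isHDiff_iff {p q w : CFuzzy} : IsHDiff p q w ↔ emb p - emb q = emb w := by
  rw [IsHDiff, ← emb_injective.eq_iff, emb_add, sub_eq_iff_eq_add']

/-- Evaluation of the first component at `r`. -/
noncomputable def evalFst (r : Icc (0 : ℝ) 1) : EndpointSpace →L[ℝ] ℝ :=
  (ContinuousMap.evalCLM ℝ r : C(Icc (0 : ℝ) 1, ℝ) →L[ℝ] ℝ).comp
    (ContinuousLinearMap.fst ℝ _ _)

/-- Evaluation of the second component at `r`. -/
noncomputable def evalSnd (r : Icc (0 : ℝ) 1) : EndpointSpace →L[ℝ] ℝ :=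
  (ContinuousMap.evalCLM ℝ r : C(Icc (0 : ℝ) 1, ℝ) →L[ℝ] ℝ).comp
    (ContinuousLinearMap.snd ℝ _ _)

/-- Continuous linear functionals whose joint nonnegativity singles out the end point functions
of fuzzy numbers. -/
inductive IsEndpointTest : (EndpointSpace →L[ℝ] ℝ) → Prop
  | lower (r q : Icc (0 : ℝ) 1) : r ≤ q → IsEndpointTest (evalFst q - evalFst r)
  | upper (r q : Icc (0 : ℝ) 1) : r ≤ q → IsEndpointTest (evalSnd r - evalSnd q)
  | top : IsEndpointTest (evalSnd 1 - evalFst 1)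

/-- Being monotone, being antitone and being ordered at level 1 are all closed linear inequalities.
Writing the cone in terms of functionals lets scalar facts about limits, integrals and derivatives
be applied one functional at a time. -/
theorem mem_range_emb {e : EndpointSpace} :
    e ∈ range emb ↔ ∀ T, IsEndpointTest T → 0 ≤ T e := by
  constructor
  · rintro ⟨z, rfl⟩ T (⟨r, q, h⟩ | ⟨r, q, h⟩ | _)
    · exact sub_nonneg.2 (z.lower_mono h q.2.2)
    · exact sub_nonneg.2 (z.upper_anti h q.2.2)
    · exact sub_nonneg.2 (z.lower_le_upper le_rfl)
  · intro h
    have hl : ∀ r q : Icc (0 : ℝ) 1, r ≤ q → e.1 r ≤ e.1 q := fun r q hrq =>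
      sub_nonneg.1 (h _ (.lower r q hrq))
    have hu : ∀ r q : Icc (0 : ℝ) 1, r ≤ q → e.2 q ≤ e.2 r := fun r q hrq =>
      sub_nonneg.1 (h _ (.upper r q hrq))
    have h1 : e.1 1 ≤ e.2 1 := sub_nonneg.1 (h _ .top)
    obtain ⟨z, hz⟩ := exists_of_endpoints (IccExtend zero_le_one e.1) (IccExtend zero_le_one e.2)
      e.1.continuous.Icc_extend'.continuousOn e.2.continuous.Icc_extend'.continuousOn
      (fun r _ q _ hrq => hl _ _ (monotone_projIcc _ hrq))
      (fun r _ q _ hrq => hu _ _ (monotone_projIcc _ hrq))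
      (by rw [IccExtend_right, IccExtend_right]; exact h1)
    refine ⟨z, emb_eq_iff.2 fun r => ?_⟩
    have hr := hz r r.2
    rw [IccExtend_val, IccExtend_val] at hr
    refine endpoints_of_level hr ?_
    exact (hl r 1 r.2.2).trans (h1.trans (hu r 1 r.2.2))

theorem isClosed_range_emb : IsClosed (range emb) := by
  have : range emb = ⋂ T, ⋂ (_ : IsEndpointTest T), {e | 0 ≤ T e} := by
    ext e
    simp only [mem_range_emb, mem_iInter, mem_ofPred_eq]
  rw [this]
  exact isClosed_iInter fun T => isClosed_iInter fun _ =>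
    isClosed_le continuous_const T.continuous

instance instCompleteSpace : CompleteSpace CFuzzy :=
  (completeSpace_iff_isComplete_range isometry_emb.isUniformInducing).2
    isClosed_range_emb.isComplete

theorem integral_mem_range_emb {X : Type*} [MeasurableSpace X] {μ : Measure X}
    {f : X → EndpointSpace} (h : ∀ᵐ x ∂μ, f x ∈ range emb) : ∫ x, f x ∂μ ∈ range emb := by
  by_cases hf : Integrable f μ
  swap
  -- The integral of a non-integrable function is zero by convention, and zero lies in the cone.
  · exact ⟨0, by rw [integral_undef hf, emb_zero]⟩
  refine mem_range_emb.2 fun T hT => ?_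
  rw [← T.integral_comp_comm hf]
  refine integral_nonneg_of_ae ?_
  filter_upwards [h] with x hx
  exact mem_range_emb.1 hx T hT

theorem integral_fst_apply {X : Type*} [MeasurableSpace X] {μ : Measure X}
    {f : X → EndpointSpace} (hf : Integrable f μ) (r : Icc (0 : ℝ) 1) :
    (∫ x, f x ∂μ).1 r = ∫ x, (f x).1 r ∂μ := ((evalFst r).integral_comp_comm hf).symm

theorem integral_snd_apply {X : Type*} [MeasurableSpace X] {μ : Measure X}
    {f : X → EndpointSpace} (hf : Integrable f μ) (r : Icc (0 : ℝ) 1) :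
    (∫ x, f x ∂μ).2 r = ∫ x, (f x).2 r ∂μ := ((evalSnd r).integral_comp_comm hf).symm

/-! ### Type (i) differentiability from differentiability of the embedded curve. -/

/-- Each test functional has nonnegative derivative along the curve, hence is nondecreasing along
it. So increments over forward steps lie in the cone, which supplies the gH-differences. This is why
differentiability is assumed on the whole interval and not only at `x`. -/
theorem hasGHDerivI_of_emb {c : ℝ} {f f' : ℝ → CFuzzy}
    (hf : ∀ t ∈ Ioc 0 c, HasDerivWithinAt (fun t => emb (f t)) (emb (f' t)) (Ioc 0 c) t)
    {x : ℝ} (hx : x ∈ Ioc 0 c) : HasGHDerivI f (f' x) (Ioc 0 c) x := by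
  have hmono : ∀ s ∈ Ioc 0 c, ∀ t ∈ Ioc 0 c, s ≤ t → ∃ w, emb (f t) - emb (f s) = emb w := by
    intro s hs t ht hst
    have : emb (f t) - emb (f s) ∈ range emb := by
      refine mem_range_emb.2 fun T hT => ?_
      have hd : ∀ t ∈ Ioc 0 c,
          HasDerivWithinAt (fun t => T (emb (f t))) (T (emb (f' t))) (Ioc 0 c) t :=
        fun t ht => T.hasFDerivAt.comp_hasDerivWithinAt t (hf t ht)
      have hm : MonotoneOn (fun t => T (emb (f t))) (Ioc 0 c) := by
        refine monotoneOn_of_hasDerivWithinAt_nonneg (convex_Ioc 0 c)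
          (fun t ht => (hd t ht).continuousWithinAt)
          (fun t ht => (hd t (interior_subset ht)).mono interior_subset) ?_
        exact fun t _ => mem_range_emb.1 ⟨f' t, rfl⟩ T hT
      rw [map_sub]
      exact sub_nonneg.2 (hm hs ht hst)
    obtain ⟨w, hw⟩ := this
    exact ⟨w, hw.symm⟩
  refine ⟨?_, fun r hr => ⟨?_, ?_⟩⟩
  -- Inadmissible increments get the dummy value `0`, so that `Δ` can be chosen as a total function.
  · have hex : ∀ h : ℝ, ∃ Δ : CFuzzy, h ≠ 0 ∧ x + h ∈ Ioc 0 c →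
        IsGHDiff (f (x + h)) (f x) Δ ∧
          emb (h⁻¹ • Δ) = h⁻¹ • (emb (f (x + h)) - emb (f x)) := by
      intro h
      by_cases hh : h ≠ 0 ∧ x + h ∈ Ioc 0 c
      swap
      · exact ⟨0, fun h' => absurd h' hh⟩
      rcases lt_or_gt_of_ne hh.1 with h0 | h0
      · obtain ⟨w, hw⟩ := hmono _ hh.2 _ hx (by linarith)
        -- For a backward step it is `f x` that exceeds `f (x + h)` by `w`, so the second
        -- alternative of the gH-difference applies. The two negative factors `h⁻¹` and `-1` then
        -- combine to a positive one, which `emb` respects.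
        refine ⟨(-1 : ℝ) • w, fun _ => ⟨Or.inr ?_, ?_⟩⟩
        · have : ((-1 : ℝ) * (-1)) • w = w := emb_injective (by
            rw [emb_smul (by norm_num)]; norm_num)
          rw [smul_smul_eq, this]
          exact isHDiff_iff.2 hw
        · rw [smul_smul_eq, emb_smul (by have := inv_lt_zero.2 h0; linarith), ← hw,
            ← neg_sub, smul_neg]
          rw [mul_neg_one, neg_smul, neg_neg]
      · obtain ⟨w, hw⟩ := hmono _ hx _ hh.2 (by linarith)
        exact ⟨w, fun _ => ⟨Or.inl (isHDiff_iff.2 hw), by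
          rw [emb_smul (inv_pos.2 h0).le, hw]⟩⟩
    choose Δ hΔ using hex
    refine ⟨Δ, ?_, ?_⟩
    · filter_upwards [self_mem_nhdsWithin] with h hh
      exact (hΔ h hh).1
    · rw [isometry_emb.isEmbedding.tendsto_nhds_iff]
      have h1 := (hasDerivWithinAt_iff_tendsto_slope.1 (hf x hx))
      have h2 : Tendsto (fun h : ℝ => x + h) (𝓝[{h | h ≠ 0 ∧ x + h ∈ Ioc 0 c}] 0)
          (𝓝[Ioc 0 c \ {x}] x) := by
        refine tendsto_nhdsWithin_iff.2 ⟨?_, ?_⟩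
        · have : Tendsto (fun h : ℝ => x + h) (𝓝 0) (𝓝 (x + 0)) :=
            (continuous_const.add continuous_id).tendsto 0
          rw [add_zero] at this
          exact this.mono_left nhdsWithin_le_nhds
        · filter_upwards [self_mem_nhdsWithin] with h hh
          exact ⟨hh.2, by simpa using hh.1⟩
      refine (h1.comp h2).congr' ?_
      filter_upwards [self_mem_nhdsWithin] with h hh
      simp only [Function.comp_apply, slope_def_module, (hΔ h hh).2, add_sub_cancel_left]
  · exact (evalFst ⟨r, hr⟩).hasFDerivAt.comp_hasDerivWithinAt x (hf x hx)
  · exact (evalSnd ⟨r, hr⟩).hasFDerivAt.comp_hasDerivWithinAt x (hf x hx)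

/-! ### One-variable Katugampola measures: finiteness, composition and scaling. -/

/-- The density of `katMeasure` of positive order. -/
noncomputable def katDensity (α ρ x s : ℝ) : ℝ :=
  ρ ^ (1 - α) / Real.Gamma α * (s ^ (ρ - 1) * (x ^ ρ - s ^ ρ) ^ (α - 1))

theorem katMeasure_of_pos {α : ℝ} (hα : 0 < α) (ρ x : ℝ) :
    katMeasure α ρ x = (volume.restrict (Ioo 0 x)).withDensity
      fun s => ENNReal.ofReal (katDensity α ρ x s) := if_neg hα.ne'

theorem katMeasure_zero_order (ρ x : ℝ) : katMeasure 0 ρ x = Measure.dirac x := if_pos rfl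

@[fun_prop]
theorem measurable_katDensity (α ρ : ℝ) :
    Measurable fun p : ℝ × ℝ => katDensity α ρ p.1 p.2 := by
  unfold katDensity
  fun_prop

@[fun_prop]
theorem measurable_katDensity_right (α ρ x : ℝ) : Measurable fun s => katDensity α ρ x s := by
  unfold katDensity
  fun_prop

theorem lintegral_katMeasure {α : ℝ} (hα : 0 < α) (ρ x : ℝ) {f : ℝ → ENNReal}
    (hf : Measurable f) :
    ∫⁻ s, f s ∂(katMeasure α ρ x) =
      ∫⁻ s in Ioo 0 x, ENNReal.ofReal (katDensity α ρ x s) * f s := by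
  rw [katMeasure_of_pos hα, lintegral_withDensity_eq_lintegral_mul _ (by fun_prop) hf]
  rfl

/-- The substitution `z = (s ^ ρ - t ^ ρ) / (x ^ ρ - t ^ ρ)` turns the integrand into the Beta
density on `(0, 1)`, up to a constant. -/
theorem lintegral_rpow_beta {α β ρ t x : ℝ} (hα : 0 < α) (hβ : 0 < β) (hρ : 0 < ρ) (ht : 0 ≤ t)
    (htx : t < x) :
    ∫⁻ s in Ioo t x, ENNReal.ofReal
        (ρ * s ^ (ρ - 1) * (x ^ ρ - s ^ ρ) ^ (α - 1) * (s ^ ρ - t ^ ρ) ^ (β - 1)) =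
      ENNReal.ofReal ((x ^ ρ - t ^ ρ) ^ (α + β - 1) * ProbabilityTheory.beta β α) := by
  set c := x ^ ρ - t ^ ρ with hc
  have hx : 0 < x := ht.trans_lt htx
  have hc0 : 0 < c := sub_pos.2 (Real.rpow_lt_rpow ht htx hρ)
  have hB := ProbabilityTheory.beta_pos hβ hα
  have himage : (fun s : ℝ => (s ^ ρ - t ^ ρ) / c) '' Ioo t x = Ioo 0 1 := by
    ext z
    simp only [mem_image, mem_Ioo]
    constructor
    · rintro ⟨s, ⟨h1, h2⟩, rfl⟩
      have h3 := Real.rpow_lt_rpow ht h1 hρ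
      have h4 := Real.rpow_lt_rpow (ht.trans h1.le) h2 hρ
      exact ⟨div_pos (by linarith) hc0, (div_lt_one hc0).2 (by linarith)⟩
    · rintro ⟨h1, h2⟩
      have ht' : 0 ≤ t ^ ρ := Real.rpow_nonneg ht _
      have hz : 0 ≤ t ^ ρ + c * z := by positivity
      have hs : ((t ^ ρ + c * z) ^ ρ⁻¹) ^ ρ = t ^ ρ + c * z := Real.rpow_inv_rpow hz hρ.ne'
      refine ⟨(t ^ ρ + c * z) ^ ρ⁻¹, ⟨?_, ?_⟩, ?_⟩
      · rw [← Real.rpow_lt_rpow_iff ht (Real.rpow_nonneg hz _) hρ, hs]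
        have : 0 < c * z := by positivity
        linarith
      · rw [← Real.rpow_lt_rpow_iff (Real.rpow_nonneg hz _) hx.le hρ, hs]
        have : c * z < c * 1 := by gcongr
        linarith
      · rw [hs]; field_simp; ring
  have hinj : InjOn (fun s : ℝ => (s ^ ρ - t ^ ρ) / c) (Ioo t x) := by
    intro s hs s' hs' h
    have h1 : s ^ ρ = s' ^ ρ := by
      have := (div_left_inj' hc0.ne').1 h
      linarith
    exact Real.rpow_left_injOn hρ.ne' (ht.trans hs.1.le) (ht.trans hs'.1.le) h1
  have hderiv : ∀ s ∈ Ioo t x, HasDerivWithinAt (fun s : ℝ => (s ^ ρ - t ^ ρ) / c)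
      (ρ * s ^ (ρ - 1) / c) (Ioo t x) s := fun s hs =>
    (((Real.hasDerivAt_rpow_const (Or.inl (ht.trans_lt hs.1).ne')).sub_const _).div_const
      c).hasDerivWithinAt
  have h1 := ProbabilityTheory.lintegral_betaPDF_eq_one hβ hα
  rw [ProbabilityTheory.lintegral_betaPDF, ← himage,
    lintegral_image_eq_lintegral_abs_deriv_mul measurableSet_Ioo hderiv hinj] at h1
  -- The factor `1` is replaced by the transported integral of the Beta density, after which the
  -- integrands are compared pointwise.
  rw [← mul_one (ENNReal.ofReal (c ^ (α + β - 1) * _)), ← h1,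
    ← lintegral_const_mul _ (by fun_prop)]
  refine setLIntegral_congr_fun measurableSet_Ioo fun s hs => ?_
  have hs0 : 0 < s := ht.trans_lt hs.1
  have h3 : 0 < s ^ ρ - t ^ ρ := sub_pos.2 (Real.rpow_lt_rpow ht hs.1 hρ)
  have h4 : 0 < x ^ ρ - s ^ ρ := sub_pos.2 (Real.rpow_lt_rpow hs0.le hs.2 hρ)
  have h5 : 1 - (s ^ ρ - t ^ ρ) / c = (x ^ ρ - s ^ ρ) / c := by
    rw [eq_div_iff hc0.ne', sub_mul, div_mul_cancel₀ _ hc0.ne', hc]; ring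
  have h6 : 0 < s ^ (ρ - 1) := Real.rpow_pos_of_pos hs0 _
  rw [← ENNReal.ofReal_mul (abs_nonneg _), ← ENNReal.ofReal_mul (by positivity), h5,
    Real.div_rpow h3.le hc0.le, Real.div_rpow h4.le hc0.le, abs_of_pos (by positivity)]
  congr 1
  have h7 : c ^ (α + β - 1) = c ^ (α - 1) * c ^ (β - 1) * c := by
    rw [← Real.rpow_add hc0, ← Real.rpow_add_one hc0.ne']; congr 1; ring
  rw [h7]
  have := Real.rpow_pos_of_pos hc0 (α - 1)
  have := Real.rpow_pos_of_pos hc0 (β - 1)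
  field_simp

theorem katDensity_nonneg {α ρ x s : ℝ} (hα : 0 < α) (hρ : 0 < ρ) (hs : 0 ≤ s) (hsx : s ≤ x) :
    0 ≤ katDensity α ρ x s :=
  mul_nonneg (div_nonneg (Real.rpow_nonneg hρ.le _) (Real.Gamma_pos_of_pos hα).le)
    (mul_nonneg (Real.rpow_nonneg hs _)
      (Real.rpow_nonneg (sub_nonneg.2 (Real.rpow_le_rpow hs hsx hρ.le)) _))

theorem katMeasure_of_nonpos {α ρ x : ℝ} (hα : 0 < α) (hx : x ≤ 0) : katMeasure α ρ x = 0 := by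
  rw [katMeasure_of_pos hα, Ioo_eq_empty (not_lt.2 hx), Measure.restrict_empty]
  ext s hs
  rw [withDensity_apply _ hs]
  simp

theorem isFiniteMeasure_katMeasure {α ρ : ℝ} (hα : 0 ≤ α) (hρ : 0 < ρ) (x : ℝ) :
    IsFiniteMeasure (katMeasure α ρ x) := by
  rcases hα.eq_or_lt with rfl | hα
  · rw [katMeasure_zero_order]; infer_instance
  rcases le_or_gt x 0 with hx | hx
  · rw [katMeasure_of_nonpos hα hx]; infer_instance
  refine ⟨?_⟩
  -- With `t = 0` and `β = 1` the last factor is `1`, and the Beta integral is the total mass up to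
  -- a constant.
  have h := lintegral_rpow_beta hα one_pos hρ le_rfl hx
  rw [← lintegral_one, lintegral_katMeasure hα _ _ measurable_const]
  have h2 : ∫⁻ s in Ioo 0 x, ENNReal.ofReal (katDensity α ρ x s) * 1 =
      ∫⁻ s in Ioo 0 x, ENNReal.ofReal (ρ ^ (1 - α) / Real.Gamma α / ρ) * ENNReal.ofReal
        (ρ * s ^ (ρ - 1) * (x ^ ρ - s ^ ρ) ^ (α - 1) * (s ^ ρ - 0 ^ ρ) ^ ((1 : ℝ) - 1)) := by
    refine setLIntegral_congr_fun measurableSet_Ioo fun s hs => ?_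
    have := Real.Gamma_pos_of_pos hα
    rw [← ENNReal.ofReal_mul (by positivity), mul_one, katDensity]
    congr 1
    rw [sub_self, Real.rpow_zero]
    field_simp
  rw [h2, lintegral_const_mul' _ _ ENNReal.ofReal_ne_top, h]
  exact ENNReal.mul_lt_top ENNReal.ofReal_lt_top ENNReal.ofReal_lt_top

theorem measurable_indicator_katDensity (α ρ : ℝ) :
    Measurable (Function.uncurry fun x : ℝ =>
      (Ioo 0 x).indicator fun s => ENNReal.ofReal (katDensity α ρ x s)) := by
  have : (Function.uncurry fun x : ℝ =>
      (Ioo 0 x).indicator fun s => ENNReal.ofReal (katDensity α ρ x s)) =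
      {p : ℝ × ℝ | 0 < p.2 ∧ p.2 < p.1}.indicator
        fun p => ENNReal.ofReal (katDensity α ρ p.1 p.2) := by
    ext ⟨x, s⟩
    simp only [Function.uncurry, indicator, mem_Ioo, mem_ofPred_eq]
  rw [this]
  refine Measurable.indicator (by fun_prop) ?_
  exact (measurableSet_lt measurable_const measurable_snd).inter
    (measurableSet_lt measurable_snd measurable_fst)

/-- The family `katMeasure α ρ` as a kernel. -/
noncomputable def katKernel (α ρ : ℝ) : ProbabilityTheory.Kernel ℝ ℝ :=
  open scoped Classical in
  if α = 0 then ProbabilityTheory.Kernel.id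
  else (ProbabilityTheory.Kernel.const ℝ volume).withDensity fun x =>
    (Ioo 0 x).indicator fun s => ENNReal.ofReal (katDensity α ρ x s)

instance (α ρ : ℝ) : ProbabilityTheory.IsSFiniteKernel (katKernel α ρ) := by
  unfold katKernel
  split_ifs
  · infer_instance
  · exact ProbabilityTheory.Kernel.IsSFiniteKernel.withDensity _
      fun x s => by simp only [indicator]; split_ifs <;> simp

theorem katKernel_apply {α : ℝ} (hα : 0 ≤ α) (ρ x : ℝ) :
    katKernel α ρ x = katMeasure α ρ x := by
  unfold katKernel
  split_ifs with h
  · rw [h, katMeasure_zero_order, ProbabilityTheory.Kernel.id_apply]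
  · rw [ProbabilityTheory.Kernel.withDensity_apply _ (measurable_indicator_katDensity α ρ),
      ProbabilityTheory.Kernel.const_apply, withDensity_indicator measurableSet_Ioo,
      katMeasure_of_pos (hα.lt_of_ne' h)]

theorem measurable_lintegral_katMeasure {α : ℝ} (hα : 0 ≤ α) (ρ : ℝ) {f : ℝ → ENNReal}
    (hf : Measurable f) : Measurable fun x => ∫⁻ s, f s ∂(katMeasure α ρ x) := by
  simp only [← katKernel_apply hα]
  exact hf.lintegral_kernel

theorem katDensity_one {ρ x s : ℝ} : katDensity 1 ρ x s = s ^ (ρ - 1) := by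
  simp [katDensity]

/-- After exchanging the integrals by Tonelli, the inner integral over `t < s < x` is a Beta
integral. Since `α + β = 1`, its power of `x ^ ρ - t ^ ρ` has exponent zero and the Gamma factors
cancel, leaving the density `t ^ (ρ - 1)` of order 1. An order zero is a Dirac mass and acts as the
identity. -/
theorem lintegral_katMeasure_katMeasure {α β ρ x : ℝ} (hα : 0 ≤ α) (hβ : 0 ≤ β)
    (hαβ : α + β = 1) (hρ : 0 < ρ) {f : ℝ → ENNReal} (hf : Measurable f) :
    ∫⁻ s, ∫⁻ t, f t ∂(katMeasure β ρ s) ∂(katMeasure α ρ x) =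
      ∫⁻ t, f t ∂(katMeasure 1 ρ x) := by
  have hm := measurable_lintegral_katMeasure hβ ρ hf
  rcases hα.eq_or_lt with rfl | hα
  · have : β = 1 := by linarith
    subst this
    rw [katMeasure_zero_order, lintegral_dirac' _ hm]
  rcases hβ.eq_or_lt with rfl | hβ
  · have : α = 1 := by linarith
    subst this
    simp_rw [katMeasure_zero_order, lintegral_dirac' _ hf]
  rw [lintegral_katMeasure hα _ _ hm, lintegral_katMeasure one_pos _ _ hf]
  have e1 : ∀ s, ∫⁻ t, f t ∂(katMeasure β ρ s) =
      ∫⁻ t, (Ioo 0 s).indicator (fun t => ENNReal.ofReal (katDensity β ρ s t)) t * f t := by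
    intro s
    rw [lintegral_katMeasure hβ _ _ hf, ← lintegral_indicator measurableSet_Ioo]
    congr 1
    ext t
    by_cases h : t ∈ Ioo 0 s <;> simp [h]
  simp_rw [e1]
  have hmeas : Measurable (Function.uncurry fun s t : ℝ => ENNReal.ofReal (katDensity α ρ x s) *
      ((Ioo 0 s).indicator (fun t => ENNReal.ofReal (katDensity β ρ s t)) t * f t)) := by
    have h1 := measurable_indicator_katDensity β ρ
    have h2 : Measurable fun p : ℝ × ℝ => ENNReal.ofReal (katDensity α ρ x p.1) := by fun_prop
    have h3 : Measurable fun p : ℝ × ℝ => f p.2 := by fun_prop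
    exact h2.mul (h1.mul h3)
  have e2 : ∀ s, ENNReal.ofReal (katDensity α ρ x s) *
      ∫⁻ t, (Ioo 0 s).indicator (fun t => ENNReal.ofReal (katDensity β ρ s t)) t * f t =
      ∫⁻ t, ENNReal.ofReal (katDensity α ρ x s) *
      ((Ioo 0 s).indicator (fun t => ENNReal.ofReal (katDensity β ρ s t)) t * f t) := fun s =>
    (lintegral_const_mul' _ _ ENNReal.ofReal_ne_top).symm
  simp_rw [e2]
  rw [lintegral_lintegral_swap hmeas.aemeasurable, ← lintegral_indicator measurableSet_Ioo]
  congr 1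
  ext t
  by_cases ht : t ∈ Ioo 0 x
  swap
  · rw [indicator_of_notMem ht, setLIntegral_eq_zero measurableSet_Ioo]
    intro s hs
    have : t ∉ Ioo 0 s := fun h => ht ⟨h.1, h.2.trans hs.2⟩
    simp [this]
  rw [indicator_of_mem ht, katDensity_one]
  -- The conditions `s ∈ (0, x)` and `t ∈ (0, s)` together say `s ∈ (t, x)`, because `t` is already
  -- positive.
  have e3 : ∀ s, (Ioo 0 x).indicator (fun s => ENNReal.ofReal (katDensity α ρ x s) *
      ((Ioo 0 s).indicator (fun t => ENNReal.ofReal (katDensity β ρ s t)) t * f t)) s =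
      (Ioo t x).indicator (fun s => (ENNReal.ofReal (t ^ (ρ - 1) /
        (Real.Gamma α * Real.Gamma β)) * f t) * ENNReal.ofReal
        (ρ * s ^ (ρ - 1) * (x ^ ρ - s ^ ρ) ^ (α - 1) * (s ^ ρ - t ^ ρ) ^ (β - 1))) s := by
    intro s
    by_cases hs : s ∈ Ioo t x
    swap
    · rw [indicator_of_notMem hs]
      by_cases hs' : s ∈ Ioo 0 x
      · have : t ∉ Ioo 0 s := fun h => hs ⟨h.2, hs'.2⟩
        simp [this]
      · rw [indicator_of_notMem hs']
    have hs0 : 0 < s := ht.1.trans hs.1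
    rw [indicator_of_mem hs, indicator_of_mem (show s ∈ Ioo 0 x from ⟨hs0, hs.2⟩),
      indicator_of_mem (show t ∈ Ioo 0 s from ⟨ht.1, hs.1⟩), mul_right_comm, ← mul_assoc,
      ← ENNReal.ofReal_mul (katDensity_nonneg hα hρ hs0.le hs.2.le), ← ENNReal.ofReal_mul
      (div_nonneg (Real.rpow_nonneg ht.1.le _) (mul_nonneg (Real.Gamma_pos_of_pos hα).le
        (Real.Gamma_pos_of_pos hβ).le))]
    congr 2
    have h1 : ρ ^ (1 - α) * ρ ^ (1 - β) = ρ := by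
      rw [← Real.rpow_add hρ, show 1 - α + (1 - β) = 1 by linarith, Real.rpow_one]
    simp only [katDensity]
    calc _ = (ρ ^ (1 - α) * ρ ^ (1 - β)) / (Real.Gamma α * Real.Gamma β) *
        (s ^ (ρ - 1) * (x ^ ρ - s ^ ρ) ^ (α - 1)) *
        (t ^ (ρ - 1) * (s ^ ρ - t ^ ρ) ^ (β - 1)) := by ring
      _ = _ := by rw [h1]; ring
  rw [← lintegral_indicator measurableSet_Ioo]
  simp_rw [e3]
  rw [lintegral_indicator measurableSet_Ioo, lintegral_const_mul _ (by fun_prop),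
    lintegral_rpow_beta hα hβ hρ ht.1.le ht.2, hαβ, sub_self, Real.rpow_zero, one_mul,
    mul_right_comm, ← ENNReal.ofReal_mul
      (div_nonneg (Real.rpow_nonneg ht.1.le _) (mul_nonneg (Real.Gamma_pos_of_pos hα).le
        (Real.Gamma_pos_of_pos hβ).le))]
  congr 2
  rw [ProbabilityTheory.beta, add_comm β α, hαβ, Real.Gamma_one]
  have := Real.Gamma_pos_of_pos hα
  have := Real.Gamma_pos_of_pos hβ
  field_simp

theorem katKernel_comp {α β ρ : ℝ} (hα : 0 ≤ α) (hβ : 0 ≤ β) (hαβ : α + β = 1) (hρ : 0 < ρ) :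
    (katKernel β ρ).comp (katKernel α ρ) = katKernel 1 ρ := by
  refine ProbabilityTheory.Kernel.ext fun x => Measure.ext_of_lintegral _ fun f hf => ?_
  rw [ProbabilityTheory.Kernel.lintegral_comp _ _ _ hf]
  simp_rw [katKernel_apply hα, katKernel_apply hβ, katKernel_apply zero_le_one]
  exact lintegral_katMeasure_katMeasure hα hβ hαβ hρ hf

/-- Homogeneity of the density under `s ↦ x * s`. It moves all dependence on `x` out of the measure,
into a power of `x` and the argument of the integrand. -/
theorem katMeasure_eq_map {α ρ x : ℝ} (hα : 0 ≤ α) (hρ : 0 < ρ) (hx : 0 < x) :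
    katMeasure α ρ x =
      ENNReal.ofReal (x ^ (ρ * α)) • (katMeasure α ρ 1).map (fun s => x * s) := by
  rcases hα.eq_or_lt with rfl | hα
  · have : Measurable fun s : ℝ => x * s := by fun_prop
    rw [katMeasure_zero_order, katMeasure_zero_order, Measure.map_dirac' this]
    simp
  refine Measure.ext_of_lintegral _ fun f hf => ?_
  rw [lintegral_smul_measure, lintegral_map hf (by fun_prop), lintegral_katMeasure hα _ _ hf,
    lintegral_katMeasure hα _ _ (by fun_prop)]
  have himage : (fun s => x * s) '' Ioo 0 1 = Ioo 0 x := by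
    rw [image_mul_left_Ioo hx, mul_zero, mul_one]
  have hd : ∀ s ∈ Ioo (0 : ℝ) 1, HasDerivWithinAt (fun s => x * s) x (Ioo 0 1) s := fun s _ => by
    simpa using ((hasDerivAt_id s).const_mul x).hasDerivWithinAt
  rw [← himage, lintegral_image_eq_lintegral_abs_deriv_mul measurableSet_Ioo hd
    (fun _ _ _ _ h => mul_left_cancel₀ hx.ne' h), smul_eq_mul,
    ← lintegral_const_mul' _ _ ENNReal.ofReal_ne_top]
  refine setLIntegral_congr_fun measurableSet_Ioo fun s hs => ?_
  rw [← mul_assoc, ← mul_assoc, ← ENNReal.ofReal_mul (abs_nonneg _),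
    ← ENNReal.ofReal_mul (Real.rpow_nonneg hx.le _), abs_of_pos hx]
  congr 2
  rw [katDensity, katDensity, Real.mul_rpow hx.le hs.1.le, Real.mul_rpow hx.le hs.1.le,
    Real.one_rpow, ← mul_one_sub, Real.mul_rpow (Real.rpow_nonneg hx.le _)
      (sub_nonneg.2 (Real.rpow_le_one hs.1.le hs.2.le hρ.le)), ← Real.rpow_mul hx.le]
  have : x ^ (ρ * α) = x * x ^ (ρ - 1) * x ^ (ρ * (α - 1)) := by
    rw [mul_comm x, ← Real.rpow_add_one hx.ne', ← Real.rpow_add hx]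
    congr 1; ring
  rw [this]
  ring

/-- The right end point is included because the measure of order zero is concentrated there. -/
theorem ae_katMeasure_mem {α ρ x : ℝ} (hα : 0 ≤ α) (hx : 0 < x) :
    ∀ᵐ s ∂(katMeasure α ρ x), s ∈ Ioc 0 x := by
  rcases hα.eq_or_lt with rfl | hα
  · rw [katMeasure_zero_order]
    refine (ae_dirac_iff measurableSet_Ioc).2 ?_
    exact ⟨hx, le_rfl⟩
  · rw [katMeasure_of_pos hα]
    refine (withDensity_absolutelyContinuous _ _).ae_le ?_
    filter_upwards [ae_restrict_mem measurableSet_Ioo] with s hs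
    exact ⟨hs.1, hs.2.le⟩

/-! ### The mixed Katugampola integral of vector-valued functions. -/

section KatInt

variable {E : Type*} [NormedAddCommGroup E]

instance (α ρ x : ℝ) : SFinite (katMeasure α ρ x) := by
  unfold katMeasure
  split_ifs <;> infer_instance

/-- The measure of the mixed Katugampola integral at `p`. -/
noncomputable def katProd (α₁ α₂ ρ₁ ρ₂ : ℝ) (p : ℝ × ℝ) : Measure (ℝ × ℝ) :=
  (katMeasure α₁ ρ₁ p.1).prod (katMeasure α₂ ρ₂ p.2)

/-- Continuous and bounded on `(0, a] × (0, b]`. -/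
structure BoundedContOn (a b : ℝ) (f : ℝ × ℝ → E) : Prop where
  continuousOn : ContinuousOn f (Ioc 0 a ×ˢ Ioc 0 b)
  bounded : ∃ M, ∀ p ∈ Ioc 0 a ×ˢ Ioc 0 b, ‖f p‖ ≤ M

theorem BoundedContOn.of_continuousOn_Icc {a b : ℝ} {f : ℝ × ℝ → E}
    (hf : ContinuousOn f (Icc 0 a ×ˢ Icc 0 b)) : BoundedContOn a b f := by
  have hsub : Ioc 0 a ×ˢ Ioc 0 b ⊆ Icc 0 a ×ˢ Icc 0 b :=
    prod_mono Ioc_subset_Icc_self Ioc_subset_Icc_self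
  obtain ⟨M, hM⟩ := (isCompact_Icc.prod isCompact_Icc).exists_bound_of_continuousOn hf
  exact ⟨hf.mono hsub, M, fun p hp => hM p (hsub hp)⟩

theorem BoundedContOn.sub {a b : ℝ} {f g : ℝ × ℝ → E} (hf : BoundedContOn a b f)
    (hg : BoundedContOn a b g) : BoundedContOn a b (fun p => f p - g p) := by
  obtain ⟨M, hM⟩ := hf.bounded
  obtain ⟨N, hN⟩ := hg.bounded
  exact ⟨hf.continuousOn.sub hg.continuousOn, M + N, fun p hp =>
    (norm_sub_le _ _).trans (add_le_add (hM p hp) (hN p hp))⟩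

variable {α₁ α₂ ρ₁ ρ₂ a b : ℝ}

theorem isFiniteMeasure_katProd (h₁ : 0 ≤ α₁) (h₂ : 0 ≤ α₂) (hρ₁ : 0 < ρ₁) (hρ₂ : 0 < ρ₂)
    (p : ℝ × ℝ) : IsFiniteMeasure (katProd α₁ α₂ ρ₁ ρ₂ p) := by
  have := isFiniteMeasure_katMeasure h₁ hρ₁ p.1
  have := isFiniteMeasure_katMeasure h₂ hρ₂ p.2
  unfold katProd
  infer_instance

theorem ae_katProd_mem (h₁ : 0 ≤ α₁) (h₂ : 0 ≤ α₂) {p : ℝ × ℝ} (hp : 0 < p.1 ∧ 0 < p.2) :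
    ∀ᵐ q ∂(katProd α₁ α₂ ρ₁ ρ₂ p), q ∈ Ioc 0 p.1 ×ˢ Ioc 0 p.2 := by
  have e1 := Measure.quasiMeasurePreserving_fst (μ := katMeasure α₁ ρ₁ p.1)
    (ν := katMeasure α₂ ρ₂ p.2) |>.ae (ae_katMeasure_mem (ρ := ρ₁) h₁ hp.1)
  have e2 := Measure.quasiMeasurePreserving_snd (μ := katMeasure α₁ ρ₁ p.1)
    (ν := katMeasure α₂ ρ₂ p.2) |>.ae (ae_katMeasure_mem (ρ := ρ₂) h₂ hp.2)
  unfold katProd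
  filter_upwards [e1, e2] with q h1 h2
  exact ⟨h1, h2⟩

theorem pos_of_mem_Ioc_prod {p : ℝ × ℝ} (hp : p ∈ Ioc 0 a ×ˢ Ioc 0 b) : 0 < p.1 ∧ 0 < p.2 :=
  ⟨hp.1.1, hp.2.1⟩

theorem Ioc_prod_subset {p : ℝ × ℝ} (hp : p ∈ Ioc 0 a ×ˢ Ioc 0 b) :
    Ioc 0 p.1 ×ˢ Ioc 0 p.2 ⊆ Ioc 0 a ×ˢ Ioc 0 b :=
  prod_mono (Ioc_subset_Ioc_right hp.1.2) (Ioc_subset_Ioc_right hp.2.2)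

theorem BoundedContOn.integrable_of_ae_mem {f : ℝ × ℝ → E} (hf : BoundedContOn a b f)
    {μ : Measure (ℝ × ℝ)} [IsFiniteMeasure μ] (h : ∀ᵐ q ∂μ, q ∈ Ioc 0 a ×ˢ Ioc 0 b) :
    Integrable f μ := by
  obtain ⟨M, hM⟩ := hf.bounded
  have hm : AEStronglyMeasurable f μ := by
    rw [← Measure.restrict_eq_self_of_ae_mem h]
    exact hf.continuousOn.aestronglyMeasurable (measurableSet_Ioc.prod measurableSet_Ioc)
  refine Integrable.of_bound hm M ?_
  filter_upwards [h] with q hq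
  exact hM q hq

theorem BoundedContOn.integrable {f : ℝ × ℝ → E} (hf : BoundedContOn a b f) (h₁ : 0 ≤ α₁)
    (h₂ : 0 ≤ α₂) (hρ₁ : 0 < ρ₁) (hρ₂ : 0 < ρ₂) {p : ℝ × ℝ} (hp : p ∈ Ioc 0 a ×ˢ Ioc 0 b) :
    Integrable f (katProd α₁ α₂ ρ₁ ρ₂ p) := by
  have := isFiniteMeasure_katProd h₁ h₂ hρ₁ hρ₂ p
  refine hf.integrable_of_ae_mem ?_
  filter_upwards [ae_katProd_mem h₁ h₂ (pos_of_mem_Ioc_prod hp)] with q hq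
  exact Ioc_prod_subset hp hq

theorem eq_zero_of_tendsto_zero {f : ℝ → E} {c : ℝ} {x : ℝ} (hx : x ∈ Ioc 0 c)
    (h : ∀ y ∈ Ioc 0 c, f y = f x) (h0 : Tendsto f (𝓝[Ioc 0 c] 0) (𝓝 0)) : f x = 0 := by
  have : (𝓝[Ioc 0 c] (0 : ℝ)).NeBot := by
    have hc : 0 < c := hx.1.trans_le hx.2
    rw [← mem_closure_iff_nhdsWithin_neBot, closure_Ioc hc.ne]
    exact ⟨le_rfl, hc.le⟩
  refine tendsto_nhds_unique ((tendsto_const_nhds (x := f x)).congr' ?_) h0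
  filter_upwards [self_mem_nhdsWithin] with y hy
  exact (h y hy).symm

variable [NormedSpace ℝ E]

/-- The mixed Katugampola integral of a vector-valued function. -/
noncomputable def katInt (α₁ α₂ ρ₁ ρ₂ : ℝ) (f : ℝ × ℝ → E) (p : ℝ × ℝ) : E :=
  ∫ q, f q ∂(katProd α₁ α₂ ρ₁ ρ₂ p)

theorem katProd_eq_map (h₁ : 0 ≤ α₁) (h₂ : 0 ≤ α₂) (hρ₁ : 0 < ρ₁) (hρ₂ : 0 < ρ₂)
    {p : ℝ × ℝ} (hp : 0 < p.1 ∧ 0 < p.2) :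
    katProd α₁ α₂ ρ₁ ρ₂ p = ENNReal.ofReal (p.1 ^ (ρ₁ * α₁) * p.2 ^ (ρ₂ * α₂)) •
      (katProd α₁ α₂ ρ₁ ρ₂ (1, 1)).map (Prod.map (fun s => p.1 * s) (fun s => p.2 * s)) := by
  have m1 : Measurable fun s : ℝ => p.1 * s := by fun_prop
  have m2 : Measurable fun s : ℝ => p.2 * s := by fun_prop
  rw [katProd, katMeasure_eq_map h₁ hρ₁ hp.1, katMeasure_eq_map h₂ hρ₂ hp.2,
    Measure.prod_smul_left, Measure.prod_smul_right, Measure.map_prod_map _ _ m1 m2, smul_smul,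
    ← ENNReal.ofReal_mul (Real.rpow_nonneg hp.1.le _)]
  rfl

/-- The integral is now against one fixed finite measure, so bounds and continuity in `p` reduce to
those of the integrand and of an explicit power. -/
theorem katInt_eq_smul_integral (h₁ : 0 ≤ α₁) (h₂ : 0 ≤ α₂) (hρ₁ : 0 < ρ₁) (hρ₂ : 0 < ρ₂)
    (f : ℝ × ℝ → E) {p : ℝ × ℝ} (hp : 0 < p.1 ∧ 0 < p.2) :
    katInt α₁ α₂ ρ₁ ρ₂ f p = (p.1 ^ (ρ₁ * α₁) * p.2 ^ (ρ₂ * α₂)) •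
      ∫ q, f (p.1 * q.1, p.2 * q.2) ∂(katProd α₁ α₂ ρ₁ ρ₂ (1, 1)) := by
  have he : MeasurableEmbedding (Prod.map (fun s => p.1 * s) (fun s => p.2 * s)) :=
    (Homeomorph.mulLeft₀ p.1 hp.1.ne').measurableEmbedding.prodMap
      (Homeomorph.mulLeft₀ p.2 hp.2.ne').measurableEmbedding
  rw [katInt, katProd_eq_map h₁ h₂ hρ₁ hρ₂ hp, integral_smul_measure, he.integral_map,
    ENNReal.toReal_ofReal (mul_nonneg (Real.rpow_nonneg hp.1.le _) (Real.rpow_nonneg hp.2.le _))]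
  rfl

theorem norm_katInt_le (h₁ : 0 ≤ α₁) (h₂ : 0 ≤ α₂) (hρ₁ : 0 < ρ₁) (hρ₂ : 0 < ρ₂)
    {f : ℝ × ℝ → E} {M : ℝ} {p : ℝ × ℝ} (hp : 0 < p.1 ∧ 0 < p.2)
    (hf : ∀ q ∈ Ioc 0 p.1 ×ˢ Ioc 0 p.2, ‖f q‖ ≤ M) :
    ‖katInt α₁ α₂ ρ₁ ρ₂ f p‖ ≤ p.1 ^ (ρ₁ * α₁) * p.2 ^ (ρ₂ * α₂) *
      (M * (katProd α₁ α₂ ρ₁ ρ₂ (1, 1)).real univ) := by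
  have := isFiniteMeasure_katProd h₁ h₂ hρ₁ hρ₂ (1, 1)
  have hc : 0 ≤ p.1 ^ (ρ₁ * α₁) * p.2 ^ (ρ₂ * α₂) :=
    mul_nonneg (Real.rpow_nonneg hp.1.le _) (Real.rpow_nonneg hp.2.le _)
  rw [katInt_eq_smul_integral h₁ h₂ hρ₁ hρ₂ f hp, norm_smul, Real.norm_of_nonneg hc]
  refine mul_le_mul_of_nonneg_left (norm_integral_le_of_norm_le_const ?_) hc
  filter_upwards [ae_katProd_mem (ρ₁ := ρ₁) (ρ₂ := ρ₂) h₁ h₂ (p := (1, 1))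
    ⟨one_pos, one_pos⟩] with q hq
  exact hf _ ⟨⟨mul_pos hp.1 hq.1.1, mul_le_of_le_one_right hp.1.le hq.1.2⟩,
    ⟨mul_pos hp.2 hq.2.1, mul_le_of_le_one_right hp.2.le hq.2.2⟩⟩

/-- Dominated convergence in the rescaled form. Orders zero are allowed, which is why nothing is
claimed on the axes. -/
theorem BoundedContOn.katInt {f : ℝ × ℝ → E} (hf : BoundedContOn a b f) (h₁ : 0 ≤ α₁)
    (h₂ : 0 ≤ α₂) (hρ₁ : 0 < ρ₁) (hρ₂ : 0 < ρ₂) :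
    BoundedContOn a b (katInt α₁ α₂ ρ₁ ρ₂ f) := by
  obtain ⟨M, hM⟩ := hf.bounded
  have hfin := isFiniteMeasure_katProd h₁ h₂ hρ₁ hρ₂ (1, 1)
  have hae := ae_katProd_mem (ρ₁ := ρ₁) (ρ₂ := ρ₂) h₁ h₂ (p := (1, 1)) ⟨one_pos, one_pos⟩
  have hmaps : ∀ p ∈ Ioc 0 a ×ˢ Ioc 0 b, ∀ q ∈ Ioc (0 : ℝ) 1 ×ˢ Ioc (0 : ℝ) 1,
      (p.1 * q.1, p.2 * q.2) ∈ Ioc 0 a ×ˢ Ioc 0 b := fun p hp q hq =>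
    ⟨⟨mul_pos hp.1.1 hq.1.1, (mul_le_of_le_one_right hp.1.1.le hq.1.2).trans hp.1.2⟩,
      ⟨mul_pos hp.2.1 hq.2.1, (mul_le_of_le_one_right hp.2.1.le hq.2.2).trans hp.2.2⟩⟩
  refine ⟨?_, ?_⟩
  · have h : ContinuousOn (fun p : ℝ × ℝ => (p.1 ^ (ρ₁ * α₁) * p.2 ^ (ρ₂ * α₂)) •
        ∫ q, f (p.1 * q.1, p.2 * q.2) ∂(katProd α₁ α₂ ρ₁ ρ₂ (1, 1))) (Ioc 0 a ×ˢ Ioc 0 b) := by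
      refine ContinuousOn.smul ?_ ?_
      · refine ContinuousOn.mul ?_ ?_
        · exact continuousOn_fst.rpow_const fun p hp => Or.inl hp.1.1.ne'
        · exact continuousOn_snd.rpow_const fun p hp => Or.inl hp.2.1.ne'
      · refine continuousOn_of_dominated (bound := fun _ => M) ?_ ?_ (integrable_const _) ?_
        · intro p hp
          rw [← Measure.restrict_eq_self_of_ae_mem hae]
          refine ContinuousOn.aestronglyMeasurable ?_ (measurableSet_Ioc.prod measurableSet_Ioc)
          exact hf.continuousOn.comp (by fun_prop) fun q hq => hmaps p hp q hq
        · intro p hp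
          filter_upwards [hae] with q hq
          exact hM _ (hmaps p hp q hq)
        · filter_upwards [hae] with q hq
          exact hf.continuousOn.comp (by fun_prop) fun p hp => hmaps p hp q hq
    exact h.congr fun p hp => katInt_eq_smul_integral h₁ h₂ hρ₁ hρ₂ f (pos_of_mem_Ioc_prod hp)
  · refine ⟨a ^ (ρ₁ * α₁) * b ^ (ρ₂ * α₂) *
      (M * (katProd α₁ α₂ ρ₁ ρ₂ (1, 1)).real univ), fun p hp => ?_⟩
    have hM0 : 0 ≤ M := (norm_nonneg _).trans (hM p hp)
    refine (norm_katInt_le h₁ h₂ hρ₁ hρ₂ (pos_of_mem_Ioc_prod hp)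
      fun q hq => hM q (Ioc_prod_subset hp hq)).trans ?_
    have := hp.1.1
    have := hp.2.1
    have := hp.1.2
    have := hp.2.2
    have : 0 < a := by linarith
    have : 0 < b := by linarith
    have e1 : p.1 ^ (ρ₁ * α₁) ≤ a ^ (ρ₁ * α₁) :=
      Real.rpow_le_rpow (by linarith) hp.1.2 (by positivity)
    have e2 : p.2 ^ (ρ₂ * α₂) ≤ b ^ (ρ₂ * α₂) :=
      Real.rpow_le_rpow (by linarith) hp.2.2 (by positivity)
    gcongr

theorem katProd_eq_zero (h₁ : 0 < α₁) (h₂ : 0 < α₂) {p : ℝ × ℝ} (hp : p.1 ≤ 0 ∨ p.2 ≤ 0) :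
    katProd α₁ α₂ ρ₁ ρ₂ p = 0 := by
  rcases hp with hp | hp
  · rw [katProd, katMeasure_of_nonpos h₁ hp, Measure.zero_prod]
  · rw [katProd, katMeasure_of_nonpos h₂ hp, Measure.prod_zero]

theorem katInt_eq_zero (h₁ : 0 < α₁) (h₂ : 0 < α₂) (f : ℝ × ℝ → E) {p : ℝ × ℝ}
    (hp : p.1 ≤ 0 ∨ p.2 ≤ 0) : katInt α₁ α₂ ρ₁ ρ₂ f p = 0 := by
  rw [katInt, katProd_eq_zero h₁ h₂ hp, integral_zero_measure]

/-- For positive orders the prefactor `x ^ (ρ₁ * α₁) * y ^ (ρ₂ * α₂)` tends to zero at the axes.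
There the measure itself vanishes, so the value matches the limit. -/
theorem BoundedContOn.continuousOn_katInt {f : ℝ × ℝ → E} (hf : BoundedContOn a b f)
    (h₁ : 0 < α₁) (h₂ : 0 < α₂) (hρ₁ : 0 < ρ₁) (hρ₂ : 0 < ρ₂) :
    ContinuousOn (CFuzzy.katInt α₁ α₂ ρ₁ ρ₂ f) (Icc 0 a ×ˢ Icc 0 b) := by
  intro p hp
  by_cases h : 0 < p.1 ∧ 0 < p.2
  · have hp' : p ∈ Ioc 0 a ×ˢ Ioc 0 b := ⟨⟨h.1, hp.1.2⟩, ⟨h.2, hp.2.2⟩⟩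
    refine ((hf.katInt h₁.le h₂.le hρ₁ hρ₂).continuousOn p hp').mono_of_mem_nhdsWithin ?_
    have ho : {q : ℝ × ℝ | 0 < q.1 ∧ 0 < q.2} ∈ 𝓝[Icc 0 a ×ˢ Icc 0 b] p :=
      mem_nhdsWithin_of_mem_nhds (((isOpen_lt continuous_const continuous_fst).inter
        (isOpen_lt continuous_const continuous_snd)).mem_nhds h)
    filter_upwards [ho, self_mem_nhdsWithin] with q h1 h2
    exact ⟨⟨h1.1, h2.1.2⟩, ⟨h1.2, h2.2.2⟩⟩
  · have hp' : p.1 = 0 ∨ p.2 = 0 := by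
      by_contra hcon
      push Not at hcon
      exact h ⟨lt_of_le_of_ne hp.1.1 hcon.1.symm, lt_of_le_of_ne hp.2.1 hcon.2.symm⟩
    obtain ⟨M, hM⟩ := hf.bounded
    set C := M * (katProd α₁ α₂ ρ₁ ρ₂ (1, 1)).real univ with hC
    have hbound : ∀ q ∈ Icc 0 a ×ˢ Icc 0 b, ‖CFuzzy.katInt α₁ α₂ ρ₁ ρ₂ f q‖ ≤
        q.1 ^ (ρ₁ * α₁) * q.2 ^ (ρ₂ * α₂) * |C| := by
      intro q hq
      have h1 : 0 ≤ q.1 ^ (ρ₁ * α₁) := Real.rpow_nonneg hq.1.1 _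
      have h2 : 0 ≤ q.2 ^ (ρ₂ * α₂) := Real.rpow_nonneg hq.2.1 _
      by_cases hq0 : 0 < q.1 ∧ 0 < q.2
      · have hq' : q ∈ Ioc 0 a ×ˢ Ioc 0 b := ⟨⟨hq0.1, hq.1.2⟩, ⟨hq0.2, hq.2.2⟩⟩
        refine (norm_katInt_le h₁.le h₂.le hρ₁ hρ₂ hq0
          fun z hz => hM z (Ioc_prod_subset hq' hz)).trans ?_
        exact mul_le_mul_of_nonneg_left (le_abs_self C) (mul_nonneg h1 h2)
      · rw [katInt_eq_zero h₁ h₂ f (by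
          rcases not_and_or.1 hq0 with h | h
          · exact Or.inl (not_lt.1 h)
          · exact Or.inr (not_lt.1 h)), norm_zero]
        positivity
    have hlim : Tendsto (fun q : ℝ × ℝ => q.1 ^ (ρ₁ * α₁) * q.2 ^ (ρ₂ * α₂) * |C|)
        (𝓝[Icc 0 a ×ˢ Icc 0 b] p) (𝓝 0) := by
      have hc : Continuous fun q : ℝ × ℝ => q.1 ^ (ρ₁ * α₁) * q.2 ^ (ρ₂ * α₂) * |C| :=
        ((continuous_fst.rpow_const fun _ => Or.inr (by positivity)).mul
          (continuous_snd.rpow_const fun _ => Or.inr (by positivity))).mul continuous_const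
      have := hc.tendsto p
      have h0 : p.1 ^ (ρ₁ * α₁) * p.2 ^ (ρ₂ * α₂) * |C| = 0 := by
        rcases hp' with h | h <;> rw [h, Real.zero_rpow (by positivity)] <;> simp
      rw [h0] at this
      exact this.mono_left nhdsWithin_le_nhds
    rw [ContinuousWithinAt, katInt_eq_zero h₁ h₂ f (hp'.imp le_of_eq le_of_eq)]
    refine squeeze_zero_norm' ?_ hlim
    filter_upwards [self_mem_nhdsWithin] with q hq
    exact hbound q hq

/-- The one-variable composition law holds between kernels, so it passes to parallel products, and
integrating against a composed kernel is iterated integration. -/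
theorem BoundedContOn.katInt_katInt {f : ℝ × ℝ → E} (hf : BoundedContOn a b f) {β₁ β₂ : ℝ}
    (h₁ : 0 ≤ α₁) (h₂ : 0 ≤ α₂) (hβ₁ : 0 ≤ β₁) (hβ₂ : 0 ≤ β₂) (e₁ : α₁ + β₁ = 1)
    (e₂ : α₂ + β₂ = 1) (hρ₁ : 0 < ρ₁) (hρ₂ : 0 < ρ₂) {p : ℝ × ℝ} (hp : p ∈ Ioc 0 a ×ˢ Ioc 0 b) :
    CFuzzy.katInt α₁ α₂ ρ₁ ρ₂ (CFuzzy.katInt β₁ β₂ ρ₁ ρ₂ f) p = CFuzzy.katInt 1 1 ρ₁ ρ₂ f p := by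
  have hk : ∀ {γ₁ γ₂ : ℝ}, 0 ≤ γ₁ → 0 ≤ γ₂ → ∀ q,
      ((katKernel γ₁ ρ₁).parallelComp (katKernel γ₂ ρ₂)) q = katProd γ₁ γ₂ ρ₁ ρ₂ q := by
    intro γ₁ γ₂ hγ₁ hγ₂ q
    rw [ProbabilityTheory.Kernel.parallelComp_apply, katKernel_apply hγ₁, katKernel_apply hγ₂]
    rfl
  have hint := hf.integrable zero_le_one zero_le_one hρ₁ hρ₂ hp
  have hcomp := ProbabilityTheory.Kernel.parallelComp_comp_parallelComp
    (κ := katKernel α₁ ρ₁) (η := katKernel β₁ ρ₁) (κ' := katKernel α₂ ρ₂) (η' := katKernel β₂ ρ₂)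
  rw [katKernel_comp h₁ hβ₁ e₁ hρ₁, katKernel_comp h₂ hβ₂ e₂ hρ₂] at hcomp
  simp only [CFuzzy.katInt]
  rw [← hk zero_le_one zero_le_one, ← hcomp] at hint ⊢
  rw [ProbabilityTheory.Kernel.integral_comp hint, hk h₁ h₂]
  simp_rw [hk hβ₁ hβ₂]

/-! ### Differentiating integrals of order one, and injectivity of the fractional integral. -/

theorem integral_katMeasure_one {ρ x : ℝ} (hx : 0 ≤ x) (f : ℝ → E) :
    ∫ s, f s ∂(katMeasure 1 ρ x) = ∫ s in (0 : ℝ)..x, s ^ (ρ - 1) • f s := by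
  rw [katMeasure_of_pos one_pos, integral_withDensity_eq_integral_toReal_smul (by fun_prop)
    (Eventually.of_forall fun _ => ENNReal.ofReal_lt_top), intervalIntegral.integral_of_le hx,
    integral_Ioc_eq_integral_Ioo]
  refine setIntegral_congr_fun measurableSet_Ioo fun s hs => ?_
  simp only [katDensity_one]
  rw [ENNReal.toReal_ofReal (Real.rpow_nonneg hs.1.le _)]

theorem intervalIntegrable_rpow_smul {ρ c : ℝ} (hρ : 0 < ρ) {f : ℝ → E}
    (hf : ContinuousOn f (Ioc 0 c)) (hb : ∃ M, ∀ s ∈ Ioc 0 c, ‖f s‖ ≤ M) {x : ℝ}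
    (hx : x ∈ Ioc 0 c) : IntervalIntegrable (fun s => s ^ (ρ - 1) • f s) volume 0 x := by
  obtain ⟨M, hM⟩ := hb
  have h1 : IntervalIntegrable (fun s : ℝ => s ^ (ρ - 1)) volume 0 x :=
    intervalIntegral.intervalIntegrable_rpow' (by linarith)
  rw [intervalIntegrable_iff_integrableOn_Ioc_of_le hx.1.le] at h1 ⊢
  refine Integrable.smul_bdd h1 M ?_ ?_
  · exact (hf.mono (Ioc_subset_Ioc_right hx.2)).aestronglyMeasurable measurableSet_Ioc
  · filter_upwards [ae_restrict_mem measurableSet_Ioc] with s hs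
    exact hM s ⟨hs.1, hs.2.trans hx.2⟩

theorem hasDerivWithinAt_integral_katMeasure_one [CompleteSpace E] {ρ c : ℝ} (hρ : 0 < ρ)
    {f : ℝ → E} (hf : ContinuousOn f (Ioc 0 c)) (hb : ∃ M, ∀ s ∈ Ioc 0 c, ‖f s‖ ≤ M) {x : ℝ}
    (hx : x ∈ Ioc 0 c) :
    HasDerivWithinAt (fun t => ∫ s, f s ∂(katMeasure 1 ρ t)) (x ^ (ρ - 1) • f x) (Ioc 0 c) x := by
  have hcont : ContinuousOn (fun s => s ^ (ρ - 1) • f s) (Ioc 0 c) :=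
    (continuousOn_id.rpow_const fun s hs => Or.inl hs.1.ne').smul hf
  have hmem : Ioc 0 c ∈ 𝓝[Icc 0 c] x := by
    filter_upwards [self_mem_nhdsWithin, mem_nhdsWithin_of_mem_nhds (Ioi_mem_nhds hx.1)]
      with s h1 h2
    exact ⟨h2, h1.2⟩
  -- This fact selects the version of the fundamental theorem of calculus relative to the closed
  -- interval, which also covers the right end point `c`.
  have : Fact (x ∈ Icc 0 c) := ⟨⟨hx.1.le, hx.2⟩⟩
  have key : HasDerivWithinAt (fun t => ∫ s in (0 : ℝ)..t, s ^ (ρ - 1) • f s)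
      (x ^ (ρ - 1) • f x) (Icc 0 c) x :=
    intervalIntegral.integral_hasDerivWithinAt_right (intervalIntegrable_rpow_smul hρ hf hb hx)
      ⟨Ioc 0 c, hmem, hcont.aestronglyMeasurable measurableSet_Ioc⟩
      ((hcont x hx).mono_of_mem_nhdsWithin hmem)
  refine (key.mono Ioc_subset_Icc_self).congr (fun t ht => ?_) ?_
  · exact integral_katMeasure_one ht.1.le f
  · exact integral_katMeasure_one hx.1.le f

theorem BoundedContOn.katInt_zero_one {f : ℝ × ℝ → E} (hf : BoundedContOn a b f) (hρ₁ : 0 < ρ₁)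
    (hρ₂ : 0 < ρ₂) {p : ℝ × ℝ} (hp : p ∈ Ioc 0 a ×ˢ Ioc 0 b) :
    CFuzzy.katInt 0 1 ρ₁ ρ₂ f p = ∫ t, f (p.1, t) ∂(katMeasure 1 ρ₂ p.2) := by
  have hint := hf.integrable le_rfl zero_le_one hρ₁ hρ₂ hp
  rw [CFuzzy.katInt]
  rw [katProd, katMeasure_zero_order, Measure.dirac_prod] at hint ⊢
  exact integral_map (by fun_prop) hint.aestronglyMeasurable

theorem BoundedContOn.katInt_one_one {f : ℝ × ℝ → E} (hf : BoundedContOn a b f) (hρ₁ : 0 < ρ₁)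
    (hρ₂ : 0 < ρ₂) {p : ℝ × ℝ} (hp : p ∈ Ioc 0 a ×ˢ Ioc 0 b) :
    CFuzzy.katInt 1 1 ρ₁ ρ₂ f p =
      ∫ s, CFuzzy.katInt 0 1 ρ₁ ρ₂ f (s, p.2) ∂(katMeasure 1 ρ₁ p.1) := by
  have hint := hf.integrable zero_le_one zero_le_one hρ₁ hρ₂ hp
  rw [CFuzzy.katInt, katProd, integral_prod _ hint]
  refine integral_congr_ae ?_
  filter_upwards [ae_katMeasure_mem zero_le_one hp.1.1] with s hs
  exact (hf.katInt_zero_one hρ₁ hρ₂ (p := (s, p.2)) ⟨⟨hs.1, hs.2.trans hp.1.2⟩, hp.2⟩).symm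

theorem BoundedContOn.hasDerivWithinAt_fst [CompleteSpace E] {f : ℝ × ℝ → E}
    (hf : BoundedContOn a b f) (hρ₁ : 0 < ρ₁) (hρ₂ : 0 < ρ₂) {x y : ℝ} (hx : x ∈ Ioc 0 a)
    (hy : y ∈ Ioc 0 b) :
    HasDerivWithinAt (fun s => CFuzzy.katInt 1 1 ρ₁ ρ₂ f (s, y))
      (x ^ (ρ₁ - 1) • CFuzzy.katInt 0 1 ρ₁ ρ₂ f (x, y)) (Ioc 0 a) x := by
  have hn := hf.katInt (α₁ := 0) (α₂ := 1) le_rfl zero_le_one hρ₁ hρ₂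
  have h := hasDerivWithinAt_integral_katMeasure_one hρ₁
    (f := fun s => CFuzzy.katInt 0 1 ρ₁ ρ₂ f (s, y)) (c := a)
    (hn.continuousOn.comp (by fun_prop) fun s hs => ⟨hs, hy⟩)
    (hn.bounded.imp fun M hM s hs => hM _ ⟨hs, hy⟩) hx
  exact h.congr (fun s hs => hf.katInt_one_one hρ₁ hρ₂ ⟨hs, hy⟩)
    (hf.katInt_one_one hρ₁ hρ₂ ⟨hx, hy⟩)

theorem BoundedContOn.hasDerivWithinAt_snd [CompleteSpace E] {f : ℝ × ℝ → E}
    (hf : BoundedContOn a b f) (hρ₁ : 0 < ρ₁) (hρ₂ : 0 < ρ₂) {x y : ℝ} (hx : x ∈ Ioc 0 a)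
    (hy : y ∈ Ioc 0 b) :
    HasDerivWithinAt (fun t => CFuzzy.katInt 0 1 ρ₁ ρ₂ f (x, t))
      (y ^ (ρ₂ - 1) • f (x, y)) (Ioc 0 b) y := by
  have h := hasDerivWithinAt_integral_katMeasure_one hρ₂ (f := fun t => f (x, t)) (c := b)
    (hf.continuousOn.comp (by fun_prop) fun s hs => ⟨hx, hs⟩)
    (hf.bounded.imp fun M hM s hs => hM _ ⟨hx, hs⟩) hy
  exact h.congr (fun t ht => hf.katInt_zero_one hρ₁ hρ₂ (p := (x, t)) ⟨hx, ht⟩)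
    (hf.katInt_zero_one hρ₁ hρ₂ (p := (x, y)) ⟨hx, hy⟩)

theorem katInt_congr {f g : ℝ × ℝ → E} (h₁ : 0 ≤ α₁) (h₂ : 0 ≤ α₂) {p : ℝ × ℝ}
    (hp : p ∈ Ioc 0 a ×ˢ Ioc 0 b) (h : ∀ q ∈ Ioc 0 a ×ˢ Ioc 0 b, f q = g q) :
    katInt α₁ α₂ ρ₁ ρ₂ f p = katInt α₁ α₂ ρ₁ ρ₂ g p := by
  refine integral_congr_ae ?_
  filter_upwards [ae_katProd_mem h₁ h₂ (pos_of_mem_Ioc_prod hp)] with q hq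
  exact h q (Ioc_prod_subset hp hq)

theorem uniqueDiffWithinAt_Ioc {c x : ℝ} (hx : x ∈ Ioc 0 c) :
    UniqueDiffWithinAt ℝ (Ioc 0 c) x := by
  refine uniqueDiffWithinAt_convex (convex_Ioc 0 c) ?_ (subset_closure hx)
  rw [interior_Ioc]
  exact nonempty_Ioo.2 (hx.1.trans_le hx.2)

/-- Applying the integral of complementary order gives a vanishing integral of order `(1, 1)`. One
differentiation in each variable then recovers `f` up to positive powers. -/
theorem BoundedContOn.eq_zero_of_katInt_eq_zero [CompleteSpace E] {f : ℝ × ℝ → E}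
    (hf : BoundedContOn a b f) (h₁ : α₁ ∈ Icc (0 : ℝ) 1) (h₂ : α₂ ∈ Icc (0 : ℝ) 1) (hρ₁ : 0 < ρ₁)
    (hρ₂ : 0 < ρ₂) (h : ∀ p ∈ Ioc 0 a ×ˢ Ioc 0 b, CFuzzy.katInt α₁ α₂ ρ₁ ρ₂ f p = 0) :
    ∀ p ∈ Ioc 0 a ×ˢ Ioc 0 b, f p = 0 := by
  have h1 : ∀ p ∈ Ioc 0 a ×ˢ Ioc 0 b, CFuzzy.katInt 1 1 ρ₁ ρ₂ f p = 0 := by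
    intro p hp
    rw [← hf.katInt_katInt (α₁ := 1 - α₁) (α₂ := 1 - α₂) (sub_nonneg.2 h₁.2) (sub_nonneg.2 h₂.2)
      h₁.1 h₂.1 (by ring) (by ring) hρ₁ hρ₂ hp,
      katInt_congr (sub_nonneg.2 h₁.2) (sub_nonneg.2 h₂.2) hp h]
    exact integral_zero _ _
  have h2 : ∀ p ∈ Ioc 0 a ×ˢ Ioc 0 b, CFuzzy.katInt 0 1 ρ₁ ρ₂ f p = 0 := by
    rintro ⟨x, y⟩ ⟨hx, hy⟩
    have d1 := hf.hasDerivWithinAt_fst hρ₁ hρ₂ hx hy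
    have d2 : HasDerivWithinAt (fun s => CFuzzy.katInt 1 1 ρ₁ ρ₂ f (s, y)) 0 (Ioc 0 a) x :=
      (hasDerivWithinAt_const x _ (0 : E)).congr (fun s hs => h1 _ ⟨hs, hy⟩) (h1 _ ⟨hx, hy⟩)
    have := (uniqueDiffWithinAt_Ioc hx).eq_deriv _ d1 d2
    exact (smul_eq_zero.1 this).resolve_left (Real.rpow_pos_of_pos hx.1 _).ne'
  rintro ⟨x, y⟩ ⟨hx, hy⟩
  have d1 := hf.hasDerivWithinAt_snd hρ₁ hρ₂ hx hy
  have d2 : HasDerivWithinAt (fun t => CFuzzy.katInt 0 1 ρ₁ ρ₂ f (x, t)) 0 (Ioc 0 b) y :=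
    (hasDerivWithinAt_const y _ (0 : E)).congr (fun t ht => h2 _ ⟨hx, ht⟩) (h2 _ ⟨hx, hy⟩)
  have := (uniqueDiffWithinAt_Ioc hy).eq_deriv _ d1 d2
  exact (smul_eq_zero.1 this).resolve_left (Real.rpow_pos_of_pos hy.1 _).ne'

/-! ### Boundary limits, and recovery of a function from its mixed derivative. -/

/-- When `α₁ = 0` the prefactor does not decay as `x → 0`. The decay comes instead from `f`
vanishing on the edge `x = 0`, uniformly by compactness. -/
theorem tendsto_katInt_fst {f : ℝ × ℝ → E} (hf : ContinuousOn f (Icc 0 a ×ˢ Icc 0 b))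
    (h0 : ∀ y ∈ Icc 0 b, f (0, y) = 0) (h₁ : 0 ≤ α₁) (h₂ : 0 ≤ α₂) (hρ₁ : 0 < ρ₁) (hρ₂ : 0 < ρ₂)
    {y : ℝ} (hy : y ∈ Ioc 0 b) :
    Tendsto (fun x => katInt α₁ α₂ ρ₁ ρ₂ f (x, y)) (𝓝[Ioc 0 a] 0) (𝓝 0) := by
  rcases le_or_gt a 0 with ha | ha
  · rw [Ioc_eq_empty (not_lt.2 ha), nhdsWithin_empty]
    exact tendsto_bot
  set C := a ^ (ρ₁ * α₁) * y ^ (ρ₂ * α₂) * (katProd α₁ α₂ ρ₁ ρ₂ (1, 1)).real univ with hC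
  have hC0 : 0 ≤ C := by have := hy.1; positivity
  rw [Metric.tendsto_nhdsWithin_nhds]
  intro ε hε
  have hu := (isCompact_Icc.prod isCompact_Icc).uniformContinuousOn_of_continuous hf
  rw [Metric.uniformContinuousOn_iff] at hu
  -- `C` may be zero; dividing by `C + 1` keeps the tolerance defined and the final inequality
  -- strict.
  obtain ⟨δ, hδ, hδ'⟩ := hu (ε / (C + 1)) (by positivity)
  refine ⟨δ, hδ, fun {x} hx hxd => ?_⟩
  rw [Real.dist_eq, sub_zero, abs_of_pos hx.1] at hxd
  rw [dist_zero_right]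
  have hle : ∀ q ∈ Ioc 0 x ×ˢ Ioc 0 y, ‖f q‖ ≤ ε / (C + 1) := by
    rintro ⟨s, t⟩ ⟨hs, ht⟩
    have ht' : t ∈ Icc 0 b := ⟨ht.1.le, ht.2.trans hy.2⟩
    have := hδ' (s, t) ⟨⟨hs.1.le, hs.2.trans hx.2⟩, ht'⟩ (0, t) ⟨⟨le_rfl, ha.le⟩, ht'⟩ (by
      rw [Prod.dist_eq, dist_self, Real.dist_eq, sub_zero, abs_of_pos hs.1]
      exact max_lt (hs.2.trans_lt hxd) hδ)
    rw [h0 t ht', dist_zero_right] at this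
    exact this.le
  refine (norm_katInt_le (p := (x, y)) h₁ h₂ hρ₁ hρ₂ ⟨hx.1, hy.1⟩ hle).trans_lt ?_
  have hxa : x ^ (ρ₁ * α₁) ≤ a ^ (ρ₁ * α₁) :=
    Real.rpow_le_rpow hx.1.le hx.2 (by positivity)
  calc x ^ (ρ₁ * α₁) * y ^ (ρ₂ * α₂) *
        (ε / (C + 1) * (katProd α₁ α₂ ρ₁ ρ₂ (1, 1)).real univ)
      ≤ a ^ (ρ₁ * α₁) * y ^ (ρ₂ * α₂) *
        (ε / (C + 1) * (katProd α₁ α₂ ρ₁ ρ₂ (1, 1)).real univ) := by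
        have := hy.1
        gcongr
    _ = ε * (C / (C + 1)) := by rw [hC]; ring
    _ < ε * 1 := by
        refine mul_lt_mul_of_pos_left ?_ hε
        rw [div_lt_one (by positivity)]
        linarith
    _ = ε := mul_one ε

theorem katInt_swap (f : ℝ × ℝ → E) (x y : ℝ) :
    katInt α₁ α₂ ρ₁ ρ₂ f (x, y) = katInt α₂ α₁ ρ₂ ρ₁ (fun q => f q.swap) (y, x) :=
  (integral_prod_swap (μ := katMeasure α₁ ρ₁ x) (ν := katMeasure α₂ ρ₂ y) f).symm

theorem tendsto_katInt_snd {f : ℝ × ℝ → E} (hf : ContinuousOn f (Icc 0 a ×ˢ Icc 0 b))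
    (h0 : ∀ x ∈ Icc 0 a, f (x, 0) = 0) (h₁ : 0 ≤ α₁) (h₂ : 0 ≤ α₂) (hρ₁ : 0 < ρ₁) (hρ₂ : 0 < ρ₂)
    {x : ℝ} (hx : x ∈ Ioc 0 a) :
    Tendsto (fun y => katInt α₁ α₂ ρ₁ ρ₂ f (x, y)) (𝓝[Ioc 0 b] 0) (𝓝 0) := by
  simp_rw [fun y => katInt_swap (α₁ := α₁) (α₂ := α₂) (ρ₁ := ρ₁) (ρ₂ := ρ₂) f x y]
  exact tendsto_katInt_fst (f := fun q => f q.swap)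
    (hf.comp continuous_swap.continuousOn fun q hq => ⟨hq.2, hq.1⟩) h0 h₂ h₁ hρ₂ hρ₁ hx

theorem eq_of_hasDerivWithinAt_zero {f : ℝ → E} {c : ℝ}
    (h : ∀ x ∈ Ioc 0 c, HasDerivWithinAt f 0 (Ioc 0 c) x) {x y : ℝ} (hx : x ∈ Ioc 0 c)
    (hy : y ∈ Ioc 0 c) : f x = f y := by
  have := (convex_Ioc 0 c).norm_image_sub_le_of_norm_hasDerivWithin_le (C := 0) h
    (fun x _ => by simp) hy hx
  rw [zero_mul, norm_le_zero_iff, sub_eq_zero] at this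
  exact this

/-- Since `Wx` does not depend on `y`, the difference `W t z - W t y` is constant in `t`, and its
limit at `t = 0` is zero. So `W x` is constant in `y`, again with limit zero. -/
theorem eq_zero_of_mixed_deriv_eq_zero {W Wx : ℝ → ℝ → E}
    (hx : ∀ x ∈ Ioc 0 a, ∀ y ∈ Ioc 0 b,
      HasDerivWithinAt (fun t => W t y) (Wx x y) (Ioc 0 a) x)
    (hy : ∀ x ∈ Ioc 0 a, ∀ y ∈ Ioc 0 b, HasDerivWithinAt (fun t => Wx x t) 0 (Ioc 0 b) y)
    (h0x : ∀ y ∈ Ioc 0 b, Tendsto (fun x => W x y) (𝓝[Ioc 0 a] 0) (𝓝 0))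
    (h0y : ∀ x ∈ Ioc 0 a, Tendsto (fun y => W x y) (𝓝[Ioc 0 b] 0) (𝓝 0)) :
    ∀ x ∈ Ioc 0 a, ∀ y ∈ Ioc 0 b, W x y = 0 := by
  intro x hx' y hy'
  refine eq_zero_of_tendsto_zero (f := W x) hy' (fun z hz => ?_) (h0y x hx')
  have hd : ∀ s ∈ Ioc 0 a, HasDerivWithinAt (fun t => W t z - W t y) 0 (Ioc 0 a) s := by
    intro s hs
    have := (hx s hs z hz).sub (hx s hs y hy')
    rwa [eq_of_hasDerivWithinAt_zero (hy s hs) hz hy', sub_self] at this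
  have h0 : Tendsto (fun t => W t z - W t y) (𝓝[Ioc 0 a] 0) (𝓝 0) := by
    simpa using (h0x z hz).sub (h0x y hy')
  exact sub_eq_zero.1 (eq_zero_of_tendsto_zero (f := fun t => W t z - W t y) hx'
    (fun s hs => eq_of_hasDerivWithinAt_zero hd hs hx') h0)

/-- With `J = I^φ g`, the function `I^(1-φ) J = I^1 g` has the same mixed derivative as `I^(1-φ) u`.
Both `u` and `J` vanish on the axes, so the two integrals coincide, and injectivity of `I^(1-φ)`
gives `u = J`. -/
theorem eq_katInt_of_mixed_deriv [CompleteSpace E] {φ₁ φ₂ : ℝ} (hφ₁ : φ₁ ∈ Ioc (0 : ℝ) 1)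
    (hφ₂ : φ₂ ∈ Ioc (0 : ℝ) 1) (hρ₁ : 0 < ρ₁) (hρ₂ : 0 < ρ₂) {u g : ℝ × ℝ → E}
    (hu : ContinuousOn u (Icc 0 a ×ˢ Icc 0 b)) (hu₁ : ∀ y ∈ Icc 0 b, u (0, y) = 0)
    (hu₂ : ∀ x ∈ Icc 0 a, u (x, 0) = 0) (hg : BoundedContOn a b g) {Lx : ℝ → ℝ → E}
    (hx : ∀ x ∈ Ioc 0 a, ∀ y ∈ Ioc 0 b, HasDerivWithinAt
      (fun t => katInt (1 - φ₁) (1 - φ₂) ρ₁ ρ₂ u (t, y)) (Lx x y) (Ioc 0 a) x)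
    (hy : ∀ x ∈ Ioc 0 a, ∀ y ∈ Ioc 0 b, HasDerivWithinAt (fun t => Lx x t)
      (x ^ (ρ₁ - 1) • y ^ (ρ₂ - 1) • g (x, y)) (Ioc 0 b) y) :
    ∀ p ∈ Ioc 0 a ×ˢ Ioc 0 b, u p = katInt φ₁ φ₂ ρ₁ ρ₂ g p := by
  have p₁ : 0 ≤ 1 - φ₁ := sub_nonneg.2 hφ₁.2
  have p₂ : 0 ≤ 1 - φ₂ := sub_nonneg.2 hφ₂.2
  set J := katInt φ₁ φ₂ ρ₁ ρ₂ g with hJdef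
  have hJ : ContinuousOn J (Icc 0 a ×ˢ Icc 0 b) :=
    hg.continuousOn_katInt hφ₁.1 hφ₂.1 hρ₁ hρ₂
  have hJ₁ : ∀ y ∈ Icc 0 b, J (0, y) = 0 := fun y _ =>
    katInt_eq_zero hφ₁.1 hφ₂.1 g (Or.inl le_rfl)
  have hJ₂ : ∀ x ∈ Icc 0 a, J (x, 0) = 0 := fun x _ =>
    katInt_eq_zero hφ₁.1 hφ₂.1 g (Or.inr le_rfl)
  have hcomp : ∀ p ∈ Ioc 0 a ×ˢ Ioc 0 b,
      katInt (1 - φ₁) (1 - φ₂) ρ₁ ρ₂ J p = katInt 1 1 ρ₁ ρ₂ g p := fun p hp =>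
    hg.katInt_katInt p₁ p₂ hφ₁.1.le hφ₂.1.le (by ring) (by ring) hρ₁ hρ₂ hp
  have hW := eq_zero_of_mixed_deriv_eq_zero (a := a) (b := b)
    (W := fun x y => katInt (1 - φ₁) (1 - φ₂) ρ₁ ρ₂ u (x, y) -
      katInt (1 - φ₁) (1 - φ₂) ρ₁ ρ₂ J (x, y))
    (Wx := fun x y => Lx x y - x ^ (ρ₁ - 1) • katInt 0 1 ρ₁ ρ₂ g (x, y)) ?_ ?_ ?_ ?_
  · have hs := BoundedContOn.eq_zero_of_katInt_eq_zero (α₁ := 1 - φ₁) (α₂ := 1 - φ₂)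
      (ρ₁ := ρ₁) (ρ₂ := ρ₂) ((BoundedContOn.of_continuousOn_Icc hu).sub (.of_continuousOn_Icc hJ))
      ⟨p₁, by linarith [hφ₁.1]⟩ ⟨p₂, by linarith [hφ₂.1]⟩ hρ₁ hρ₂ ?_
    · exact fun p hp => sub_eq_zero.1 (hs p hp)
    · rintro ⟨x, y⟩ hp
      rw [← hW x hp.1 y hp.2]
      exact integral_sub ((BoundedContOn.of_continuousOn_Icc hu).integrable p₁ p₂ hρ₁ hρ₂ hp)
        ((BoundedContOn.of_continuousOn_Icc hJ).integrable p₁ p₂ hρ₁ hρ₂ hp)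
  · intro x hx' y hy'
    refine (hx x hx' y hy').sub ?_
    exact (hg.hasDerivWithinAt_fst hρ₁ hρ₂ hx' hy').congr (fun s hs => hcomp _ ⟨hs, hy'⟩)
      (hcomp _ ⟨hx', hy'⟩)
  · intro x hx' y hy'
    have := (hy x hx' y hy').sub
      ((hg.hasDerivWithinAt_snd hρ₁ hρ₂ hx' hy').const_smul (x ^ (ρ₁ - 1)))
    rwa [sub_self] at this
  · intro y hy'
    simpa using (tendsto_katInt_fst hu hu₁ p₁ p₂ hρ₁ hρ₂ hy').sub
      (tendsto_katInt_fst hJ hJ₁ p₁ p₂ hρ₁ hρ₂ hy')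
  · intro x hx'
    simpa using (tendsto_katInt_snd hu hu₂ p₁ p₂ hρ₁ hρ₂ hx').sub
      (tendsto_katInt_snd hJ hJ₂ p₁ p₂ hρ₁ hρ₂ hx')

end KatInt

/-! ### Fixed points of maps that halve a weighted distance. -/

section FixedPoint

variable {K Y : Type*} [TopologicalSpace K] [CompactSpace K] [MetricSpace Y]
  {T : C(K, Y) → C(K, Y)} {m : K → ℝ} {M : ℝ}

/-- Applying `hT` repeatedly to two fixed points bounds their distance by `dist f g / 2 ^ n * m p`
for every `n`. The bounds `1 ≤ m ≤ M` compare the weighted distance with the uniform one. -/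
theorem eq_of_fixed_of_weighted (hm : ∀ p, 1 ≤ m p) (hmM : ∀ p, m p ≤ M)
    (hT : ∀ D, 0 ≤ D → ∀ f g : C(K, Y), (∀ p, dist (f p) (g p) ≤ D * m p) →
      ∀ p, dist (T f p) (T g p) ≤ D / 2 * m p) {f g : C(K, Y)} (hf : T f = f) (hg : T g = g) :
    f = g := by
  have h : ∀ n : ℕ, ∀ p, dist (f p) (g p) ≤ dist f g / 2 ^ n * m p := by
    intro n
    induction n with
    | zero =>
      intro p
      rw [pow_zero, div_one]
      exact (ContinuousMap.dist_apply_le_dist p).trans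
        (le_mul_of_one_le_right dist_nonneg (hm p))
    | succ n ih =>
      intro p
      have := hT _ (by positivity) f g ih p
      rw [hf, hg] at this
      rwa [pow_succ, ← div_div]
  have hlim : Tendsto (fun n : ℕ => dist f g / 2 ^ n * M) atTop (𝓝 0) := by
    have := (tendsto_pow_atTop_nhds_zero_of_lt_one (r := (1 / 2 : ℝ)) (by norm_num)
      (by norm_num)).const_mul (dist f g * M)
    rw [mul_zero] at this
    refine this.congr fun n => ?_
    rw [one_div, inv_pow]; ring
  ext p
  refine dist_le_zero.1 (ge_of_tendsto' hlim fun n => (h n p).trans ?_)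
  exact mul_le_mul_of_nonneg_left (hmM p) (by positivity)

theorem exists_fixed_of_weighted [CompleteSpace Y] [Nonempty Y] (hM : 0 ≤ M) (hm : ∀ p, 1 ≤ m p)
    (hmM : ∀ p, m p ≤ M)
    (hT : ∀ D, 0 ≤ D → ∀ f g : C(K, Y), (∀ p, dist (f p) (g p) ≤ D * m p) →
      ∀ p, dist (T f p) (T g p) ≤ D / 2 * m p) : ∃ f, T f = f := by
  obtain ⟨y⟩ := ‹Nonempty Y›
  let f : ℕ → C(K, Y) := fun n => T^[n] (ContinuousMap.const K y)
  have hf : ∀ n, f (n + 1) = T (f n) := fun n => Function.iterate_succ_apply' T n _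
  set D := dist (f 0) (f 1) with hD
  have h : ∀ n p, dist (f n p) (f (n + 1) p) ≤ D / 2 ^ n * m p := by
    intro n
    induction n with
    | zero =>
      intro p
      rw [pow_zero, div_one]
      exact (ContinuousMap.dist_apply_le_dist p).trans
        (le_mul_of_one_le_right dist_nonneg (hm p))
    | succ n ih =>
      intro p
      have := hT _ (by positivity) _ _ ih p
      rw [← hf, ← hf] at this
      rwa [pow_succ, ← div_div]
  have hc : CauchySeq f := by
    -- The criterion asks for `C / 2 / 2 ^ n`, so the factor 2 makes the required bound `D * M / 2 ^
    -- n`.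
    refine cauchySeq_of_le_geometric_two (C := 2 * (D * M)) fun n => ?_
    rw [mul_div_cancel_left₀ _ two_ne_zero, ContinuousMap.dist_le (by positivity)]
    intro p
    refine (h n p).trans ?_
    rw [div_mul_eq_mul_div]
    gcongr
    exact hmM p
  obtain ⟨g, hg⟩ := cauchySeq_tendsto_of_complete hc
  refine ⟨g, tendsto_nhds_unique (f := fun n => f (n + 1)) ?_ (hg.comp (tendsto_add_atTop_nat 1))⟩
  rw [tendsto_iff_dist_tendsto_zero] at hg ⊢
  have hlim : Tendsto (fun n => dist (f n) g / 2 * M) atTop (𝓝 0) := by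
    simpa using (hg.div_const 2).mul_const M
  refine squeeze_zero (fun _ => dist_nonneg) (fun n => ?_) hlim
  rw [hf, ContinuousMap.dist_le (by positivity)]
  intro p
  refine (hT (dist (f n) g) dist_nonneg _ _ (fun q => ?_) p).trans ?_
  · exact (ContinuousMap.dist_apply_le_dist q).trans
      (le_mul_of_one_le_right dist_nonneg (hm q))
  · exact mul_le_mul_of_nonneg_left (hmM p) (by positivity)

end FixedPoint

/-! ### The exponential weight. -/

section Weight

variable {E : Type*} [NormedAddCommGroup E] [NormedSpace ℝ E] {α₁ α₂ ρ₁ ρ₂ a b : ℝ}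

theorem ae_katMeasure_lt {α ρ x : ℝ} (hα : 0 < α) : ∀ᵐ s ∂(katMeasure α ρ x), s < x := by
  rw [katMeasure_of_pos hα]
  refine (withDensity_absolutelyContinuous _ _).ae_le ?_
  filter_upwards [ae_restrict_mem measurableSet_Ioo] with s hs
  exact hs.2

/-- After rescaling and factoring out `exp (l * p.1)`, what remains is a prefactor times the
integral of `exp (-(l * p.1 * (1 - q.1)))`. For `p.1 ≤ δ` the prefactor is small and the integral is
at most the total mass. For `p.1 ≥ δ` the prefactor is bounded and the integral is dominated by the
one at `δ`, which tends to zero as `l → ∞` because `q.1 < 1` almost everywhere. -/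
theorem eventually_katInt_exp_le (h₁ : 0 < α₁) (h₂ : 0 < α₂) (hρ₁ : 0 < ρ₁) (hρ₂ : 0 < ρ₂)
    (ha : 0 < a) (hb : 0 < b) {ε : ℝ} (hε : 0 < ε) :
    ∀ᶠ l : ℝ in atTop, ∀ p ∈ Ioc 0 a ×ˢ Ioc 0 b,
      katInt α₁ α₂ ρ₁ ρ₂ (fun q => Real.exp (l * q.1)) p ≤ ε * Real.exp (l * p.1) := by
  set μ := katProd α₁ α₂ ρ₁ ρ₂ (1, 1) with hμ
  have hfin : IsFiniteMeasure μ := isFiniteMeasure_katProd h₁.le h₂.le hρ₁ hρ₂ (1, 1)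
  have hae : ∀ᵐ q ∂μ, q.1 < 1 :=
    Measure.quasiMeasurePreserving_fst.ae (ae_katMeasure_lt (ρ := ρ₁) (x := 1) h₁)
  have hB : 0 < b ^ (ρ₂ * α₂) := Real.rpow_pos_of_pos hb _
  have hA : 0 < a ^ (ρ₁ * α₁) := Real.rpow_pos_of_pos ha _
  have hexp : 0 < ρ₁ * α₁ := mul_pos hρ₁ h₁
  -- small values of the first coordinate
  obtain ⟨δ, hδ, hδε⟩ : ∃ δ > 0, δ ^ (ρ₁ * α₁) * b ^ (ρ₂ * α₂) * μ.real univ ≤ ε := by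
    have hlim : Tendsto (fun x : ℝ => x ^ (ρ₁ * α₁) * b ^ (ρ₂ * α₂) * μ.real univ) (𝓝[>] 0)
        (𝓝 0) := by
      have hc : Continuous fun x : ℝ => x ^ (ρ₁ * α₁) * b ^ (ρ₂ * α₂) * μ.real univ :=
        ((continuous_id.rpow_const fun _ => Or.inr hexp.le).mul continuous_const).mul
          continuous_const
      have := hc.tendsto 0
      rw [Real.zero_rpow hexp.ne', zero_mul, zero_mul] at this
      exact this.mono_left nhdsWithin_le_nhds
    obtain ⟨δ, h1, h2⟩ := ((hlim.eventually (eventually_le_nhds hε)).and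
      self_mem_nhdsWithin).exists
    exact ⟨δ, h2, h1⟩
  have hlarge : ∀ᶠ l : ℝ in atTop, a ^ (ρ₁ * α₁) * b ^ (ρ₂ * α₂) *
      ∫ q, Real.exp (-(l * δ * (1 - q.1))) ∂μ ≤ ε := by
    have hlim : Tendsto (fun l : ℝ => ∫ q, Real.exp (-(l * δ * (1 - q.1))) ∂μ) atTop
        (𝓝 (∫ _, (0 : ℝ) ∂μ)) := by
      refine tendsto_integral_filter_of_dominated_convergence (fun _ => 1)
        (Eventually.of_forall fun l => by fun_prop) ?_ (integrable_const _) ?_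
      · filter_upwards [eventually_ge_atTop 0] with l hl
        filter_upwards [hae] with q hq
        rw [Real.norm_of_nonneg (Real.exp_pos _).le, Real.exp_le_one_iff, neg_nonpos]
        exact mul_nonneg (mul_nonneg hl hδ.le) (sub_nonneg.2 hq.le)
      · filter_upwards [hae] with q hq
        refine Real.tendsto_exp_neg_atTop_nhds_zero.comp ?_
        exact (tendsto_id.atTop_mul_const hδ).atTop_mul_const (sub_pos.2 hq)
    rw [integral_zero] at hlim
    have := hlim.const_mul (a ^ (ρ₁ * α₁) * b ^ (ρ₂ * α₂))
    rw [mul_zero] at this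
    exact this.eventually (eventually_le_nhds hε)
  filter_upwards [hlarge, eventually_ge_atTop 0] with l hl hl0
  intro p hp
  have hp0 := pos_of_mem_Ioc_prod hp
  rw [katInt_eq_smul_integral h₁.le h₂.le hρ₁ hρ₂ _ hp0, smul_eq_mul]
  have hsplit : ∫ q, Real.exp (l * (p.1 * q.1)) ∂μ =
      (∫ q, Real.exp (-(l * p.1 * (1 - q.1))) ∂μ) * Real.exp (l * p.1) := by
    rw [← integral_mul_const]
    refine integral_congr_ae (Eventually.of_forall fun q => ?_)
    simp only
    rw [← Real.exp_add]
    congr 1; ring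
  rw [hsplit, ← mul_assoc]
  refine mul_le_mul_of_nonneg_right ?_ (Real.exp_pos _).le
  have hp2 : p.2 ^ (ρ₂ * α₂) ≤ b ^ (ρ₂ * α₂) :=
    Real.rpow_le_rpow hp0.2.le hp.2.2 (by positivity)
  have hp1 : 0 ≤ p.1 ^ (ρ₁ * α₁) := Real.rpow_nonneg hp0.1.le _
  have hI0 : ∀ c : ℝ, 0 ≤ ∫ q, Real.exp (-(c * (1 - q.1))) ∂μ := fun c =>
    integral_nonneg fun q => (Real.exp_pos _).le
  have hint : ∀ c : ℝ, 0 ≤ c → Integrable (fun q : ℝ × ℝ => Real.exp (-(c * (1 - q.1)))) μ := by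
    intro c hc
    refine Integrable.of_bound (by fun_prop) 1 ?_
    filter_upwards [hae] with q hq
    rw [Real.norm_of_nonneg (Real.exp_pos _).le, Real.exp_le_one_iff, neg_nonpos]
    exact mul_nonneg hc (sub_nonneg.2 hq.le)
  rcases le_total p.1 δ with h | h
  · have e1 : p.1 ^ (ρ₁ * α₁) ≤ δ ^ (ρ₁ * α₁) := Real.rpow_le_rpow hp0.1.le h hexp.le
    have e2 : ∫ q, Real.exp (-(l * p.1 * (1 - q.1))) ∂μ ≤ μ.real univ := by
      have := integral_mono_ae (hint (l * p.1) (mul_nonneg hl0 hp0.1.le)) (integrable_const (1 : ℝ))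
        (by
          filter_upwards [hae] with q hq
          rw [Real.exp_le_one_iff, neg_nonpos]
          exact mul_nonneg (mul_nonneg hl0 hp0.1.le) (sub_nonneg.2 hq.le))
      simpa using this
    refine le_trans ?_ hδε
    exact mul_le_mul (mul_le_mul e1 hp2 (Real.rpow_nonneg hp0.2.le _) (by positivity)) e2
      (hI0 _) (by positivity)
  · have e1 : p.1 ^ (ρ₁ * α₁) ≤ a ^ (ρ₁ * α₁) := Real.rpow_le_rpow hp0.1.le hp.1.2 hexp.le
    have e2 : ∫ q, Real.exp (-(l * p.1 * (1 - q.1))) ∂μ ≤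
        ∫ q, Real.exp (-(l * δ * (1 - q.1))) ∂μ := by
      refine integral_mono_ae (hint _ (mul_nonneg hl0 hp0.1.le)) (hint _ (mul_nonneg hl0 hδ.le)) ?_
      filter_upwards [hae] with q hq
      rw [Real.exp_le_exp, neg_le_neg_iff]
      exact mul_le_mul_of_nonneg_right (mul_le_mul_of_nonneg_left h hl0) (sub_nonneg.2 hq.le)
    refine le_trans ?_ hl
    exact mul_le_mul (mul_le_mul e1 hp2 (Real.rpow_nonneg hp0.2.le _) hA.le) e2
      (hI0 _) (by positivity)

theorem norm_katInt_sub_le {f g : ℝ × ℝ → E} (hf : BoundedContOn a b f)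
    (hg : BoundedContOn a b g) (h₁ : 0 ≤ α₁) (h₂ : 0 ≤ α₂) (hρ₁ : 0 < ρ₁) (hρ₂ : 0 < ρ₂)
    {l C : ℝ} {p : ℝ × ℝ} (hp : p ∈ Ioc 0 a ×ˢ Ioc 0 b)
    (h : ∀ q ∈ Ioc 0 a ×ˢ Ioc 0 b, ‖f q - g q‖ ≤ C * Real.exp (l * q.1)) :
    ‖katInt α₁ α₂ ρ₁ ρ₂ f p - katInt α₁ α₂ ρ₁ ρ₂ g p‖ ≤
      C * katInt α₁ α₂ ρ₁ ρ₂ (fun q => Real.exp (l * q.1)) p := by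
  have he : BoundedContOn a b fun q : ℝ × ℝ => Real.exp (l * q.1) :=
    .of_continuousOn_Icc (by fun_prop)
  have hsub : katInt α₁ α₂ ρ₁ ρ₂ f p - katInt α₁ α₂ ρ₁ ρ₂ g p =
      ∫ q, (f q - g q) ∂(katProd α₁ α₂ ρ₁ ρ₂ p) :=
    (integral_sub (hf.integrable h₁ h₂ hρ₁ hρ₂ hp) (hg.integrable h₁ h₂ hρ₁ hρ₂ hp)).symm
  rw [hsub, katInt, ← integral_const_mul]
  refine norm_integral_le_of_norm_le ((he.integrable h₁ h₂ hρ₁ hρ₂ hp).const_mul C) ?_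
  filter_upwards [ae_katProd_mem h₁ h₂ (pos_of_mem_Ioc_prod hp)] with q hq
  exact h q (Ioc_prod_subset hp hq)

end Weight

/-! ### Fuzzy Caputo-Katugampola derivatives and fractional integrals. -/

section Derivative

variable {a b φ₁ φ₂ ρ₁ ρ₂ : ℝ}

theorem isKatIntegral_iff {α₁ α₂ : ℝ} {u : ℝ → ℝ → CFuzzy} {x y : ℝ} {w : CFuzzy}
    (hu : Integrable (fun q : ℝ × ℝ => emb (u q.1 q.2)) (katProd α₁ α₂ ρ₁ ρ₂ (x, y))) :
    IsKatIntegral α₁ α₂ ρ₁ ρ₂ u x y w ↔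
      emb w = katInt α₁ α₂ ρ₁ ρ₂ (fun q => emb (u q.1 q.2)) (x, y) := by
  rw [emb_eq_iff]
  constructor
  · intro h r
    rw [katInt, integral_fst_apply hu, integral_snd_apply hu]
    exact ⟨(h r r.2).1.2, (h r r.2).2.2⟩
  · intro h r hr
    have h' := h ⟨r, hr⟩
    rw [katInt, integral_fst_apply hu, integral_snd_apply hu] at h'
    exact ⟨⟨(evalFst ⟨r, hr⟩).integrable_comp hu, h'.1⟩,
      ⟨(evalSnd ⟨r, hr⟩).integrable_comp hu, h'.2⟩⟩

theorem exists_emb_eq_katInt (α₁ α₂ ρ₁ ρ₂ : ℝ) (u : ℝ → ℝ → CFuzzy) (p : ℝ × ℝ) :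
    ∃ z, emb z = katInt α₁ α₂ ρ₁ ρ₂ (fun q => emb (u q.1 q.2)) p :=
  integral_mem_range_emb (Eventually.of_forall fun _ => mem_range_self _)

theorem one_smul_eq (z : CFuzzy) : (1 : ℝ) • z = z :=
  emb_injective (by rw [emb_smul zero_le_one, one_smul])

/-- The semigroup law gives `I^(1-φ) u = I^1 g`, represented by `U`. Its `x`-derivative is `x ^ (ρ₁
- 1)` times `V = I^(0,1) g`, and the `y`-derivative of that is a positive multiple of `g`. All these
lie in the cone, so type (i) holds in both variables. -/
theorem hasKatDeriv1_katInt (hφ₁ : φ₁ ∈ Ioc (0 : ℝ) 1) (hφ₂ : φ₂ ∈ Ioc (0 : ℝ) 1)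
    (hρ₁ : 0 < ρ₁) (hρ₂ : 0 < ρ₂) {u g : ℝ → ℝ → CFuzzy}
    (hg : BoundedContOn a b fun q => emb (g q.1 q.2))
    (hu : ∀ x ∈ Icc 0 a, ∀ y ∈ Icc 0 b,
      emb (u x y) = katInt φ₁ φ₂ ρ₁ ρ₂ (fun q => emb (g q.1 q.2)) (x, y)) :
    HasKatDeriv1 a b φ₁ φ₂ ρ₁ ρ₂ u g := by
  have p₁ : 0 ≤ 1 - φ₁ := sub_nonneg.2 hφ₁.2
  have p₂ : 0 ≤ 1 - φ₂ := sub_nonneg.2 hφ₂.2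
  have huE : ∀ q ∈ Ioc 0 a ×ˢ Ioc 0 b,
      emb (u q.1 q.2) = katInt φ₁ φ₂ ρ₁ ρ₂ (fun q => emb (g q.1 q.2)) q := fun q hq =>
    hu _ (Ioc_subset_Icc_self hq.1) _ (Ioc_subset_Icc_self hq.2)
  have huB : BoundedContOn a b fun q => emb (u q.1 q.2) := by
    have h := hg.katInt hφ₁.1.le hφ₂.1.le hρ₁ hρ₂
    exact ⟨h.continuousOn.congr huE, h.bounded.imp fun M hM q hq => by rw [huE q hq]; exact hM q hq⟩
  choose U hU using fun x y => exists_emb_eq_katInt 1 1 ρ₁ ρ₂ g (x, y)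
  choose V hV using fun x y => exists_emb_eq_katInt 0 1 ρ₁ ρ₂ g (x, y)
  have hx0 : ∀ x ∈ Ioc 0 a, 0 ≤ x ^ (ρ₁ - 1) := fun x hx => Real.rpow_nonneg hx.1.le _
  have hy0 : ∀ y ∈ Ioc 0 b, 0 ≤ y ^ (ρ₂ - 1) := fun y hy => Real.rpow_nonneg hy.1.le _
  refine ⟨U, fun x y => (x ^ (ρ₁ - 1) * y ^ (ρ₂ - 1)) • g x y, ?_, ?_, ?_⟩
  · intro x hx y hy
    rw [isKatIntegral_iff (huB.integrable p₁ p₂ hρ₁ hρ₂ ⟨hx, hy⟩), hU,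
      katInt_congr p₁ p₂ (p := (x, y)) ⟨hx, hy⟩ huE]
    exact (hg.katInt_katInt p₁ p₂ hφ₁.1.le hφ₂.1.le (by ring) (by ring) hρ₁ hρ₂ ⟨hx, hy⟩).symm
  · refine ⟨fun x y => x ^ (ρ₁ - 1) • V x y, Or.inl fun x hx y hy => ⟨?_, ?_⟩⟩
    · refine hasGHDerivI_of_emb (f' := fun x => x ^ (ρ₁ - 1) • V x y) (fun s hs => ?_) hx
      simp_rw [emb_smul (hx0 s hs), hU, hV]
      exact hg.hasDerivWithinAt_fst hρ₁ hρ₂ hs hy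
    · refine hasGHDerivI_of_emb (f' := fun y => (x ^ (ρ₁ - 1) * y ^ (ρ₂ - 1)) • g x y)
        (fun t ht => ?_) hy
      simp_rw [emb_smul (hx0 x hx), hV, emb_smul (mul_nonneg (hx0 x hx) (hy0 t ht)), mul_smul]
      exact (hg.hasDerivWithinAt_snd hρ₁ hρ₂ hx ht).const_smul (x ^ (ρ₁ - 1))
  · intro x hx y hy
    have : x ^ (1 - ρ₁) * y ^ (1 - ρ₂) * (x ^ (ρ₁ - 1) * y ^ (ρ₂ - 1)) = 1 := by
      rw [mul_mul_mul_comm, ← Real.rpow_add hx.1, ← Real.rpow_add hy.1]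
      simp
    rw [smul_smul_eq, this, one_smul_eq]

theorem katInt_clm (T : EndpointSpace →L[ℝ] ℝ) {α₁ α₂ : ℝ} {f : ℝ × ℝ → EndpointSpace}
    (hf : BoundedContOn a b f) (h₁ : 0 ≤ α₁) (h₂ : 0 ≤ α₂) (hρ₁ : 0 < ρ₁) (hρ₂ : 0 < ρ₂)
    {p : ℝ × ℝ} (hp : p ∈ Ioc 0 a ×ˢ Ioc 0 b) :
    katInt α₁ α₂ ρ₁ ρ₂ (fun q => T (f q)) p = T (katInt α₁ α₂ ρ₁ ρ₂ f p) :=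
  T.integral_comp_comm (hf.integrable h₁ h₂ hρ₁ hρ₂ hp)

theorem BoundedContOn.clm_comp (T : EndpointSpace →L[ℝ] ℝ) {f : ℝ × ℝ → EndpointSpace}
    (hf : BoundedContOn a b f) : BoundedContOn a b fun q => T (f q) := by
  obtain ⟨M, hM⟩ := hf.bounded
  exact ⟨T.continuous.comp_continuousOn hf.continuousOn, ‖T‖ * M, fun p hp =>
    (T.le_opNorm _).trans (mul_le_mul_of_nonneg_left (hM p hp) (norm_nonneg _))⟩

/-- gH-differentiability controls one level and one end point at a time, without uniformity in the
level. The argument is therefore scalar, through evaluation functionals, rather than carried out in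
the Banach space. -/
theorem HasKatDeriv1.emb_eq_katInt (hφ₁ : φ₁ ∈ Ioc (0 : ℝ) 1) (hφ₂ : φ₂ ∈ Ioc (0 : ℝ) 1)
    (hρ₁ : 0 < ρ₁) (hρ₂ : 0 < ρ₂) {u g : ℝ → ℝ → CFuzzy}
    (hg : BoundedContOn a b fun q => emb (g q.1 q.2))
    (hu : ContinuousOn (fun q : ℝ × ℝ => emb (u q.1 q.2)) (Icc 0 a ×ˢ Icc 0 b))
    (hu₁ : ∀ y ∈ Icc 0 b, u 0 y = 0) (hu₂ : ∀ x ∈ Icc 0 a, u x 0 = 0)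
    (h : HasKatDeriv1 a b φ₁ φ₂ ρ₁ ρ₂ u g) :
    ∀ p ∈ Ioc 0 a ×ˢ Ioc 0 b,
      emb (u p.1 p.2) = katInt φ₁ φ₂ ρ₁ ρ₂ (fun q => emb (g q.1 q.2)) p := by
  have p₁ : 0 ≤ 1 - φ₁ := sub_nonneg.2 hφ₁.2
  have p₂ : 0 ≤ 1 - φ₂ := sub_nonneg.2 hφ₂.2
  obtain ⟨U, d, hU, ⟨Ux, hUx⟩, hgd⟩ := h
  have huB := BoundedContOn.of_continuousOn_Icc hu
  have hUE : ∀ x ∈ Ioc 0 a, ∀ y ∈ Ioc 0 b, emb (U x y) =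
      katInt (1 - φ₁) (1 - φ₂) ρ₁ ρ₂ (fun q => emb (u q.1 q.2)) (x, y) := fun x hx y hy =>
    (isKatIntegral_iff (huB.integrable p₁ p₂ hρ₁ hρ₂ ⟨hx, hy⟩)).1 (hU x hx y hy)
  have hd : ∀ x ∈ Ioc 0 a, ∀ y ∈ Ioc 0 b,
      emb (d x y) = x ^ (ρ₁ - 1) • y ^ (ρ₂ - 1) • emb (g x y) := by
    intro x hx y hy
    have : x ^ (ρ₁ - 1) * y ^ (ρ₂ - 1) * (x ^ (1 - ρ₁) * y ^ (1 - ρ₂)) = 1 := by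
      rw [mul_mul_mul_comm, ← Real.rpow_add hx.1, ← Real.rpow_add hy.1]
      simp
    rw [hgd x hx y hy, emb_smul (mul_nonneg (Real.rpow_nonneg hx.1.le _)
      (Real.rpow_nonneg hy.1.le _)), smul_smul, smul_smul, this, one_smul]
  have key : ∀ (T : EndpointSpace →L[ℝ] ℝ) (Lx : ℝ → ℝ → ℝ),
      (∀ x ∈ Ioc 0 a, ∀ y ∈ Ioc 0 b,
        HasDerivWithinAt (fun t => T (emb (U t y))) (Lx x y) (Ioc 0 a) x ∧
        HasDerivWithinAt (fun t => Lx x t) (T (emb (d x y))) (Ioc 0 b) y) →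
      ∀ p ∈ Ioc 0 a ×ˢ Ioc 0 b, T (emb (u p.1 p.2)) =
        T (katInt φ₁ φ₂ ρ₁ ρ₂ (fun q => emb (g q.1 q.2)) p) := by
    intro T Lx hL p hp
    rw [← katInt_clm T hg hφ₁.1.le hφ₂.1.le hρ₁ hρ₂ hp]
    refine eq_katInt_of_mixed_deriv (u := fun q => T (emb (u q.1 q.2))) (Lx := Lx) hφ₁ hφ₂ hρ₁
      hρ₂ (T.continuous.comp_continuousOn hu) (fun y hy => ?_) (fun x hx => ?_)
      (hg.clm_comp T) (fun x hx y hy => ?_) (fun x hx y hy => ?_) p hp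
    · simp only [hu₁ y hy, emb_zero, map_zero]
    · simp only [hu₂ x hx, emb_zero, map_zero]
    · have e : ∀ t ∈ Ioc 0 a, katInt (1 - φ₁) (1 - φ₂) ρ₁ ρ₂
          (fun q => T (emb (u q.1 q.2))) (t, y) = T (emb (U t y)) := by
        intro t ht
        rw [hUE t ht y hy, katInt_clm T huB p₁ p₂ hρ₁ hρ₂ ⟨ht, hy⟩]
      exact (hL x hx y hy).1.congr e (e x hx)
    · have := (hL x hx y hy).2
      rwa [hd x hx y hy, map_smul, map_smul] at this
  intro p hp
  rw [emb_eq_iff]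
  rcases hUx with hI | hII
  · exact fun r => ⟨
      key (evalFst r) (fun x y => (Ux x y).lower r) (fun x hx y hy =>
        ⟨((hI x hx y hy).1.2 r r.2).1, ((hI x hx y hy).2.2 r r.2).1⟩) p hp,
      key (evalSnd r) (fun x y => (Ux x y).upper r) (fun x hx y hy =>
        ⟨((hI x hx y hy).1.2 r r.2).2, ((hI x hx y hy).2.2 r r.2).2⟩) p hp⟩
  -- In type (ii) the lower end point of `U` differentiates to the upper end point of `Ux`, and that
  -- one to the lower end point of `d`; the other end point behaves symmetrically. The two exchanges
  -- cancel.
  · exact fun r => ⟨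
      key (evalFst r) (fun x y => (Ux x y).upper r) (fun x hx y hy =>
        ⟨((hII x hx y hy).1.2 r r.2).2, ((hII x hx y hy).2.2 r r.2).1⟩) p hp,
      key (evalSnd r) (fun x y => (Ux x y).lower r) (fun x hx y hy =>
        ⟨((hII x hx y hy).1.2 r r.2).1, ((hII x hx y hy).2.2 r r.2).2⟩) p hp⟩

theorem HasCKDeriv1.emb_eq (hφ₁ : φ₁ ∈ Ioc (0 : ℝ) 1) (hφ₂ : φ₂ ∈ Ioc (0 : ℝ) 1)
    (hρ₁ : 0 < ρ₁) (hρ₂ : 0 < ρ₂) (ha : 0 < a) (hb : 0 < b) {v g : ℝ → ℝ → CFuzzy}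
    (hg : BoundedContOn a b fun q => emb (g q.1 q.2))
    (hv : ContinuousOn (fun q : ℝ × ℝ => v q.1 q.2) (Icc 0 a ×ˢ Icc 0 b))
    (h : HasCKDeriv1 a b φ₁ φ₂ ρ₁ ρ₂ v g) {x y : ℝ} (hx : x ∈ Icc 0 a) (hy : y ∈ Icc 0 b) :
    emb (v x y) = emb (v x 0) + (emb (v 0 y) - emb (v 0 0)) +
      katInt φ₁ φ₂ ρ₁ ρ₂ (fun q => emb (g q.1 q.2)) (x, y) := by
  obtain ⟨u, hu, hK⟩ := h
  have hE : ∀ x ∈ Icc 0 a, ∀ y ∈ Icc 0 b, emb (u x y) =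
      emb (v x y) - emb (v x 0) - (emb (v 0 y) - emb (v 0 0)) := by
    intro x hx y hy
    obtain ⟨p, q, h1, h2, h3⟩ := hu x hx y hy
    rw [isHDiff_iff] at h1 h2 h3
    rw [h1, h2, h3]
  have h0a : (0 : ℝ) ∈ Icc 0 a := ⟨le_rfl, ha.le⟩
  have h0b : (0 : ℝ) ∈ Icc 0 b := ⟨le_rfl, hb.le⟩
  have hu₁ : ∀ y ∈ Icc 0 b, u 0 y = 0 := fun y hy => emb_injective (by
    rw [hE 0 h0a y hy, sub_self, emb_zero])
  have hu₂ : ∀ x ∈ Icc 0 a, u x 0 = 0 := fun x hx => emb_injective (by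
    rw [hE x hx 0 h0b, sub_self, sub_self, sub_self, emb_zero])
  have huc : ContinuousOn (fun q : ℝ × ℝ => emb (u q.1 q.2)) (Icc 0 a ×ˢ Icc 0 b) := by
    have hvE : ContinuousOn (fun q : ℝ × ℝ => emb (v q.1 q.2)) (Icc 0 a ×ˢ Icc 0 b) :=
      isometry_emb.continuous.comp_continuousOn hv
    have e1 : ContinuousOn (fun q : ℝ × ℝ => emb (v q.1 0)) (Icc 0 a ×ˢ Icc 0 b) :=
      hvE.comp (f := fun q : ℝ × ℝ => (q.1, (0 : ℝ))) (by fun_prop) fun q hq => ⟨hq.1, h0b⟩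
    have e2 : ContinuousOn (fun q : ℝ × ℝ => emb (v 0 q.2)) (Icc 0 a ×ˢ Icc 0 b) :=
      hvE.comp (f := fun q : ℝ × ℝ => ((0 : ℝ), q.2)) (by fun_prop) fun q hq => ⟨h0a, hq.2⟩
    exact ((hvE.sub e1).sub (e2.sub continuousOn_const)).congr fun q hq => hE _ hq.1 _ hq.2
  have hmain : emb (u x y) = katInt φ₁ φ₂ ρ₁ ρ₂ (fun q => emb (g q.1 q.2)) (x, y) := by
    rcases hx.1.eq_or_lt with rfl | hx0
    · rw [hu₁ y hy, emb_zero, katInt_eq_zero hφ₁.1 hφ₂.1 _ (Or.inl le_rfl)]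
    rcases hy.1.eq_or_lt with rfl | hy0
    · rw [hu₂ x hx, emb_zero, katInt_eq_zero hφ₁.1 hφ₂.1 _ (Or.inr le_rfl)]
    exact hK.emb_eq_katInt hφ₁ hφ₂ hρ₁ hρ₂ hg huc hu₁ hu₂ (x, y) ⟨⟨hx0, hx.2⟩, ⟨hy0, hy.2⟩⟩
  rw [← hmain, hE x hx y hy]
  abel

theorem hasCKDeriv1_of_emb_eq (hφ₁ : φ₁ ∈ Ioc (0 : ℝ) 1) (hφ₂ : φ₂ ∈ Ioc (0 : ℝ) 1)
    (hρ₁ : 0 < ρ₁) (hρ₂ : 0 < ρ₂) {v g : ℝ → ℝ → CFuzzy}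
    (hg : BoundedContOn a b fun q => emb (g q.1 q.2))
    (hk : ∀ y ∈ Icc 0 b, ∃ k, IsHDiff (v 0 y) (v 0 0) k)
    (hv : ∀ x ∈ Icc 0 a, ∀ y ∈ Icc 0 b, emb (v x y) = emb (v x 0) + (emb (v 0 y) - emb (v 0 0)) +
      katInt φ₁ φ₂ ρ₁ ρ₂ (fun q => emb (g q.1 q.2)) (x, y)) :
    HasCKDeriv1 a b φ₁ φ₂ ρ₁ ρ₂ v g := by
  choose u hu using fun x y => exists_emb_eq_katInt φ₁ φ₂ ρ₁ ρ₂ g (x, y)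
  refine ⟨u, fun x hx y hy => ?_, hasKatDeriv1_katInt hφ₁ hφ₂ hρ₁ hρ₂ hg fun x _ y _ => hu x y⟩
  obtain ⟨k, hk⟩ := hk y hy
  -- The first Hukuhara difference `v x y ⊖ v x 0` is the axis increment `k` plus the fractional
  -- integral `u x y`; removing `k` leaves `u x y`.
  refine ⟨k + u x y, k, isHDiff_iff.2 ?_, hk, rfl⟩
  rw [hv x hx y hy, emb_add, hu, ← isHDiff_iff.1 hk]
  abel

end Derivative

/-! ### A single equation of the system. -/

/-- The hypotheses on the data of one of the two equations of the coupled system. -/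
structure IsEquationData (a b φ₁ φ₂ ρ₁ ρ₂ R : ℝ) (F : ℝ → ℝ → CFuzzy → CFuzzy → CFuzzy)
    (ξ₁ ξ₂ : ℝ → CFuzzy) : Prop where
  a_pos : 0 < a
  b_pos : 0 < b
  order_fst : φ₁ ∈ Ioc (0 : ℝ) 1
  order_snd : φ₂ ∈ Ioc (0 : ℝ) 1
  rho_fst : 0 < ρ₁
  rho_snd : 0 < ρ₂
  lip_pos : 0 < R
  continuousOn : ContinuousOn (fun p : ℝ × ℝ × CFuzzy × CFuzzy => F p.1 p.2.1 p.2.2.1 p.2.2.2)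
    (Ioc 0 a ×ˢ Ioc 0 b ×ˢ univ)
  bounded : ∃ M : ℝ, ∀ x ∈ Ioc 0 a, ∀ y ∈ Ioc 0 b, dist (F x y 0 0) 0 ≤ M
  lip : ∀ x ∈ Ioc 0 a, ∀ y ∈ Ioc 0 b, ∀ v w v' w' : CFuzzy,
    dist (F x y v w) (F x y v' w') ≤ R * (dist v v' + dist w w')
  continuousOn_xAxis : ContinuousOn ξ₁ (Icc 0 a)
  continuousOn_yAxis : ContinuousOn ξ₂ (Icc 0 b)
  corner : ξ₁ 0 = ξ₂ 0
  exists_diff : ∀ y ∈ Icc 0 b, ∃ k, IsHDiff (ξ₂ y) (ξ₁ 0) k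

/-- The right-hand side of the integral equation, in terms of end point functions. -/
noncomputable def integralRhs (φ₁ φ₂ ρ₁ ρ₂ : ℝ) (F : ℝ → ℝ → CFuzzy → CFuzzy → CFuzzy)
    (ξ₁ ξ₂ : ℝ → CFuzzy) (v w : ℝ → ℝ → CFuzzy) (p : ℝ × ℝ) : EndpointSpace :=
  emb (ξ₁ p.1) + (emb (ξ₂ p.2) - emb (ξ₁ 0)) +
    katInt φ₁ φ₂ ρ₁ ρ₂ (fun q => emb (F q.1 q.2 (v q.1 q.2) (w q.1 q.2))) p

namespace IsEquationData

variable {a b φ₁ φ₂ ρ₁ ρ₂ R : ℝ} {F : ℝ → ℝ → CFuzzy → CFuzzy → CFuzzy} {ξ₁ ξ₂ : ℝ → CFuzzy}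
  {v w v' w' : ℝ → ℝ → CFuzzy}

/-- The Lipschitz condition compares the nonlinearity with its bounded values at `(0, 0)`, while `v`
and `w` are bounded on the compact rectangle. -/
theorem boundedContOn (H : IsEquationData a b φ₁ φ₂ ρ₁ ρ₂ R F ξ₁ ξ₂)
    (hv : ContinuousOn (fun q : ℝ × ℝ => v q.1 q.2) (Icc 0 a ×ˢ Icc 0 b))
    (hw : ContinuousOn (fun q : ℝ × ℝ => w q.1 q.2) (Icc 0 a ×ˢ Icc 0 b)) :
    BoundedContOn a b fun q => emb (F q.1 q.2 (v q.1 q.2) (w q.1 q.2)) := by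
  have hsub : Ioc 0 a ×ˢ Ioc 0 b ⊆ Icc 0 a ×ˢ Icc 0 b :=
    prod_mono Ioc_subset_Icc_self Ioc_subset_Icc_self
  obtain ⟨Mv, hMv⟩ := (BoundedContOn.of_continuousOn_Icc
    (isometry_emb.continuous.comp_continuousOn hv)).bounded
  obtain ⟨Mw, hMw⟩ := (BoundedContOn.of_continuousOn_Icc
    (isometry_emb.continuous.comp_continuousOn hw)).bounded
  obtain ⟨M, hM⟩ := H.bounded
  refine ⟨isometry_emb.continuous.comp_continuousOn ?_, R * (Mv + Mw) + M, fun q hq => ?_⟩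
  · exact H.continuousOn.comp (f := fun q : ℝ × ℝ => (q.1, q.2, v q.1 q.2, w q.1 q.2))
      (continuousOn_fst.prodMk (continuousOn_snd.prodMk ((hv.mono hsub).prodMk (hw.mono hsub))))
      fun q hq => ⟨hq.1, hq.2, mem_univ _⟩
  · have h1 := hMv q hq
    have h2 := hMw q hq
    simp only [Function.comp_apply, norm_emb] at h1 h2 ⊢
    refine (dist_triangle _ (F q.1 q.2 0 0) _).trans (add_le_add ?_ (hM _ hq.1 _ hq.2))
    exact (H.lip _ hq.1 _ hq.2 _ _ _ _).trans
      (mul_le_mul_of_nonneg_left (add_le_add h1 h2) H.lip_pos.le)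

/-- Existence of the Hukuhara difference on the `y`-axis keeps the right-hand side in the cone,
where a difference of two elements need not lie. -/
theorem exists_emb_eq_integralRhs (H : IsEquationData a b φ₁ φ₂ ρ₁ ρ₂ R F ξ₁ ξ₂)
    (v w : ℝ → ℝ → CFuzzy) {p : ℝ × ℝ} (hp : p.2 ∈ Icc 0 b) :
    ∃ z, emb z = integralRhs φ₁ φ₂ ρ₁ ρ₂ F ξ₁ ξ₂ v w p := by
  obtain ⟨k, hk⟩ := H.exists_diff _ hp
  obtain ⟨J, hJ⟩ := exists_emb_eq_katInt φ₁ φ₂ ρ₁ ρ₂ (fun s t => F s t (v s t) (w s t)) p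
  exact ⟨ξ₁ p.1 + k + J, by rw [integralRhs, isHDiff_iff.1 hk, ← hJ, emb_add, emb_add]⟩

theorem continuousOn_integralRhs (H : IsEquationData a b φ₁ φ₂ ρ₁ ρ₂ R F ξ₁ ξ₂)
    (hv : ContinuousOn (fun q : ℝ × ℝ => v q.1 q.2) (Icc 0 a ×ˢ Icc 0 b))
    (hw : ContinuousOn (fun q : ℝ × ℝ => w q.1 q.2) (Icc 0 a ×ˢ Icc 0 b)) :
    ContinuousOn (integralRhs φ₁ φ₂ ρ₁ ρ₂ F ξ₁ ξ₂ v w) (Icc 0 a ×ˢ Icc 0 b) := by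
  have e1 : ContinuousOn (fun p : ℝ × ℝ => emb (ξ₁ p.1)) (Icc 0 a ×ˢ Icc 0 b) :=
    isometry_emb.continuous.comp_continuousOn
      (H.continuousOn_xAxis.comp continuousOn_fst fun p hp => hp.1)
  have e2 : ContinuousOn (fun p : ℝ × ℝ => emb (ξ₂ p.2)) (Icc 0 a ×ˢ Icc 0 b) :=
    isometry_emb.continuous.comp_continuousOn
      (H.continuousOn_yAxis.comp continuousOn_snd fun p hp => hp.2)
  exact (e1.add (e2.sub continuousOn_const)).add ((H.boundedContOn hv hw).continuousOn_katInt
    H.order_fst.1 H.order_snd.1 H.rho_fst H.rho_snd)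

theorem eventually_contraction (H : IsEquationData a b φ₁ φ₂ ρ₁ ρ₂ R F ξ₁ ξ₂) :
    ∀ᶠ l : ℝ in atTop, ∀ D, 0 ≤ D → ∀ v w v' w' : ℝ → ℝ → CFuzzy,
      ContinuousOn (fun q : ℝ × ℝ => v q.1 q.2) (Icc 0 a ×ˢ Icc 0 b) →
      ContinuousOn (fun q : ℝ × ℝ => w q.1 q.2) (Icc 0 a ×ˢ Icc 0 b) →
      ContinuousOn (fun q : ℝ × ℝ => v' q.1 q.2) (Icc 0 a ×ˢ Icc 0 b) →
      ContinuousOn (fun q : ℝ × ℝ => w' q.1 q.2) (Icc 0 a ×ˢ Icc 0 b) →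
      (∀ q ∈ Icc 0 a ×ˢ Icc 0 b, dist (v q.1 q.2) (v' q.1 q.2) ≤ D * Real.exp (l * q.1)) →
      (∀ q ∈ Icc 0 a ×ˢ Icc 0 b, dist (w q.1 q.2) (w' q.1 q.2) ≤ D * Real.exp (l * q.1)) →
      ∀ p ∈ Icc 0 a ×ˢ Icc 0 b, ‖integralRhs φ₁ φ₂ ρ₁ ρ₂ F ξ₁ ξ₂ v w p -
        integralRhs φ₁ φ₂ ρ₁ ρ₂ F ξ₁ ξ₂ v' w' p‖ ≤ D / 2 * Real.exp (l * p.1) := by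
  have hR := H.lip_pos
  filter_upwards [eventually_katInt_exp_le H.order_fst.1 H.order_snd.1 H.rho_fst H.rho_snd
    -- The two Lipschitz terms contribute `2 * R * D`, and multiplying by `1 / (4 * R)` leaves `D /
    -- 2`.
    H.a_pos H.b_pos (ε := 1 / (4 * R)) (by positivity)] with l hl
  intro D hD v w v' w' hv hw hv' hw' hvv hww p hp
  rw [integralRhs, integralRhs, add_sub_add_left_eq_sub]
  by_cases h0 : 0 < p.1 ∧ 0 < p.2
  · have hp' : p ∈ Ioc 0 a ×ˢ Ioc 0 b := ⟨⟨h0.1, hp.1.2⟩, ⟨h0.2, hp.2.2⟩⟩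
    refine (norm_katInt_sub_le (H.boundedContOn hv hw) (H.boundedContOn hv' hw')
      H.order_fst.1.le H.order_snd.1.le H.rho_fst H.rho_snd (l := l) (C := 2 * R * D) hp'
      fun q hq => ?_).trans ?_
    · have hq' : q ∈ Icc 0 a ×ˢ Icc 0 b :=
        ⟨Ioc_subset_Icc_self hq.1, Ioc_subset_Icc_self hq.2⟩
      rw [dist_emb]
      refine (H.lip _ hq.1 _ hq.2 _ _ _ _).trans ?_
      calc R * (dist (v q.1 q.2) (v' q.1 q.2) + dist (w q.1 q.2) (w' q.1 q.2))
          ≤ R * (D * Real.exp (l * q.1) + D * Real.exp (l * q.1)) :=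
            mul_le_mul_of_nonneg_left (add_le_add (hvv q hq') (hww q hq')) hR.le
        _ = 2 * R * D * Real.exp (l * q.1) := by ring
    · calc _ ≤ 2 * R * D * (1 / (4 * R) * Real.exp (l * p.1)) :=
            mul_le_mul_of_nonneg_left (hl p hp') (by positivity)
        _ = D / 2 * Real.exp (l * p.1) := by field_simp; ring
  · have h0' : p.1 ≤ 0 ∨ p.2 ≤ 0 := (not_and_or.1 h0).imp not_lt.1 not_lt.1
    rw [katInt_eq_zero H.order_fst.1 H.order_snd.1 _ h0',
      katInt_eq_zero H.order_fst.1 H.order_snd.1 _ h0', sub_self, norm_zero]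
    positivity

theorem integral_equation_iff (H : IsEquationData a b φ₁ φ₂ ρ₁ ρ₂ R F ξ₁ ξ₂)
    (hv : ContinuousOn (fun q : ℝ × ℝ => v q.1 q.2) (Icc 0 a ×ˢ Icc 0 b))
    (hw : ContinuousOn (fun q : ℝ × ℝ => w q.1 q.2) (Icc 0 a ×ˢ Icc 0 b)) {x y : ℝ}
    (hx : x ∈ Icc 0 a) (hy : y ∈ Icc 0 b) (z : CFuzzy) :
    (∃ k J : CFuzzy, IsHDiff (ξ₂ y) (ξ₁ 0) k ∧
      IsKatIntegral φ₁ φ₂ ρ₁ ρ₂ (fun s t => F s t (v s t) (w s t)) x y J ∧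
      z = ξ₁ x + k + J) ↔ emb z = integralRhs φ₁ φ₂ ρ₁ ρ₂ F ξ₁ ξ₂ v w (x, y) := by
  have hint : Integrable (fun q : ℝ × ℝ => emb (F q.1 q.2 (v q.1 q.2) (w q.1 q.2)))
      (katProd φ₁ φ₂ ρ₁ ρ₂ (x, y)) := by
    by_cases h0 : 0 < x ∧ 0 < y
    · exact (H.boundedContOn hv hw).integrable H.order_fst.1.le H.order_snd.1.le H.rho_fst
        H.rho_snd (p := (x, y)) ⟨⟨h0.1, hx.2⟩, ⟨h0.2, hy.2⟩⟩
    · rw [katProd_eq_zero H.order_fst.1 H.order_snd.1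
        ((not_and_or.1 h0).imp not_lt.1 not_lt.1)]
      exact integrable_zero_measure
  rw [integralRhs]
  constructor
  · rintro ⟨k, J, hk, hJ, rfl⟩
    rw [isHDiff_iff.1 hk, ← (isKatIntegral_iff (u := fun s t => F s t (v s t) (w s t)) hint).1 hJ,
      emb_add, emb_add]
  · intro hz
    obtain ⟨k, hk⟩ := H.exists_diff y hy
    obtain ⟨J, hJ⟩ :=
      exists_emb_eq_katInt φ₁ φ₂ ρ₁ ρ₂ (fun s t => F s t (v s t) (w s t)) (x, y)
    refine ⟨k, J, hk, (isKatIntegral_iff (u := fun s t => F s t (v s t) (w s t)) hint).2 hJ,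
      emb_injective ?_⟩
    rw [hz, isHDiff_iff.1 hk, ← hJ, emb_add, emb_add]

/-- The unknown `z` is kept apart from the arguments `v` and `w` of the nonlinearity, so one
statement serves both equations. The axis conditions come out of the integral equation because the
fractional integral vanishes on the axes. -/
theorem differential_equation_iff (H : IsEquationData a b φ₁ φ₂ ρ₁ ρ₂ R F ξ₁ ξ₂)
    (hv : ContinuousOn (fun q : ℝ × ℝ => v q.1 q.2) (Icc 0 a ×ˢ Icc 0 b))
    (hw : ContinuousOn (fun q : ℝ × ℝ => w q.1 q.2) (Icc 0 a ×ˢ Icc 0 b))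
    {z : ℝ → ℝ → CFuzzy}
    (hz : ContinuousOn (fun q : ℝ × ℝ => z q.1 q.2) (Icc 0 a ×ˢ Icc 0 b)) :
    (HasCKDeriv1 a b φ₁ φ₂ ρ₁ ρ₂ z (fun x y => F x y (v x y) (w x y)) ∧
      (∀ x ∈ Icc 0 a, z x 0 = ξ₁ x) ∧ ∀ y ∈ Icc 0 b, z 0 y = ξ₂ y) ↔
    ∀ x ∈ Icc 0 a, ∀ y ∈ Icc 0 b,
      emb (z x y) = integralRhs φ₁ φ₂ ρ₁ ρ₂ F ξ₁ ξ₂ v w (x, y) := by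
  have h0a : (0 : ℝ) ∈ Icc 0 a := ⟨le_rfl, H.a_pos.le⟩
  have h0b : (0 : ℝ) ∈ Icc 0 b := ⟨le_rfl, H.b_pos.le⟩
  have hg := H.boundedContOn hv hw
  constructor
  · rintro ⟨hd, hx₀, hy₀⟩ x hx y hy
    rw [HasCKDeriv1.emb_eq (g := fun x y => F x y (v x y) (w x y)) H.order_fst H.order_snd
      H.rho_fst H.rho_snd H.a_pos H.b_pos hg hz hd hx hy, hx₀ x hx, hy₀ y hy, hx₀ 0 h0a, integralRhs]
  · intro h
    have hx₀ : ∀ x ∈ Icc 0 a, z x 0 = ξ₁ x := fun x hx => emb_injective (by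
      rw [h x hx 0 h0b, integralRhs,
        katInt_eq_zero H.order_fst.1 H.order_snd.1 _ (p := (x, 0)) (Or.inr le_rfl), H.corner]
      simp)
    have hy₀ : ∀ y ∈ Icc 0 b, z 0 y = ξ₂ y := fun y hy => emb_injective (by
      rw [h 0 h0a y hy, integralRhs,
        katInt_eq_zero H.order_fst.1 H.order_snd.1 _ (p := (0, y)) (Or.inl le_rfl)]
      simp)
    refine ⟨hasCKDeriv1_of_emb_eq (g := fun x y => F x y (v x y) (w x y)) H.order_fst
      H.order_snd H.rho_fst H.rho_snd hg ?_ ?_, hx₀, hy₀⟩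
    · intro y hy
      rw [hy₀ y hy, hx₀ 0 h0a]
      exact H.exists_diff y hy
    · intro x hx y hy
      rw [h x hx y hy, hx₀ x hx, hy₀ y hy, hx₀ 0 h0a, integralRhs]

end IsEquationData

/-! ### The coupled system. -/

section System

variable {a b φ₁ φ₂ ψ₁ ψ₂ ρ₁ ρ₂ R₁ R₂ : ℝ} {F G : ℝ → ℝ → CFuzzy → CFuzzy → CFuzzy}
  {ξ₁ ξ₂ η₁ η₂ : ℝ → CFuzzy}

/-- Extension of a function on a rectangle to the plane, constant in each variable outside of the
rectangle. -/
noncomputable def rectExtend {Y : Type*} (ha : 0 ≤ a) (hb : 0 ≤ b)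
    (f : Icc 0 a × Icc 0 b → Y) (x y : ℝ) : Y := f (projIcc 0 a ha x, projIcc 0 b hb y)

theorem rectExtend_coe {Y : Type*} (ha : 0 ≤ a) (hb : 0 ≤ b) (f : Icc 0 a × Icc 0 b → Y)
    {x y : ℝ} (hx : x ∈ Icc 0 a) (hy : y ∈ Icc 0 b) :
    rectExtend ha hb f x y = f (⟨x, hx⟩, ⟨y, hy⟩) := by
  rw [rectExtend, projIcc_of_mem ha hx, projIcc_of_mem hb hy]

theorem continuous_rectExtend {Y : Type*} [TopologicalSpace Y] (ha : 0 ≤ a) (hb : 0 ≤ b)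
    {f : Icc 0 a × Icc 0 b → Y} (hf : Continuous f) :
    Continuous fun q : ℝ × ℝ => rectExtend ha hb f q.1 q.2 :=
  hf.comp ((continuous_projIcc.comp continuous_fst).prodMk (continuous_projIcc.comp continuous_snd))

/-- `(v, w)` is continuous and solves the integral system, in terms of end point functions. -/
structure IsEmbSolution (a b φ₁ φ₂ ψ₁ ψ₂ ρ₁ ρ₂ : ℝ) (F G : ℝ → ℝ → CFuzzy → CFuzzy → CFuzzy)
    (ξ₁ ξ₂ η₁ η₂ : ℝ → CFuzzy) (v w : ℝ → ℝ → CFuzzy) : Prop where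
  continuousOn_fst : ContinuousOn (fun p : ℝ × ℝ => v p.1 p.2) (Icc 0 a ×ˢ Icc 0 b)
  continuousOn_snd : ContinuousOn (fun p : ℝ × ℝ => w p.1 p.2) (Icc 0 a ×ˢ Icc 0 b)
  eq_fst : ∀ x ∈ Icc 0 a, ∀ y ∈ Icc 0 b,
    emb (v x y) = integralRhs φ₁ φ₂ ρ₁ ρ₂ F ξ₁ ξ₂ v w (x, y)
  eq_snd : ∀ x ∈ Icc 0 a, ∀ y ∈ Icc 0 b,
    emb (w x y) = integralRhs ψ₁ ψ₂ ρ₁ ρ₂ G η₁ η₂ v w (x, y)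

theorem isSolution_iff (HF : IsEquationData a b φ₁ φ₂ ρ₁ ρ₂ R₁ F ξ₁ ξ₂)
    (HG : IsEquationData a b ψ₁ ψ₂ ρ₁ ρ₂ R₂ G η₁ η₂) {v w : ℝ → ℝ → CFuzzy} :
    IsSolution a b φ₁ φ₂ ψ₁ ψ₂ ρ₁ ρ₂ F G ξ₁ ξ₂ η₁ η₂ v w ↔
      IsEmbSolution a b φ₁ φ₂ ψ₁ ψ₂ ρ₁ ρ₂ F G ξ₁ ξ₂ η₁ η₂ v w := by
  constructor
  · rintro ⟨hv, hw, h1, h2, h3, h4, h5, h6⟩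
    exact ⟨hv, hw, (HF.differential_equation_iff hv hw hv).1 ⟨h1, h3, h4⟩,
      (HG.differential_equation_iff hv hw hw).1 ⟨h2, h5, h6⟩⟩
  · rintro ⟨hv, hw, h1, h2⟩
    obtain ⟨k1, k2, k3⟩ := (HF.differential_equation_iff hv hw hv).2 h1
    obtain ⟨l1, l2, l3⟩ := (HG.differential_equation_iff hv hw hw).2 h2
    exact ⟨hv, hw, k1, l1, k2, k3, l2, l3⟩

theorem isIntegralSolution_iff (HF : IsEquationData a b φ₁ φ₂ ρ₁ ρ₂ R₁ F ξ₁ ξ₂)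
    (HG : IsEquationData a b ψ₁ ψ₂ ρ₁ ρ₂ R₂ G η₁ η₂) {v w : ℝ → ℝ → CFuzzy} :
    IsIntegralSolution a b φ₁ φ₂ ψ₁ ψ₂ ρ₁ ρ₂ F G ξ₁ ξ₂ η₁ η₂ v w ↔
      IsEmbSolution a b φ₁ φ₂ ψ₁ ψ₂ ρ₁ ρ₂ F G ξ₁ ξ₂ η₁ η₂ v w := by
  constructor
  · rintro ⟨hv, hw, h1, h2⟩
    exact ⟨hv, hw, fun x hx y hy => (HF.integral_equation_iff hv hw hx hy _).1 (h1 x hx y hy),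
      fun x hx y hy => (HG.integral_equation_iff hv hw hx hy _).1 (h2 x hx y hy)⟩
  · rintro ⟨hv, hw, h1, h2⟩
    exact ⟨hv, hw, fun x hx y hy => (HF.integral_equation_iff hv hw hx hy _).2 (h1 x hx y hy),
      fun x hx y hy => (HG.integral_equation_iff hv hw hx hy _).2 (h2 x hx y hy)⟩

theorem IsEquationData.exists_picard (H : IsEquationData a b φ₁ φ₂ ρ₁ ρ₂ R₁ F ξ₁ ξ₂)
    (V : C(Icc 0 a × Icc 0 b, CFuzzy × CFuzzy)) :
    ∃ z : C(Icc 0 a × Icc 0 b, CFuzzy), ∀ p, emb (z p) =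
      integralRhs φ₁ φ₂ ρ₁ ρ₂ F ξ₁ ξ₂
        (rectExtend H.a_pos.le H.b_pos.le fun p => (V p).1)
        (rectExtend H.a_pos.le H.b_pos.le fun p => (V p).2) (p.1, p.2) := by
  choose z hz using fun p : Icc 0 a × Icc 0 b => H.exists_emb_eq_integralRhs
    (rectExtend H.a_pos.le H.b_pos.le fun p => (V p).1)
    (rectExtend H.a_pos.le H.b_pos.le fun p => (V p).2) (p := (p.1, p.2)) p.2.2
  refine ⟨⟨z, isometry_emb.isEmbedding.continuous_iff.2 ?_⟩, hz⟩
  have hc := H.continuousOn_integralRhs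
    (continuous_rectExtend H.a_pos.le H.b_pos.le V.continuous.fst).continuousOn
    (continuous_rectExtend H.a_pos.le H.b_pos.le V.continuous.snd).continuousOn
  have : emb ∘ z = fun p : Icc 0 a × Icc 0 b => integralRhs φ₁ φ₂ ρ₁ ρ₂ F ξ₁ ξ₂
        (rectExtend H.a_pos.le H.b_pos.le fun p => (V p).1)
        (rectExtend H.a_pos.le H.b_pos.le fun p => (V p).2) (p.1, p.2) := funext hz
  rw [this]
  exact hc.comp_continuous (by fun_prop) fun p => ⟨p.1.2, p.2.2⟩

theorem integralRhs_congr (H : IsEquationData a b φ₁ φ₂ ρ₁ ρ₂ R₁ F ξ₁ ξ₂)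
    {v w v' w' : ℝ → ℝ → CFuzzy} (hv : ∀ x ∈ Icc 0 a, ∀ y ∈ Icc 0 b, v x y = v' x y)
    (hw : ∀ x ∈ Icc 0 a, ∀ y ∈ Icc 0 b, w x y = w' x y) {p : ℝ × ℝ}
    (hp : p ∈ Icc 0 a ×ˢ Icc 0 b) :
    integralRhs φ₁ φ₂ ρ₁ ρ₂ F ξ₁ ξ₂ v w p = integralRhs φ₁ φ₂ ρ₁ ρ₂ F ξ₁ ξ₂ v' w' p := by
  rw [integralRhs, integralRhs]
  congr 1
  by_cases h0 : 0 < p.1 ∧ 0 < p.2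
  · refine katInt_congr H.order_fst.1.le H.order_snd.1.le (a := a) (b := b)
      ⟨⟨h0.1, hp.1.2⟩, ⟨h0.2, hp.2.2⟩⟩ fun q hq => ?_
    rw [hv _ (Ioc_subset_Icc_self hq.1) _ (Ioc_subset_Icc_self hq.2),
      hw _ (Ioc_subset_Icc_self hq.1) _ (Ioc_subset_Icc_self hq.2)]
  · have h0' : p.1 ≤ 0 ∨ p.2 ≤ 0 := (not_and_or.1 h0).imp not_lt.1 not_lt.1
    rw [katInt_eq_zero H.order_fst.1 H.order_snd.1 _ h0',
      katInt_eq_zero H.order_fst.1 H.order_snd.1 _ h0']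

theorem existsUnique_isEmbSolution (HF : IsEquationData a b φ₁ φ₂ ρ₁ ρ₂ R₁ F ξ₁ ξ₂)
    (HG : IsEquationData a b ψ₁ ψ₂ ρ₁ ρ₂ R₂ G η₁ η₂) :
    ∃ v w, IsEmbSolution a b φ₁ φ₂ ψ₁ ψ₂ ρ₁ ρ₂ F G ξ₁ ξ₂ η₁ η₂ v w ∧
      ∀ v' w', IsEmbSolution a b φ₁ φ₂ ψ₁ ψ₂ ρ₁ ρ₂ F G ξ₁ ξ₂ η₁ η₂ v' w' →
        ∀ x ∈ Icc 0 a, ∀ y ∈ Icc 0 b, v' x y = v x y ∧ w' x y = w x y := by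
  have ha := HF.a_pos.le
  have hb := HF.b_pos.le
  choose z₁ hz₁ using HF.exists_picard
  choose z₂ hz₂ using HG.exists_picard
  let T : C(Icc 0 a × Icc 0 b, CFuzzy × CFuzzy) → C(Icc 0 a × Icc 0 b, CFuzzy × CFuzzy) :=
    fun V => (z₁ V).prodMk (z₂ V)
  -- One rate `l` must serve both equations; `l ≥ 0` makes the weight lie between `1` and `exp (l *
  -- a)`.
  obtain ⟨l, hlF, hlG, hl0⟩ := (HF.eventually_contraction.and
    (HG.eventually_contraction.and (eventually_ge_atTop 0))).exists
  let m : Icc 0 a × Icc 0 b → ℝ := fun p => Real.exp (l * p.1)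
  have hm : ∀ p, 1 ≤ m p := fun p => Real.one_le_exp (mul_nonneg hl0 p.1.2.1)
  have hmM : ∀ p, m p ≤ Real.exp (l * a) := fun p =>
    Real.exp_le_exp.2 (mul_le_mul_of_nonneg_left p.1.2.2 hl0)
  have hT : ∀ D, 0 ≤ D → ∀ V W : C(Icc 0 a × Icc 0 b, CFuzzy × CFuzzy),
      (∀ p, dist (V p) (W p) ≤ D * m p) → ∀ p, dist (T V p) (T W p) ≤ D / 2 * m p := by
    intro D hD V W hVW p
    have c1 := fun V : C(Icc 0 a × Icc 0 b, CFuzzy × CFuzzy) =>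
      (continuous_rectExtend ha hb V.continuous.fst).continuousOn (s := Icc 0 a ×ˢ Icc 0 b)
    have c2 := fun V : C(Icc 0 a × Icc 0 b, CFuzzy × CFuzzy) =>
      (continuous_rectExtend ha hb V.continuous.snd).continuousOn (s := Icc 0 a ×ˢ Icc 0 b)
    have d1 : ∀ q ∈ Icc 0 a ×ˢ Icc 0 b, dist (rectExtend ha hb (fun p => (V p).1) q.1 q.2)
        (rectExtend ha hb (fun p => (W p).1) q.1 q.2) ≤ D * Real.exp (l * q.1) := by
      intro q hq
      rw [rectExtend_coe ha hb _ hq.1 hq.2, rectExtend_coe ha hb _ hq.1 hq.2]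
      exact (le_max_left _ _).trans (hVW (⟨q.1, hq.1⟩, ⟨q.2, hq.2⟩))
    have d2 : ∀ q ∈ Icc 0 a ×ˢ Icc 0 b, dist (rectExtend ha hb (fun p => (V p).2) q.1 q.2)
        (rectExtend ha hb (fun p => (W p).2) q.1 q.2) ≤ D * Real.exp (l * q.1) := by
      intro q hq
      rw [rectExtend_coe ha hb _ hq.1 hq.2, rectExtend_coe ha hb _ hq.1 hq.2]
      exact (le_max_right _ _).trans (hVW (⟨q.1, hq.1⟩, ⟨q.2, hq.2⟩))
    have hp : ((p.1 : ℝ), (p.2 : ℝ)) ∈ Icc 0 a ×ˢ Icc 0 b := ⟨p.1.2, p.2.2⟩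
    rw [Prod.dist_eq]
    refine max_le ?_ ?_
    · change dist (z₁ V p) (z₁ W p) ≤ _
      rw [← dist_emb, hz₁, hz₁]
      exact hlF D hD _ _ _ _ (c1 V) (c2 V) (c1 W) (c2 W) d1 d2 _ hp
    · change dist (z₂ V p) (z₂ W p) ≤ _
      rw [← dist_emb, hz₂, hz₂]
      exact hlG D hD _ _ _ _ (c1 V) (c2 V) (c1 W) (c2 W) d1 d2 _ hp
  have hM0 : 0 ≤ Real.exp (l * a) := (Real.exp_pos _).le
  have : Nonempty (CFuzzy × CFuzzy) := ⟨(0, 0)⟩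
  obtain ⟨V, hV⟩ := exists_fixed_of_weighted hM0 hm hmM hT
  refine ⟨rectExtend ha hb fun p => (V p).1, rectExtend ha hb fun p => (V p).2,
    ⟨?_, ?_, ?_, ?_⟩, ?_⟩
  · exact (continuous_rectExtend ha hb V.continuous.fst).continuousOn
  · exact (continuous_rectExtend ha hb V.continuous.snd).continuousOn
  · intro x hx y hy
    have h : (V (⟨x, hx⟩, ⟨y, hy⟩)).1 = z₁ V (⟨x, hx⟩, ⟨y, hy⟩) :=
      (congrArg Prod.fst (DFunLike.congr_fun hV (⟨x, hx⟩, ⟨y, hy⟩))).symm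
    rw [rectExtend_coe ha hb _ hx hy, h, hz₁ V (⟨x, hx⟩, ⟨y, hy⟩)]
  · intro x hx y hy
    have h : (V (⟨x, hx⟩, ⟨y, hy⟩)).2 = z₂ V (⟨x, hx⟩, ⟨y, hy⟩) :=
      (congrArg Prod.snd (DFunLike.congr_fun hV (⟨x, hx⟩, ⟨y, hy⟩))).symm
    rw [rectExtend_coe ha hb _ hx hy, h, hz₂ V (⟨x, hx⟩, ⟨y, hy⟩)]
  · intro v' w' h x hx y hy
    -- A competing solution is restricted to the rectangle. Its extension agrees with it only there,
    -- which suffices because the right-hand side sees no other values.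
    let V' : C(Icc 0 a × Icc 0 b, CFuzzy × CFuzzy) :=
      ⟨fun p => (v' p.1 p.2, w' p.1 p.2), by
        have hc := h.continuousOn_fst.prodMk h.continuousOn_snd
        exact hc.comp_continuous (f := fun p : Icc 0 a × Icc 0 b => ((p.1 : ℝ), (p.2 : ℝ)))
          (by fun_prop) fun p => ⟨p.1.2, p.2.2⟩⟩
    have e1 : ∀ x ∈ Icc 0 a, ∀ y ∈ Icc 0 b,
        rectExtend ha hb (fun p => (V' p).1) x y = v' x y := fun x hx y hy =>
      rectExtend_coe ha hb _ hx hy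
    have e2 : ∀ x ∈ Icc 0 a, ∀ y ∈ Icc 0 b,
        rectExtend ha hb (fun p => (V' p).2) x y = w' x y := fun x hx y hy =>
      rectExtend_coe ha hb _ hx hy
    have hV' : T V' = V' := by
      ext1 p
      have hp : ((p.1 : ℝ), (p.2 : ℝ)) ∈ Icc 0 a ×ˢ Icc 0 b := ⟨p.1.2, p.2.2⟩
      refine Prod.ext (emb_injective ?_) (emb_injective ?_)
      · exact ((hz₁ V' p).trans (integralRhs_congr HF e1 e2 hp)).trans
          (h.eq_fst _ p.1.2 _ p.2.2).symm
      · exact ((hz₂ V' p).trans (integralRhs_congr HG e1 e2 hp)).trans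
          (h.eq_snd _ p.1.2 _ p.2.2).symm
    have heq := eq_of_fixed_of_weighted hm hmM hT hV' hV
    rw [← e1 x hx y hy, ← e2 x hx y hy, heq]
    exact ⟨rfl, rfl⟩

end System

end CFuzzy

theorem mainTheorem4 (a b φ₁ φ₂ ψ₁ ψ₂ ρ₁ ρ₂ R₁ R₂ : ℝ)
    (ha : 0 < a) (hb : 0 < b)
    (hφ₁ : φ₁ ∈ Set.Ioc (0 : ℝ) 1) (hφ₂ : φ₂ ∈ Set.Ioc (0 : ℝ) 1)
    (hψ₁ : ψ₁ ∈ Set.Ioc (0 : ℝ) 1) (hψ₂ : ψ₂ ∈ Set.Ioc (0 : ℝ) 1)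
    (hρ₁ : 0 < ρ₁) (hρ₂ : 0 < ρ₂) (hR₁ : 0 < R₁) (hR₂ : 0 < R₂)
    (F G : ℝ → ℝ → CFuzzy → CFuzzy → CFuzzy)
    (ξ₁ ξ₂ η₁ η₂ : ℝ → CFuzzy)
    (hFcont : ContinuousOn (fun p : ℝ × ℝ × CFuzzy × CFuzzy => F p.1 p.2.1 p.2.2.1 p.2.2.2)
      (Set.Ioc 0 a ×ˢ Set.Ioc 0 b ×ˢ Set.univ))
    (hGcont : ContinuousOn (fun p : ℝ × ℝ × CFuzzy × CFuzzy => G p.1 p.2.1 p.2.2.1 p.2.2.2)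
      (Set.Ioc 0 a ×ˢ Set.Ioc 0 b ×ˢ Set.univ))
    (hFbdd : ∃ M : ℝ, ∀ x ∈ Set.Ioc 0 a, ∀ y ∈ Set.Ioc 0 b, dist (F x y 0 0) 0 ≤ M)
    (hGbdd : ∃ M : ℝ, ∀ x ∈ Set.Ioc 0 a, ∀ y ∈ Set.Ioc 0 b, dist (G x y 0 0) 0 ≤ M)
    (hFlip : ∀ x ∈ Set.Ioc 0 a, ∀ y ∈ Set.Ioc 0 b, ∀ v w v' w' : CFuzzy,
      dist (F x y v w) (F x y v' w') ≤ R₁ * (dist v v' + dist w w'))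
    (hGlip : ∀ x ∈ Set.Ioc 0 a, ∀ y ∈ Set.Ioc 0 b, ∀ v w v' w' : CFuzzy,
      dist (G x y v w) (G x y v' w') ≤ R₂ * (dist v v' + dist w w'))
    (hξ₁ : ContinuousOn ξ₁ (Set.Icc 0 a)) (hξ₂ : ContinuousOn ξ₂ (Set.Icc 0 b))
    (hη₁ : ContinuousOn η₁ (Set.Icc 0 a)) (hη₂ : ContinuousOn η₂ (Set.Icc 0 b))
    (hξ : ξ₁ 0 = ξ₂ 0) (hη : η₁ 0 = η₂ 0)
    (hξdiff : ∀ y ∈ Set.Icc 0 b, ∃ k, CFuzzy.IsHDiff (ξ₂ y) (ξ₁ 0) k)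
    (hηdiff : ∀ y ∈ Set.Icc 0 b, ∃ k, CFuzzy.IsHDiff (η₂ y) (η₁ 0) k)
    (hΞ₁ : R₁ / (Real.Gamma (φ₁ + 1) * Real.Gamma (φ₂ + 1)) *
      (a ^ ρ₁ / ρ₁) ^ φ₁ * (b ^ ρ₂ / ρ₂) ^ φ₂ < 1)
    (hΞ₂ : R₂ / (Real.Gamma (ψ₁ + 1) * Real.Gamma (ψ₂ + 1)) *
      (a ^ ρ₁ / ρ₁) ^ ψ₁ * (b ^ ρ₂ / ρ₂) ^ ψ₂ < 1) :
    ∃ v w : ℝ → ℝ → CFuzzy,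
      CFuzzy.IsSolution a b φ₁ φ₂ ψ₁ ψ₂ ρ₁ ρ₂ F G ξ₁ ξ₂ η₁ η₂ v w ∧
      CFuzzy.IsIntegralSolution a b φ₁ φ₂ ψ₁ ψ₂ ρ₁ ρ₂ F G ξ₁ ξ₂ η₁ η₂ v w ∧
      ∀ v' w' : ℝ → ℝ → CFuzzy,
        (CFuzzy.IsSolution a b φ₁ φ₂ ψ₁ ψ₂ ρ₁ ρ₂ F G ξ₁ ξ₂ η₁ η₂ v' w' ∨
          CFuzzy.IsIntegralSolution a b φ₁ φ₂ ψ₁ ψ₂ ρ₁ ρ₂ F G ξ₁ ξ₂ η₁ η₂ v' w') →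
        ∀ x ∈ Set.Icc 0 a, ∀ y ∈ Set.Icc 0 b, v' x y = v x y ∧ w' x y = w x y := by
  have HF : CFuzzy.IsEquationData a b φ₁ φ₂ ρ₁ ρ₂ R₁ F ξ₁ ξ₂ :=
    ⟨ha, hb, hφ₁, hφ₂, hρ₁, hρ₂, hR₁, hFcont, hFbdd, hFlip, hξ₁, hξ₂, hξ, hξdiff⟩
  have HG : CFuzzy.IsEquationData a b ψ₁ ψ₂ ρ₁ ρ₂ R₂ G η₁ η₂ :=
    ⟨ha, hb, hψ₁, hψ₂, hρ₁, hρ₂, hR₂, hGcont, hGbdd, hGlip, hη₁, hη₂, hη, hηdiff⟩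
  obtain ⟨v, w, h, hu⟩ := CFuzzy.existsUnique_isEmbSolution HF HG
  refine ⟨v, w, (CFuzzy.isSolution_iff HF HG).2 h, (CFuzzy.isIntegralSolution_iff HF HG).2 h, ?_⟩
  rintro v' w' (h' | h')
  · exact hu v' w' ((CFuzzy.isSolution_iff HF HG).1 h')
  · exact hu v' w' ((CFuzzy.isIntegralSolution_iff HF HG).1 h')
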